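/- Let $n\ge 2$, let $D=\overline{\operatorname{int} D}\subset\mathbb R^n$ be compact, and let $\Gamma_1,\dots,\Gamma_s\subset\mathbb R^n$ be closed embedded $C^\infty$ hypersurfaces with $\partial D\subseteq\Gamma_1\cup\dots\cup\Gamma_s$, in general position: at every point of $\mathbb R^n$, the normals of those $\Gamma_j$ that pass through the point are linearly independent. Let $\mathbb{RP}_n$ have homogeneous coordinates $(\alpha:p)$, $\alpha\in\mathbb R^n$, $p\in\mathbb R$, and for $\alpha\ne0$ let $l_{\alpha p}=\{x:\alpha\cdot x=p\}$. For a submanifold $B\subset\mathbb R^n$, the plane $l_{\alpha p}$ is tangent to $B$ at $x\in B$ if it passes through $x$ and is not transversal to $B$ at $x$; $\widehat B\subset\mathbb{RP}_n$ denotes the set of all $(\alpha:p)$ for which $l_{\alpha p}$ is tangent to $B$ at some point. **(a)** Let $m\ge1$ and let $B_m$ be the intersection of $m$ distinct surfaces among the $\Gamma_j$. If $B_m$ is nonempty, then $m-1$ principal curvatures of $\widehat B_m$ vanish identically. That is: if $S$ is a smooth hypersurface in an affine chart $\mathbb R^n$ of $\mathbb{RP}_n$ (with respect to any linear homogeneous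 coordinates) and $S\subseteq\widehat B_m$, then at each point of $S$ at least $m-1$ principal curvatures of $S$, counted with multiplicity, are zero. **(b)** Suppose that at every point of $\Gamma_i$ exactly $k$ principal curvatures, counted with multiplicity, are zero. Then $\widehat\Gamma_i$ has codimension $k+1$ in $\mathbb{RP}_n$: every $P\in\Gamma_i$ has an open neighbourhood $U$ such that the dual set of $\Gamma_i\cap U$ is an embedded $C^\infty$ submanifold of codimension $k+1$ of $\mathbb{RP}_n$. Moreover, let $k\ge1$, let $P\in\Gamma_i$, let $v=(\alpha_0:p_0)$ be the plane tangent to $\Gamma_i$ at $P$, and let $L_k(P)$ be the affine space through $P$ spanned by the principal directions of zero curvature of $\Gamma_i$ at $P$. Then $L_k(P)$ is $k$-dimensional and $L_k(P)\subseteq\Gamma_i$. For $j\neq i$ let $d_P^{\,j}\subset\mathbb{RP}_n$ be the set of planes tangent to $\Gamma_j$ at points of $L_k(P)\cap\Gamma_j$. Then for each $j\ne i$: - $v\notin d_P^{\,j}$, and the cone with vertex $v$ and directrix $d_P^{\,j}$ (the union of the projective lines joining $v$ to the points of $d_P^{\,j}$) is contained in the dual set $\widehat\Gamma_{ij}$ of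 $\Gamma_i\cap\Gamma_j$; - the directrix is $(k-1)$-dimensional wherever $L_k(P)$ is in general position to $\Gamma_j$: if $x\in L_k(P)\cap\Gamma_j$, $L_k(P)$ is not contained in the tangent plane of $\Gamma_j$ at $x$, and no direction of $L_k(P)$ is a principal direction of zero curvature of $\Gamma_j$ at $x$, then $x$ has an open neighbourhood $U$ such that the planes tangent to $\Gamma_j$ at points of $L_k(P)\cap\Gamma_j\cap U$ form an embedded $C^\infty$ submanifold of dimension $k-1$ of $\mathbb{RP}_n$. Finally, if $P\in\Gamma_i\cap\partial D$, then $d_P^{\,j}$ is nonempty for at least one $j\ne i$ (so that $\Gamma_i\cap\Gamma_j\neq\varnothing$). -/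

import Mathlib

open scoped ContDiff Topology
open LinearAlgebra Module

noncomputable section

/-- `f` is a smooth local equation of the hypersurface `S` at `x`: near `x` the set `S` is the
zero set of `f`, and the gradient of `f` does not vanish at `x`. (A smooth function that is
only given near `x` can be cut off, so asking for `f` to be smooth everywhere costs nothing.) -/
structure IsLocalEquation {n : ℕ} (S : Set (EuclideanSpace ℝ (Fin n)))
    (x : EuclideanSpace ℝ (Fin n)) (f : EuclideanSpace ℝ (Fin n) → ℝ) : Prop where
  smooth : ContDiff ℝ ∞ f
  gradient_ne : gradient f x ≠ 0
  eventually_mem_iff : ∀ᶠ y in 𝓝 x, (y ∈ S ↔ f y = 0)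

/-- A smooth embedded hypersurface (without boundary) of `ℝⁿ`. -/
def IsSmoothHypersurface {n : ℕ} (S : Set (EuclideanSpace ℝ (Fin n))) : Prop :=
  ∀ x ∈ S, ∃ f, IsLocalEquation S x f

/-- A smooth embedded submanifold of codimension `c` of a normed space: locally the zero set
of `c` smooth functions with linearly independent differentials. -/
def IsSubmanifoldOfCodim {V : Type*} [NormedAddCommGroup V] [NormedSpace ℝ V]
    (c : ℕ) (M : Set V) : Prop :=
  ∀ x ∈ M, ∃ F : V → (Fin c → ℝ), ContDiff ℝ ∞ F ∧
    Function.Surjective (fderiv ℝ F x) ∧ ∀ᶠ y in 𝓝 x, (y ∈ M ↔ F y = 0)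

/-- The tangent space at `x` of a subset `S` of `ℝⁿ`: the common kernel of the differentials at
`x` of all smooth functions that vanish on `S` near `x`. For an embedded submanifold through `x`
this is the usual tangent space. -/
def tangentSpaceAt {n : ℕ} (S : Set (EuclideanSpace ℝ (Fin n)))
    (x : EuclideanSpace ℝ (Fin n)) : Submodule ℝ (EuclideanSpace ℝ (Fin n)) :=
  ⨅ f ∈ {f : EuclideanSpace ℝ (Fin n) → ℝ | ContDiff ℝ ∞ f ∧ ∀ᶠ y in 𝓝[S] x, f y = 0},
    LinearMap.ker (fderiv ℝ f x).toLinearMap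

/-- The hypersurfaces `Γ j` are in general position: at every point the normal vectors of those
that pass through the point are linearly independent. -/
def InGeneralPosition {n s : ℕ} (Γ : Fin s → Set (EuclideanSpace ℝ (Fin n))) : Prop :=
  ∀ (x : EuclideanSpace ℝ (Fin n)) (f : Fin s → EuclideanSpace ℝ (Fin n) → ℝ),
    (∀ j, x ∈ Γ j → IsLocalEquation (Γ j) x (f j)) →
      LinearIndependent ℝ (fun j : {j : Fin s // x ∈ Γ j} => gradient (f j) x)

/-- The unit normal field of the level sets of `f`. -/
def unitNormal {n : ℕ} (f : EuclideanSpace ℝ (Fin n) → ℝ) (x : EuclideanSpace ℝ (Fin n)) :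
    EuclideanSpace ℝ (Fin n) :=
  ‖gradient f x‖⁻¹ • gradient f x

/-- The shape operator (Weingarten map) at `x` of a hypersurface `S` with local equation `f`:
minus the derivative of the unit normal field, as an endomorphism of the tangent space. Its
eigenvalues are the principal curvatures of `S` at `x`; another choice of the equation changes
the operator at most by its sign. -/
def shapeOperator {n : ℕ} (S : Set (EuclideanSpace ℝ (Fin n)))
    (f : EuclideanSpace ℝ (Fin n) → ℝ) (x : EuclideanSpace ℝ (Fin n)) :
    Module.End ℝ (tangentSpaceAt S x) :=
  -((tangentSpaceAt S x).orthogonalProjectionOnto ∘L fderiv ℝ (unitNormal f) x ∘L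
      (tangentSpaceAt S x).subtypeL).toLinearMap

/-- The eigenspace of the shape operator for the principal curvature zero. Its dimension is the
number of vanishing principal curvatures, since the shape operator is symmetric. -/
def nullDirections {n : ℕ} (S : Set (EuclideanSpace ℝ (Fin n)))
    (f : EuclideanSpace ℝ (Fin n) → ℝ) (x : EuclideanSpace ℝ (Fin n)) :
    Submodule ℝ (EuclideanSpace ℝ (Fin n)) :=
  (Module.End.eigenspace (shapeOperator S f x) 0).map (tangentSpaceAt S x).subtype

/-- The `n`-dimensional projective space with homogeneous coordinates `(α : p)`, where `α ∈ ℝⁿ`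
and `p ∈ ℝ`. -/
abbrev RP (n : ℕ) : Type := Projectivization ℝ (EuclideanSpace ℝ (Fin n) × ℝ)

/-- The points `(α : p)`, `α ≠ 0`, such that the plane `α · x = p` is tangent to `S` at the given
point `x` of `S`, that is, passes through `x` and is not transversal to `S` there. -/
def tangentPlanesAt {n : ℕ} (S : Set (EuclideanSpace ℝ (Fin n)))
    (x : EuclideanSpace ℝ (Fin n)) : Set (RP n) :=
  {w | x ∈ S ∧ ∃ (α : EuclideanSpace ℝ (Fin n)) (p : ℝ) (h : (α, p) ≠ 0),
    w = Projectivization.mk ℝ (α, p) h ∧ α ≠ 0 ∧ inner ℝ α x = p ∧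
      tangentSpaceAt S x ⊔ (ℝ ∙ α)ᗮ ≠ ⊤}

/-- The dual set of `S`: all planes that are tangent to `S` at some point of `S`. -/
def dualSet {n : ℕ} (S : Set (EuclideanSpace ℝ (Fin n))) : Set (RP n) :=
  ⋃ x, tangentPlanesAt S x

/-- The nonzero vectors of homogeneous coordinates of the points of `X`. -/
def homogeneousVectors {n : ℕ} (X : Set (RP n)) : Set (EuclideanSpace ℝ (Fin n) × ℝ) :=
  {z | ∃ h : z ≠ 0, Projectivization.mk ℝ z h ∈ X}

/-- `X` is a smooth embedded submanifold of codimension `c` of the projective space. As the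
projection from the nonzero vectors to the projective space is a submersion, this is the same as
the vectors over `X` being a submanifold of codimension `c` of the space of vectors. -/
def IsProjectiveSubmanifoldOfCodim {n : ℕ} (c : ℕ) (X : Set (RP n)) : Prop :=
  IsSubmanifoldOfCodim c (homogeneousVectors X)

/-- The cone with vertex `v` and directrix `d` in the projective space: the union of the
projective lines that join `v` to the points of `d`. -/
def projectiveCone {n : ℕ} (v : RP n) (d : Set (RP n)) : Set (RP n) :=
  {w | ∃ u ∈ d, w.submodule ≤ v.submodule ⊔ u.submodule}

/-- At least `r` principal curvatures of the part of `X` that consists of smooth hypersurfaces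
vanish identically: whenever a smooth hypersurface `S`, drawn in an affine chart
`y ↦ [A (y, 1)]` of the projective space, lies in `X`, at least `r` principal curvatures of `S`
vanish at each of its points. -/
def DualCurvaturesVanish {n : ℕ} (r : ℕ) (X : Set (RP n)) : Prop :=
  ∀ (A : (EuclideanSpace ℝ (Fin n) × ℝ) ≃L[ℝ] (EuclideanSpace ℝ (Fin n) × ℝ))
    (S : Set (EuclideanSpace ℝ (Fin n))), IsSmoothHypersurface S →
    (∀ y ∈ S, A (y, 1) ∈ homogeneousVectors X) →
    ∀ y ∈ S, ∀ f, IsLocalEquation S y f → r ≤ finrank ℝ (nullDirections S f y)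

/-- The affine space through the point `P` of `S` whose directions are the principal directions
of zero curvature of `S` at `P`. -/
def rulingSpace {n : ℕ} (S : Set (EuclideanSpace ℝ (Fin n)))
    (f : EuclideanSpace ℝ (Fin n) → ℝ) (P : EuclideanSpace ℝ (Fin n)) :
    AffineSubspace ℝ (EuclideanSpace ℝ (Fin n)) :=
  AffineSubspace.mk' P (nullDirections S f P)

/-- The planes that are tangent to `T` at the points of `L ∩ T`. -/
def tangentPlanesAlong {n : ℕ} (T L : Set (EuclideanSpace ℝ (Fin n))) : Set (RP n) :=
  ⋃ x ∈ L ∩ T, tangentPlanesAt T x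

end

/-! Sets of planes are handled through the cones of their homogeneous coordinate vectors in `ℝⁿ ×
ℝ`.

Part (a). Let `B` be the intersection of `m` of the surfaces. A plane tangent to `B` at `x` has as
`α` a combination of `m` independent normals, so the cone over the dual set is covered by smooth
maps `Φ` of `(n - m) + m = n` parameters. Differentiating the incidence `α · x = p` shows that the
image of `dΦ` lies in the hyperplane dual to `x` (`exists_conormal_parametrization`). The cone over
a hypersurface `S` of such planes also has dimension `n`, so wherever `Φ` is an immersion tangent to
this cone, the tangent hyperplane of `S` is dual to the point `x` of `B`. No smooth lift of `S` to
the parameters is given; a Sard and Lebesgue density argument (`ae_immersion_tangent_levelSet`)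
shows instead that these points of `S` are dense (`exists_tangentHyperplane_dual_mem`). The point
dual to the tangent hyperplane depends smoothly on the point of `S`, and by density and closedness
it stays in `B`. Since `dim S = n - 1` and `dim B = n - m`, its differential has a kernel of
dimension at least `m - 1`, which consists of null directions
(`le_finrank_nullDirections_of_tangentHyperplane_dual_mem`). Upper semicontinuity of the nullity
reaches the remaining points of `S`.

Part (b). The kernel of the differential of the Gauss map, which takes a point to its tangent plane,
is the space of null directions. If this has constant dimension `k`, the constant rank theorem makes
the local images submanifolds of dimension `n - 1 - k` (`exists_isSubmanifoldOfCodim_cone`). A fibre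
of the Gauss map lies in the affine null space and has the same dimension, so it fills it locally
(`IsLocalEquation.eventually_add_mem`); a clopen argument extends this to the whole of `L_k(P)`. The
plane `v` is thus tangent to `Γ i` along all of `L_k(P)`, and at a point of `L_k(P) ∩ Γ j` the
pencil spanned by `v` and the tangent plane of `Γ j` is tangent to `Γ i ∩ Γ j`. If `L_k(P)` met no
other surface, `∂D` would be clopen in `L_k(P)` and would contain this unbounded space, against
compactness of `D`. -/

/-! ### Local inverses, level sets and maps of constant rank. -/

theorem exists_contDiff_eventuallyEq {V W : Type*} [NormedAddCommGroup V] [NormedSpace ℝ V]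
    [FiniteDimensional ℝ V] [NormedAddCommGroup W] [NormedSpace ℝ W] {f : V → W} {x : V}
    (hf : ∀ᶠ y in 𝓝 x, ContDiffAt ℝ ∞ f y) :
    ∃ g : V → W, ContDiff ℝ ∞ g ∧ g =ᶠ[𝓝 x] f := by
  obtain ⟨r, hr, hball⟩ := Metric.eventually_nhds_iff_ball.1 hf
  -- Cutting off turns local inverses into globally smooth maps, which is the form that the
  -- definitions and the later lemmas ask for.
  let b : ContDiffBump x := ⟨r / 4, r / 2, by positivity, by linarith⟩
  refine ⟨fun y => b y • f y, ?_, ?_⟩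
  · rw [contDiff_iff_contDiffAt]
    intro y
    by_cases hy : y ∈ Metric.ball x r
    · exact b.contDiff.contDiffAt.smul (hball y hy)
    · have : (fun z => b z • f z) =ᶠ[𝓝 y] fun _ => 0 := by
        have h1 : y ∈ (Metric.closedBall x (r / 2))ᶜ := by
          simp only [Metric.mem_ball, not_lt, Set.mem_compl_iff, Metric.mem_closedBall] at *
          linarith
        filter_upwards [Metric.isClosed_closedBall.isOpen_compl.mem_nhds h1] with z hz
        rw [b.zero_of_le_dist, zero_smul]
        simp only [Set.mem_compl_iff, Metric.mem_closedBall, not_le] at hz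
        exact hz.le
      exact contDiffAt_const.congr_of_eventuallyEq this
  · filter_upwards [b.eventuallyEq_one] with y hy
    rw [hy]; simp

/-- The source is shrunk to the open set where the differential is invertible, so the inverse is
smooth on the whole target and not only at one point. -/
theorem exists_openPartialHomeomorph_of_fderiv_bijective {V W : Type*} [NormedAddCommGroup V]
    [NormedSpace ℝ V] [FiniteDimensional ℝ V] [NormedAddCommGroup W] [NormedSpace ℝ W]
    [FiniteDimensional ℝ W] {ψ : V → W} (hψ : ContDiff ℝ ∞ ψ) {x : V}
    (hb : Function.Bijective (fderiv ℝ ψ x)) :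
    ∃ e : OpenPartialHomeomorph V W, ⇑e = ψ ∧ x ∈ e.source ∧
      ∀ y ∈ e.target, ContDiffAt ℝ ∞ e.symm y := by
  have : CompleteSpace V := FiniteDimensional.complete ℝ V
  have : CompleteSpace W := FiniteDimensional.complete ℝ W
  let A : V ≃L[ℝ] W := (LinearEquiv.ofBijective (fderiv ℝ ψ x).toLinearMap hb).toContinuousLinearEquiv
  have hA : (A : V →L[ℝ] W) = fderiv ℝ ψ x := by ext v; rfl
  have hd : HasFDerivAt ψ (A : V →L[ℝ] W) x := by
    rw [hA]; exact (hψ.differentiable (by simp) x).hasFDerivAt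
  let e := hψ.contDiffAt.toOpenPartialHomeomorph ψ hd (by simp)
  have hopen : IsOpen {y : V | fderiv ℝ ψ y ∈ Set.range ((↑) : (V ≃L[ℝ] W) → V →L[ℝ] W)} :=
    (ContinuousLinearEquiv.isOpen).preimage (hψ.continuous_fderiv (by simp))
  refine ⟨e.restrOpen _ hopen, rfl, ⟨?_, ?_⟩, ?_⟩
  · exact ContDiffAt.mem_toOpenPartialHomeomorph_source _ _ _
  · exact ⟨A, hA⟩
  · intro y hy
    have h1 := (e.restrOpen _ hopen).map_target hy
    obtain ⟨B, hB⟩ := h1.2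
    refine (e.restrOpen _ hopen).contDiffAt_symm hy (f₀' := B) ?_ hψ.contDiffAt
    rw [hB]
    exact (hψ.differentiable (by simp) _).hasFDerivAt

theorem exists_continuousLinearMap_projection {V : Type*} [NormedAddCommGroup V] [NormedSpace ℝ V]
    [FiniteDimensional ℝ V] (K : Submodule ℝ V) : ∃ pr : V →L[ℝ] K, ∀ w : K, pr w = w :=
  Submodule.ClosedComplemented.of_finiteDimensional K

/-- Straightening of the level sets of a submersion. -/
theorem exists_straightening {V Z : Type*} [NormedAddCommGroup V]
    [NormedSpace ℝ V] [FiniteDimensional ℝ V] [NormedAddCommGroup Z] [NormedSpace ℝ Z]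
    [FiniteDimensional ℝ Z] {F : V → Z} (hF : ContDiff ℝ ∞ F) {x : V}
    (hs : Function.Surjective (fderiv ℝ F x)) (pr : V →L[ℝ] (fderiv ℝ F x).ker)
    (hpr : ∀ w : (fderiv ℝ F x).ker, pr w = w) :
    ∃ e : OpenPartialHomeomorph V (Z × (fderiv ℝ F x).ker), 
      (∀ y, e y = (F y, pr (y - x))) ∧ x ∈ e.source ∧
      ∀ y ∈ e.target, ContDiffAt ℝ ∞ e.symm y := by
  have hd : HasFDerivAt (fun y => (F y, pr (y - x))) ((fderiv ℝ F x).prod pr) x := by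
    refine ((hF.differentiable (by simp) x).hasFDerivAt).prodMk ?_
    exact pr.hasFDerivAt.comp x ((hasFDerivAt_id x).sub_const x)
  obtain ⟨e, he, hx, hsm⟩ := exists_openPartialHomeomorph_of_fderiv_bijective
    (ψ := fun y => (F y, pr (y - x))) (x := x)
    (hF.prodMk (pr.contDiff.comp (contDiff_id.sub contDiff_const))) (by
      rw [hd.fderiv]
      constructor
      · rw [injective_iff_map_eq_zero]
        intro v hv
        simp only [ContinuousLinearMap.prod_apply, Prod.mk_eq_zero] at hv
        exact congrArg Subtype.val ((hpr ⟨v, hv.1⟩).symm.trans hv.2)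
      · rintro ⟨z, k⟩
        obtain ⟨v, hv⟩ := hs z
        refine ⟨v - pr v + k, ?_⟩
        have h1 : ∀ w : (fderiv ℝ F x).ker, fderiv ℝ F x (w : V) = 0 := fun w => w.2
        simp [hv, hpr, h1])
  exact ⟨e, fun y => by rw [he], hx, hsm⟩

/-- The level set of a submersion through `x`, parametrized over the kernel of its differential. -/
theorem exists_levelSet_parametrization {V Z : Type*} [NormedAddCommGroup V]
    [NormedSpace ℝ V] [FiniteDimensional ℝ V] [NormedAddCommGroup Z] [NormedSpace ℝ Z]
    [FiniteDimensional ℝ Z] {F : V → Z} (hF : ContDiff ℝ ∞ F) {x : V} (hx : F x = 0)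
    (hs : Function.Surjective (fderiv ℝ F x)) (pr : V →L[ℝ] (fderiv ℝ F x).ker)
    (hpr : ∀ w : (fderiv ℝ F x).ker, pr w = w) :
    ∃ i : (fderiv ℝ F x).ker → V, ContDiff ℝ ∞ i ∧ i 0 = x ∧ (∀ᶠ u in 𝓝 0, F (i u) = 0) ∧
      (∀ᶠ u in 𝓝 0, pr (i u - x) = u) ∧ (∀ᶠ y in 𝓝 x, F y = 0 → i (pr (y - x)) = y) ∧
      ∀ w, fderiv ℝ i 0 w = w := by
  obtain ⟨e, he, hxe, hsm⟩ := exists_straightening hF hs pr hpr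
  have hex : e x = (0, 0) := by rw [he, hx]; simp
  have h0 : ((0 : Z), (0 : (fderiv ℝ F x).ker)) ∈ e.target := hex ▸ e.map_source hxe
  have hT : ∀ᶠ u in 𝓝 (0 : (fderiv ℝ F x).ker), ((0 : Z), u) ∈ e.target := by
    have hc : Continuous fun u : (fderiv ℝ F x).ker => ((0 : Z), u) := by fun_prop
    exact hc.continuousAt.preimage_mem_nhds (e.open_target.mem_nhds h0)
  obtain ⟨i, hi, hie⟩ := exists_contDiff_eventuallyEq (x := (0 : (fderiv ℝ F x).ker))
    (f := fun u => e.symm (0, u)) (by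
      filter_upwards [hT] with u hu
      exact (hsm _ hu).comp u (by fun_prop))
  have h1 : ∀ᶠ u in 𝓝 (0 : (fderiv ℝ F x).ker), (F (i u), pr (i u - x)) = (0, u) := by
    filter_upwards [hT, hie] with u hu hiu
    rw [hiu, ← he, e.right_inv hu]
  have hF0 : ∀ᶠ u in 𝓝 (0 : (fderiv ℝ F x).ker), F (i u) = 0 := h1.mono fun u hu => congrArg Prod.fst hu
  have hp0 : ∀ᶠ u in 𝓝 (0 : (fderiv ℝ F x).ker), pr (i u - x) = u :=
    h1.mono fun u hu => congrArg Prod.snd hu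
  have hi0 : i 0 = x := by rw [hie.self_of_nhds]; simp only; rw [← hex, e.left_inv hxe]
  refine ⟨i, hi, hi0, hF0, hp0, ?_, ?_⟩
  · have hc : Filter.Tendsto (fun y => pr (y - x)) (𝓝 x) (𝓝 0) := by
      have : Continuous (fun y => pr (y - x)) := by fun_prop
      simpa using this.tendsto x
    filter_upwards [hc.eventually hie, e.open_source.mem_nhds hxe] with y hy hys hy0
    rw [hy, ← hy0, ← he, e.left_inv hys]
  · have hdi := (hi.differentiable (by simp) 0).hasFDerivAt
    have h2 : HasFDerivAt (fun u => F (i u)) ((fderiv ℝ F x).comp (fderiv ℝ i 0)) 0 := by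
      have := (hF.differentiable (by simp) (i 0)).hasFDerivAt.comp 0 hdi
      rwa [hi0] at this
    have h3 : HasFDerivAt (fun u => F (i u)) (0 : _ →L[ℝ] Z) 0 :=
      (hasFDerivAt_const (0 : Z) _).congr_of_eventuallyEq hF0
    have h4 : HasFDerivAt (fun u => pr (i u - x)) (pr.comp (fderiv ℝ i 0)) 0 :=
      pr.hasFDerivAt.comp 0 (hdi.sub_const x)
    have h5 : HasFDerivAt (fun u => pr (i u - x)) (ContinuousLinearMap.id ℝ _) 0 :=
      (hasFDerivAt_id _).congr_of_eventuallyEq hp0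
    intro w
    have h6 : fderiv ℝ F x (fderiv ℝ i 0 w) = 0 := DFunLike.congr_fun (h2.unique h3) w
    have h7 : pr (fderiv ℝ i 0 w) = w := DFunLike.congr_fun (h4.unique h5) w
    have h8 := hpr ⟨fderiv ℝ i 0 w, h6⟩
    exact (congrArg Subtype.val (h8.symm.trans h7))

/-- Rank is lower semicontinuous. Applied to differentials this keeps surjectivity and trivial
kernels near a point, and makes nullity upper semicontinuous. -/
theorem eventually_le_finrank_range {V X Y : Type*} [TopologicalSpace V] [NormedAddCommGroup X]
    [NormedSpace ℝ X] [FiniteDimensional ℝ X] [NormedAddCommGroup Y] [NormedSpace ℝ Y]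
    {L : V → X →L[ℝ] Y} {x : V} (hL : ContinuousAt L x) :
    ∀ᶠ y in 𝓝 x, finrank ℝ (L x).range ≤ finrank ℝ (L y).range := by
  have h := hL.preimage_mem_nhds ((isOpen_setOfPred_nat_le_rank
    (finrank ℝ (L x).range)).mem_nhds (x := L x) (by
      simp only [Set.mem_ofPred_eq, LinearMap.rank, finrank_eq_rank]; exact le_rfl))
  filter_upwards [h] with y hy
  simp only [Set.mem_preimage, Set.mem_ofPred_eq, LinearMap.rank, ← finrank_eq_rank] at hy
  exact_mod_cast hy

theorem eventually_surjective {V X Y : Type*} [TopologicalSpace V] [NormedAddCommGroup X]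
    [NormedSpace ℝ X] [FiniteDimensional ℝ X] [NormedAddCommGroup Y] [NormedSpace ℝ Y]
    [FiniteDimensional ℝ Y]
    {L : V → X →L[ℝ] Y} {x : V} (hL : ContinuousAt L x) (hs : Function.Surjective (L x)) :
    ∀ᶠ y in 𝓝 x, Function.Surjective (L y) := by
  filter_upwards [eventually_le_finrank_range hL] with y hy
  rw [LinearMap.range_eq_top.2 hs, finrank_top] at hy
  exact LinearMap.range_eq_top.1 (Submodule.eq_top_of_finrank_eq
    (le_antisymm (Submodule.finrank_le _) hy))

/-- A smooth map of constant rank factors, near a point, through its projection to the range of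
its differential at that point. -/
theorem exists_constantRank_factorization {X Y : Type*} [NormedAddCommGroup X]
    [NormedSpace ℝ X] [FiniteDimensional ℝ X] [NormedAddCommGroup Y] [NormedSpace ℝ Y]
    [FiniteDimensional ℝ Y] {G : X → Y} (hG : ContDiff ℝ ∞ G) {x : X}
    (hr : ∀ᶠ u in 𝓝 x, finrank ℝ (fderiv ℝ G u).range = finrank ℝ (fderiv ℝ G x).range)
    (pr : Y →L[ℝ] (fderiv ℝ G x).range) (hpr : ∀ w : (fderiv ℝ G x).range, pr w = w) :
    ∃ σ : (fderiv ℝ G x).range → Y, ContDiff ℝ ∞ σ ∧ (∀ᶠ ξ in 𝓝 (pr (G x)), pr (σ ξ) = ξ) ∧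
      ∀ᶠ u in 𝓝 x, G u = σ (pr (G u)) := by
  have hGd := hG.differentiable (by simp)
  set ρ : X → (fderiv ℝ G x).range := fun u => pr (G u) with hρdef
  have hρ : ContDiff ℝ ∞ ρ := pr.contDiff.comp hG
  have hρ' : ∀ u, fderiv ℝ ρ u = pr.comp (fderiv ℝ G u) := fun u =>
    (pr.hasFDerivAt.comp u (hGd u).hasFDerivAt).fderiv
  have hsurj : Function.Surjective (fderiv ℝ ρ x) := by
    rintro ⟨y, u, hu⟩
    refine ⟨u, ?_⟩
    rw [hρ']
    exact (congrArg pr hu).trans (hpr ⟨y, u, hu⟩)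
  obtain ⟨p, hp⟩ := exists_continuousLinearMap_projection (fderiv ℝ ρ x).ker
  obtain ⟨e, he, hxe, hsm⟩ := exists_straightening hρ hsurj p hp
  have hex : e x = (ρ x, 0) := by rw [he]; simp
  have h0 : (ρ x, (0 : (fderiv ℝ ρ x).ker)) ∈ e.target := hex ▸ e.map_source hxe
  -- Here constant rank enters: near `x` the projection `pr` maps the range of `dG u` onto a space
  -- of the same dimension, so it is injective there and `dρ u` and `dG u` have the same kernel.
  have hgood : ∀ᶠ u in 𝓝 x, ∀ c, fderiv ℝ ρ u c = 0 → fderiv ℝ G u c = 0 := by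
    filter_upwards [hr, eventually_surjective
      (hρ.continuous_fderiv (by simp)).continuousAt hsurj] with u hu hsu c hc
    have hinj : Function.Injective (pr.toLinearMap.domRestrict (fderiv ℝ G u).range) := by
      refine (LinearMap.injective_iff_surjective_of_finrank_eq_finrank hu).2 fun z => ?_
      obtain ⟨c, hc⟩ := hsu z
      rw [hρ'] at hc
      exact ⟨⟨_, c, rfl⟩, hc⟩
    rw [hρ'] at hc
    have := @hinj ⟨fderiv ℝ G u c, c, rfl⟩ 0 (by simpa using hc)
    exact congrArg Subtype.val this
  have hcs : ContinuousAt e.symm (ρ x, 0) := (hsm _ h0).continuousAt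
  have hsx : e.symm (ρ x, 0) = x := by rw [← hex, e.left_inv hxe]
  have hbox : ∀ᶠ z in 𝓝 (ρ x, (0 : (fderiv ℝ ρ x).ker)), z ∈ e.target ∧
      ∀ c, fderiv ℝ ρ (e.symm z) c = 0 → fderiv ℝ G (e.symm z) c = 0 := by
    have ht : Filter.Tendsto e.symm (𝓝 (ρ x, 0)) (𝓝 x) := by
      have := hcs.tendsto
      rwa [hsx] at this
    exact (e.open_target.eventually_mem h0).and (ht.eventually hgood)
  obtain ⟨δ, hδ, hball⟩ := Metric.eventually_nhds_iff_ball.1 hbox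
  have hb' : ∀ ξ ∈ Metric.ball (ρ x) δ, ∀ b ∈ Metric.ball (0 : (fderiv ℝ ρ x).ker) δ,
      (ξ, b) ∈ Metric.ball (ρ x, (0 : (fderiv ℝ ρ x).ker)) δ := by
    intro ξ hξ b hb
    rw [← ball_prod_same]; exact ⟨hξ, hb⟩
  have hρs : ∀ z ∈ e.target, ρ (e.symm z) = z.1 := fun z hz => by
    have := he (e.symm z)
    rw [e.right_inv hz] at this
    exact (congrArg Prod.fst this).symm
  -- In the straightened coordinates `ρ` is constant on each slice, hence `dG` vanishes along it;
  -- the slice is a ball, so `G` is constant on it and depends on `ξ` only.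
  have hconst : ∀ ξ ∈ Metric.ball (ρ x) δ, ∀ b ∈ Metric.ball (0 : (fderiv ℝ ρ x).ker) δ,
      G (e.symm (ξ, b)) = G (e.symm (ξ, 0)) := by
    intro ξ hξ b hb
    have hdiff : ∀ b ∈ Metric.ball (0 : (fderiv ℝ ρ x).ker) δ,
        HasFDerivAt (fun b => G (e.symm (ξ, b))) (0 : _ →L[ℝ] Y) b := by
      intro b hb
      obtain ⟨ht, hk⟩ := hball _ (hb' ξ hξ b hb)
      have hs1 : HasFDerivAt (fun b : (fderiv ℝ ρ x).ker => e.symm (ξ, b)) _ b :=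
        ((hsm _ ht).differentiableAt (by simp)).hasFDerivAt.comp b
          (hasFDerivAt_prodMk_right ξ b)
      have hs2 := (hρ.differentiable (by simp) (e.symm (ξ, b))).hasFDerivAt.comp b hs1
      have hs3 : HasFDerivAt (ρ ∘ fun b : (fderiv ℝ ρ x).ker => e.symm (ξ, b))
          (0 : _ →L[ℝ] (fderiv ℝ G x).range) b := by
        refine (hasFDerivAt_const ξ b).congr_of_eventuallyEq ?_
        filter_upwards [Metric.isOpen_ball.mem_nhds hb] with b' hb2
        exact hρs _ (hball _ (hb' ξ hξ b' hb2)).1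
      have hs4 := (hGd (e.symm (ξ, b))).hasFDerivAt.comp b hs1
      refine hs4.congr_fderiv ?_
      ext1 w
      exact hk _ (DFunLike.congr_fun (hs2.unique hs3) w)
    have := (convex_ball (0 : (fderiv ℝ ρ x).ker) δ).is_const_of_fderivWithin_eq_zero (𝕜 := ℝ)
      (f := fun b => G (e.symm (ξ, b)))
      (fun b hb => (hdiff b hb).differentiableAt.differentiableWithinAt)
      (fun b hb => by
        rw [fderivWithin_of_isOpen Metric.isOpen_ball hb, (hdiff b hb).fderiv])
      hb (Metric.mem_ball_self hδ)
    exact this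
  obtain ⟨σ, hσ, hσe⟩ := exists_contDiff_eventuallyEq (x := ρ x)
    (f := fun ξ => G (e.symm (ξ, 0))) (by
      filter_upwards [Metric.ball_mem_nhds (ρ x) hδ] with ξ hξ
      exact hG.contDiffAt.comp ξ ((hsm _ (hball _ (hb' ξ hξ 0 (Metric.mem_ball_self hδ))).1).comp
        (f := fun ξ => (ξ, (0 : (fderiv ℝ ρ x).ker))) ξ
        (by fun_prop)))
  refine ⟨σ, hσ, ?_, ?_⟩
  · filter_upwards [hσe, Metric.ball_mem_nhds (ρ x) hδ] with ξ hξ hξb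
    rw [hξ]
    exact hρs _ (hball _ (hb' ξ hξb 0 (Metric.mem_ball_self hδ))).1
  · have hc : Filter.Tendsto e (𝓝 x) (𝓝 (ρ x, 0)) := hex ▸ e.continuousAt hxe
    have hρc : ContinuousAt ρ x := hρ.continuous.continuousAt
    filter_upwards [hρc.eventually hσe, hc.eventually (Metric.ball_mem_nhds _ hδ),
      e.open_source.mem_nhds hxe] with u hu hub hue
    change G u = σ (ρ u)
    rw [hu]
    have h1 : e u = (ρ u, p (u - x)) := he u
    have h2 : (ρ u, p (u - x)) ∈ Metric.ball (ρ x, (0 : (fderiv ℝ ρ x).ker)) δ := h1 ▸ hub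
    rw [← ball_prod_same] at h2
    rw [← hconst _ h2.1 _ h2.2, ← h1, e.left_inv hue]

theorem isOpen_image_of_surjective_fderiv {X Y : Type*} [NormedAddCommGroup X]
    [NormedSpace ℝ X] [FiniteDimensional ℝ X] [NormedAddCommGroup Y] [NormedSpace ℝ Y]
    [FiniteDimensional ℝ Y] {f : X → Y} (hf : ContDiff ℝ ∞ f) {U : Set X} (hU : IsOpen U)
    (hs : ∀ u ∈ U, Function.Surjective (fderiv ℝ f u)) : IsOpen (f '' U) := by
  have : CompleteSpace X := FiniteDimensional.complete ℝ X
  have : CompleteSpace Y := FiniteDimensional.complete ℝ Y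
  rw [isOpen_iff_mem_nhds]
  rintro _ ⟨u, hu, rfl⟩
  have h := (hf.contDiffAt.hasStrictFDerivAt (x := u) (by simp)).map_nhds_eq_of_surj
    (LinearMap.range_eq_top.2 (hs u hu))
  rw [← h]
  exact Filter.image_mem_map (hU.mem_nhds hu)

/-- The cone over a small piece of the image of a map of constant rank into an affine hyperplane
is a submanifold. -/
theorem exists_isSubmanifoldOfCodim_cone {X Y : Type*} [NormedAddCommGroup X]
    [NormedSpace ℝ X] [FiniteDimensional ℝ X] [NormedAddCommGroup Y] [NormedSpace ℝ Y]
    [FiniteDimensional ℝ Y] {G : X → Y} (hG : ContDiff ℝ ∞ G) {x : X} (ℓ : Y →L[ℝ] ℝ)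
    (hℓ : ∀ᶠ u in 𝓝 x, ℓ (G u) = 1)
    (hr : ∀ᶠ u in 𝓝 x, finrank ℝ (fderiv ℝ G u).range = finrank ℝ (fderiv ℝ G x).range)
    {W : Set X} (hW : W ∈ 𝓝 x) {c : ℕ}
    (hc : c + (finrank ℝ (fderiv ℝ G x).range + 1) = finrank ℝ Y) :
    ∃ U ⊆ W, IsOpen U ∧ x ∈ U ∧
      IsSubmanifoldOfCodim c {v | ∃ t : ℝ, t ≠ 0 ∧ ∃ u ∈ U, v = t • G u} := by
  obtain ⟨pr, hpr⟩ := exists_continuousLinearMap_projection (fderiv ℝ G x).range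
  obtain ⟨σ, hσ, hσ1, hσ2⟩ := exists_constantRank_factorization hG hr pr hpr
  have hGd := hG.differentiable (by simp)
  -- `G` moves inside the affine hyperplane `ℓ = 1`, so the radial direction is transversal to its
  -- image and adds exactly one dimension to the cone.
  have hRℓ : ∀ w : (fderiv ℝ G x).range, ℓ w = 0 := by
    rintro ⟨_, u, rfl⟩
    have h1 := ℓ.hasFDerivAt.comp x (hGd x).hasFDerivAt
    have h2 : HasFDerivAt (ℓ ∘ G) (0 : X →L[ℝ] ℝ) x :=
      (hasFDerivAt_const (1 : ℝ) x).congr_of_eventuallyEq hℓ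
    exact DFunLike.congr_fun (h1.unique h2) u
  have hρ : ContDiff ℝ ∞ (fun u => pr (G u)) := pr.contDiff.comp hG
  have hsurj : Function.Surjective (fderiv ℝ (fun u => pr (G u)) x) := by
    rintro ⟨y, u, hu⟩
    refine ⟨u, ?_⟩
    have : fderiv ℝ (fun u => pr (G u)) x = pr.comp (fderiv ℝ G x) :=
      (pr.hasFDerivAt.comp x (hGd x).hasFDerivAt).fderiv
    rw [this]
    exact (congrArg pr hu).trans (hpr ⟨y, u, hu⟩)
  have hev := ((hσ2.and hℓ).and (eventually_surjective
    (hρ.continuous_fderiv (by simp)).continuousAt hsurj)).and hW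
  obtain ⟨U, hUs, hUo, hxU⟩ := mem_nhds_iff.1 hev
  refine ⟨U, fun u hu => (hUs hu).2, hUo, hxU, ?_⟩
  have hV : IsOpen ((fun u => pr (G u)) '' U) :=
    isOpen_image_of_surjective_fderiv hρ hUo fun u hu => (hUs hu).1.2
  set V := (fun u => pr (G u)) '' U with hVdef
  have hσU : ∀ u ∈ U, σ (pr (G u)) = G u := fun u hu => (hUs hu).1.1.1.symm
  have hℓU : ∀ u ∈ U, ℓ (G u) = 1 := fun u hu => (hUs hu).1.1.2
  have hM : ∀ v, (∃ t : ℝ, t ≠ 0 ∧ ∃ u ∈ U, v = t • G u) ↔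
      ℓ v ≠ 0 ∧ pr ((ℓ v)⁻¹ • v) ∈ V ∧ (ℓ v)⁻¹ • v = σ (pr ((ℓ v)⁻¹ • v)) := by
    intro v
    constructor
    · rintro ⟨t, ht, u, hu, rfl⟩
      have h1 : ℓ (t • G u) = t := by simp [hℓU u hu]
      have h2 : t⁻¹ • t • G u = G u := by rw [smul_smul, inv_mul_cancel₀ ht, one_smul]
      rw [h1, h2]
      exact ⟨ht, ⟨u, hu, rfl⟩, (hσU u hu).symm⟩
    · rintro ⟨h1, ⟨u, hu, h2⟩, h3⟩
      refine ⟨ℓ v, h1, u, hu, ?_⟩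
      simp only at h2
      rw [← hσU u hu, h2, ← h3, smul_smul, mul_inv_cancel₀ h1, one_smul]
  -- the common kernel of `pr` and `ℓ`
  set W₀ : Submodule ℝ Y := (pr.prod ℓ).ker with hW₀
  have hmemW : ∀ w, w ∈ W₀ ↔ pr w = 0 ∧ ℓ w = 0 := fun w => by
    rw [hW₀, LinearMap.mem_ker]; simp
  have hdim : finrank ℝ W₀ = c := by
    have hs : Function.Surjective (pr.prod ℓ).toLinearMap := by
      rintro ⟨ξ, s⟩
      refine ⟨s • G x + (ξ - s • pr (G x) : (fderiv ℝ G x).range), ?_⟩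
      have h1 := hRℓ (ξ - s • pr (G x))
      have h2 := hpr (ξ - s • pr (G x))
      simp only [ContinuousLinearMap.coe_coe, ContinuousLinearMap.prod_apply, map_add, map_smul]
      rw [h1, h2, hℓ.self_of_nhds]
      simp
    have h := LinearMap.finrank_range_add_finrank_ker (pr.prod ℓ).toLinearMap
    rw [LinearMap.range_eq_top.2 hs, finrank_top, finrank_prod, finrank_self, ← hc] at h
    have h' : finrank ℝ (pr.prod ℓ).toLinearMap.ker = finrank ℝ W₀ := rfl
    omega
  obtain ⟨Q, hQ⟩ := exists_continuousLinearMap_projection W₀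
  let eW : W₀ ≃L[ℝ] (Fin c → ℝ) := ContinuousLinearEquiv.ofFinrankEq (by simp [hdim])
  -- `F₀` is the deviation of the dehomogenized vector from the image of `σ`. Near the cone this
  -- deviation already lies in `W₀`, so projecting by `Q` loses nothing.
  let F₀ : Y → (Fin c → ℝ) := fun v => eW (Q ((ℓ v)⁻¹ • v - σ (pr ((ℓ v)⁻¹ • v))))
  rintro v hv
  obtain ⟨hv1, hv2, hv3⟩ := (hM v).1 hv
  have hcont : ∀ v, ℓ v ≠ 0 → ContDiffAt ℝ ∞ (fun v => (ℓ v)⁻¹ • v) v := fun v hv =>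
    (ℓ.contDiff.contDiffAt.inv hv).smul contDiffAt_id
  have hℓo : IsOpen {v | ℓ v ≠ 0} := isOpen_ne_fun ℓ.continuous continuous_const
  obtain ⟨F, hF, hFe⟩ := exists_contDiff_eventuallyEq (f := F₀) (x := v) (by
    filter_upwards [hℓo.mem_nhds hv1] with y hy
    exact eW.contDiff.contDiffAt.comp y (Q.contDiff.contDiffAt.comp y
      ((hcont y hy).sub (hσ.contDiffAt.comp y (pr.contDiff.contDiffAt.comp y (hcont y hy))))))
  refine ⟨F, hF, ?_, ?_⟩
  -- Along `W₀` neither `ℓ` nor `pr` changes, so `F` is affine there; these directions alone give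
  -- surjectivity.
  · have hder : ∀ w : W₀, fderiv ℝ F v w = (ℓ v)⁻¹ • eW w := by
      intro w
      obtain ⟨hw1, hw2⟩ := (hmemW w).1 w.2
      have hline : HasDerivAt (fun s : ℝ => v + s • (w : Y)) (w : Y) 0 := by
        simpa using ((hasDerivAt_id (0 : ℝ)).smul_const (w : Y)).const_add v
      have h1 : HasDerivAt (fun s : ℝ => F (v + s • (w : Y))) (fderiv ℝ F v w) 0 := by
        have hd : HasFDerivAt F (fderiv ℝ F v) (v + (0 : ℝ) • (w : Y)) := by
          rw [zero_smul, add_zero]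
          exact (hF.differentiable (by simp) v).hasFDerivAt
        exact hd.comp_hasDerivAt (0 : ℝ) hline
      have h2 : HasDerivAt (fun s : ℝ => F v + s • (ℓ v)⁻¹ • eW w) ((ℓ v)⁻¹ • eW w) 0 := by
        simpa using ((hasDerivAt_id (0 : ℝ)).smul_const ((ℓ v)⁻¹ • eW w)).const_add (F v)
      refine h1.unique (h2.congr_of_eventuallyEq ?_)
      have ht : Filter.Tendsto (fun s : ℝ => v + s • (w : Y)) (𝓝 0) (𝓝 v) := by
        simpa using hline.continuousAt.tendsto
      filter_upwards [ht.eventually hFe] with s hs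
      have h3 : ℓ (v + s • (w : Y)) = ℓ v := by simp [hw2]
      have h4 : pr ((ℓ v)⁻¹ • (v + s • (w : Y))) = pr ((ℓ v)⁻¹ • v) := by simp [hw1]
      rw [hs, hFe.self_of_nhds]
      simp only [F₀]
      rw [h3, h4, smul_add, add_sub_right_comm, map_add, map_add, smul_smul, smul_comm]
      congr 1
      rw [← mul_smul, map_smul, map_smul, hQ w, mul_comm]
    intro z
    refine ⟨(eW.symm (ℓ v • z) : W₀), ?_⟩
    rw [hder]
    simp [smul_smul, inv_mul_cancel₀ hv1]
  · have hVo : ∀ᶠ y in 𝓝 v, pr ((ℓ y)⁻¹ • y) ∈ V :=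
      (pr.continuous.continuousAt.comp (hcont v hv1).continuousAt).eventually
        (hV.eventually_mem hv2)
    filter_upwards [hFe, hℓo.mem_nhds hv1, hVo] with y hy1 hy2 hy3
    refine (hM y).trans ?_
    rw [hy1]
    have hmem : (ℓ y)⁻¹ • y - σ (pr ((ℓ y)⁻¹ • y)) ∈ W₀ := by
      rw [hmemW]
      obtain ⟨u, hu, hu2⟩ := hy3
      simp only at hu2
      rw [← hu2, hσU u hu, map_sub, map_sub, ← hu2, hℓU u hu]
      simp [inv_mul_cancel₀ hy2]
    have h5 := hQ ⟨_, hmem⟩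
    constructor
    · rintro ⟨-, -, h⟩
      simp only [F₀]
      rw [sub_eq_zero.2 h]; simp
    · intro h
      refine ⟨hy2, hy3, ?_⟩
      simp only [F₀] at h
      have h6 := (map_eq_zero_iff eW eW.injective).1 h
      exact sub_eq_zero.1 (congrArg Subtype.val (h5.symm.trans h6))

/-! ### A Sard and Lebesgue density argument. -/

open MeasureTheory in
/-- Let `Φ : X → Y` be smooth, with `dim Y = dim X + 1`. For almost all `v`, at all the points `x`
such that `Φ x` lies in the hypersurface `g = 0` and on the line through `v` of direction `e`, the
map `Φ` is an immersion tangent to the hypersurface. -/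
theorem ae_immersion_tangent_levelSet {X Y : Type*} [NormedAddCommGroup X]
    [NormedSpace ℝ X] [FiniteDimensional ℝ X] [NormedAddCommGroup Y] [NormedSpace ℝ Y]
    [FiniteDimensional ℝ Y] [MeasurableSpace Y] [BorelSpace Y] (μ : Measure Y)
    [μ.IsAddHaarMeasure] (hdim : finrank ℝ X + 1 = finrank ℝ Y) {Φ : X → Y}
    (hΦ : ContDiff ℝ ∞ Φ) (e : Y) {g : Y → ℝ} (hg : ContDiff ℝ ∞ g) :
    ∀ᵐ v ∂μ, ∀ (x : X) (s : ℝ), v = Φ x + s • e → g (Φ x) = 0 →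
      (∀ c, fderiv ℝ g (Φ x) (fderiv ℝ Φ x c) = 0) ∧
      finrank ℝ (fderiv ℝ Φ x).range = finrank ℝ X := by
  let L : Y ≃L[ℝ] X × ℝ := ContinuousLinearEquiv.ofFinrankEq (by simp [← hdim])
  have : Nontrivial Y := Module.nontrivial_of_finrank_pos (R := ℝ) (by omega)
  obtain ⟨e₁, he₁⟩ := exists_ne (0 : Y)
  let l1 : Y →L[ℝ] X := (ContinuousLinearMap.fst ℝ X ℝ).comp (L : Y →L[ℝ] X × ℝ)
  let l2 : Y →L[ℝ] ℝ := (ContinuousLinearMap.snd ℝ X ℝ).comp (L : Y →L[ℝ] X × ℝ)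
  -- As `dim Y = dim X + 1`, the coordinates `(x, s)` identify with `Y`, so the sweep `Φ x + s • e`
  -- becomes a self-map; the vector `e₁` likewise makes `g ∘ Φ` a map from `Y` to `Y`.
  let Ψ : Y → Y := fun p => Φ (l1 p) + l2 p • e
  let h : Y → Y := fun p => g (Φ (l1 p)) • e₁
  let Ψ' : Y → Y →L[ℝ] Y := fun p => (fderiv ℝ Φ (l1 p)).comp l1 + l2.smulRight e
  let h' : Y → Y →L[ℝ] Y := fun p =>
    (((fderiv ℝ g (Φ (l1 p))).comp ((fderiv ℝ Φ (l1 p)).comp l1))).smulRight e₁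
  have hΦ1 : ∀ p, HasFDerivAt (fun p => Φ (l1 p)) ((fderiv ℝ Φ (l1 p)).comp l1) p := fun p =>
    (hΦ.differentiable (by simp) _).hasFDerivAt.comp p l1.hasFDerivAt
  have hΨ : ∀ p, HasFDerivAt Ψ (Ψ' p) p := fun p =>
    (hΦ1 p).add (l2.hasFDerivAt.smul_const e)
  have hh : ∀ p, HasFDerivAt h (h' p) p := fun p =>
    (((hg.differentiable (by simp) _).hasFDerivAt.comp p (hΦ1 p))).smul_const e₁
  let M : Set Y := {p | g (Φ (l1 p)) = 0}
  have hMc : IsClosed M := by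
    have := hg.continuous; have := hΦ.continuous
    exact isClosed_eq (by fun_prop) continuous_const
  have hcrit : μ (Ψ '' {p | (Ψ' p).det = 0}) = 0 :=
    addHaar_image_eq_zero_of_det_fderivWithin_eq_zero μ
      (fun p _ => (hΨ p).hasFDerivWithinAt) fun p hp => hp
  have happ : ApproximatesLinearOn h (0 : Y →L[ℝ] Y) M 0 := by
    intro p hp q hq
    have h1 : h p = 0 := by simp only [h]; rw [show g (Φ (l1 p)) = 0 from hp, zero_smul]
    have h2 : h q = 0 := by simp only [h]; rw [show g (Φ (l1 q)) = 0 from hq, zero_smul]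
    simp [h1, h2]
  have hae := happ.norm_fderiv_sub_le μ hMc.measurableSet h' fun p _ => (hh p).hasFDerivWithinAt
  rw [ae_restrict_iff' hMc.measurableSet] at hae
  have hN : μ (Ψ '' {p | ¬ (p ∈ M → ‖h' p - 0‖₊ ≤ 0)}) = 0 :=
    addHaar_image_eq_zero_of_differentiableOn_of_addHaar_eq_zero μ
      (fun p _ => (hΨ p).differentiableAt.differentiableWithinAt) hae
  filter_upwards [measure_eq_zero_iff_ae_notMem.1 hcrit, measure_eq_zero_iff_ae_notMem.1 hN]
    with v hv1 hv2 x s hvx hgx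
  have hl1 : ∀ a b, l1 (L.symm (a, b)) = a := fun a b => by simp [l1]
  have hl2 : ∀ a b, l2 (L.symm (a, b)) = b := fun a b => by simp [l2]
  have hp : Ψ (L.symm (x, s)) = v := by simp only [Ψ]; rw [hl1, hl2, hvx]
  constructor
  · intro c
    have h1 : L.symm (x, s) ∈ M := by change g (Φ (l1 _)) = 0; rw [hl1]; exact hgx
    have h2 : ‖h' (L.symm (x, s)) - 0‖₊ ≤ 0 := by
      by_contra hcon
      exact hv2 ⟨_, fun hc => hcon (hc h1), hp⟩
    have h3 : h' (L.symm (x, s)) = 0 := by simpa using h2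
    have h4 := DFunLike.congr_fun h3 (L.symm (c, 0))
    simp only [h', ContinuousLinearMap.smulRight_apply, ContinuousLinearMap.comp_apply, hl1,
      zero_apply, smul_eq_zero, he₁, or_false] at h4
    exact h4
  · have h1 : (Ψ' (L.symm (x, s))).det ≠ 0 := fun hd => hv1 ⟨_, hd, hp⟩
    refine LinearMap.finrank_range_of_inj ?_
    rw [injective_iff_map_eq_zero]
    intro c hc
    have h2 : Ψ' (L.symm (x, s)) (L.symm (c, 0)) = 0 := by
      simp only [Ψ', add_apply, ContinuousLinearMap.comp_apply, hl1, hl2,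
        ContinuousLinearMap.smulRight_apply, zero_smul, add_zero]
      exact hc
    have h3 : Function.Injective (Ψ' (L.symm (x, s))) := by
      have := (LinearMap.isUnit_iff_isUnit_det (Ψ' (L.symm (x, s))).toLinearMap).2
        (isUnit_iff_ne_zero.2 h1)
      exact LinearMap.ker_eq_bot.1 ((LinearMap.isUnit_iff_ker_eq_bot _).1 this)
    have h4 : L.symm (c, 0) = 0 := h3 (by rw [h2, map_zero])
    have h5 := congrArg l1 h4
    rwa [hl1, map_zero] at h5

/-! ### Gradients and second derivatives. -/

section Gradient

variable {n : ℕ}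

theorem inner_gradient_eq_fderiv (f : EuclideanSpace ℝ (Fin n) → ℝ)
    (x v : EuclideanSpace ℝ (Fin n)) : inner ℝ (gradient f x) v = fderiv ℝ f x v := by
  simp [gradient]

theorem contDiff_gradient {f : EuclideanSpace ℝ (Fin n) → ℝ} (hf : ContDiff ℝ ∞ f) :
    ContDiff ℝ ∞ (gradient f) :=
  (InnerProductSpace.toDual ℝ (EuclideanSpace ℝ (Fin n))).symm.contDiff.comp
    (hf.fderiv_right (m := ∞) (by simp))

theorem inner_fderiv_gradient {f : EuclideanSpace ℝ (Fin n) → ℝ} (hf : ContDiff ℝ ∞ f)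
    (x v c : EuclideanSpace ℝ (Fin n)) :
    inner ℝ (fderiv ℝ (gradient f) x v) c = fderiv ℝ (fderiv ℝ f) x v c := by
  have h1 := (innerSL ℝ c).hasFDerivAt.comp x
    ((contDiff_gradient hf).differentiable (by simp) x).hasFDerivAt
  have h2 := (ContinuousLinearMap.apply ℝ ℝ c).hasFDerivAt.comp x
    ((hf.fderiv_right (m := ∞) (by simp)).differentiable (by simp) x).hasFDerivAt
  have h3 : innerSL ℝ c ∘ gradient f = ContinuousLinearMap.apply ℝ ℝ c ∘ fderiv ℝ f := by
    ext y
    simp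
  rw [h3] at h1
  have h4 := DFunLike.congr_fun (h1.unique h2) v
  simpa [real_inner_comm] using h4

theorem fderiv_fderiv_symm {f : EuclideanSpace ℝ (Fin n) → ℝ} (hf : ContDiff ℝ ∞ f)
    (x v c : EuclideanSpace ℝ (Fin n)) :
    fderiv ℝ (fderiv ℝ f) x v c = fderiv ℝ (fderiv ℝ f) x c v :=
  (hf.contDiffAt.isSymmSndFDerivAt (by
    rw [minSmoothness_of_isRCLikeNormedField]; exact WithTop.coe_le_coe.2 (le_top (a := (2 : ℕ∞))))) v c

end Gradient

/-! ### Tangent spaces and null directions through local equations. -/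

section LocalEquation

variable {n : ℕ} {S : Set (EuclideanSpace ℝ (Fin n))} {x : EuclideanSpace ℝ (Fin n)}
  {f : EuclideanSpace ℝ (Fin n) → ℝ}

theorem IsLocalEquation.apply_eq_zero (hf : IsLocalEquation S x f) (hx : x ∈ S) : f x = 0 :=
  hf.eventually_mem_iff.self_of_nhds.1 hx

theorem IsLocalEquation.eventually (hf : IsLocalEquation S x f) :
    ∀ᶠ y in 𝓝 x, IsLocalEquation S y f := by
  filter_upwards [hf.eventually_mem_iff.eventually_nhds,
    (contDiff_gradient hf.smooth).continuous.continuousAt.eventually_ne hf.gradient_ne] with y h1 h2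
  exact ⟨hf.smooth, h2, h1⟩

theorem surjective_of_ne_zero {V : Type*} [NormedAddCommGroup V] [NormedSpace ℝ V] {φ : V →L[ℝ] ℝ}
    (h : φ ≠ 0) : Function.Surjective φ :=
  LinearMap.surjective (f := φ.toLinearMap) fun h0 => h (ContinuousLinearMap.coe_injective h0)

theorem IsLocalEquation.surjective (hf : IsLocalEquation S x f) :
    Function.Surjective (fderiv ℝ f x) := by
  refine surjective_of_ne_zero fun h => hf.gradient_ne ?_
  simp [gradient, h]

/-- One inclusion tests with the functions `φ ∘ F` for `φ` in the dual space; the other pulls a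
function vanishing on `S` back along a parametrization of the level set. -/
theorem tangentSpaceAt_eq_ker {Z : Type*} [NormedAddCommGroup Z] [NormedSpace ℝ Z]
    [FiniteDimensional ℝ Z] {F : EuclideanSpace ℝ (Fin n) → Z} (hF : ContDiff ℝ ∞ F)
    (hs : Function.Surjective (fderiv ℝ F x)) (hx : x ∈ S) (hS : ∀ᶠ y in 𝓝 x, (y ∈ S ↔ F y = 0)) :
    tangentSpaceAt S x = (fderiv ℝ F x).ker := by
  have hFx : F x = 0 := hS.self_of_nhds.1 hx
  apply le_antisymm
  · intro v hv
    simp only [tangentSpaceAt, Submodule.mem_iInf] at hv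
    rw [LinearMap.mem_ker]
    refine SeparatingDual.eq_zero_of_forall_dual_eq_zero (R := ℝ) fun φ => ?_
    have h := hv (fun y => φ (F y)) ⟨φ.contDiff.comp hF, by
      filter_upwards [hS.filter_mono nhdsWithin_le_nhds, self_mem_nhdsWithin] with y h1 h2
      rw [h1.1 h2, map_zero]⟩
    have h2 : fderiv ℝ (fun y => φ (F y)) x = φ.comp (fderiv ℝ F x) :=
      (φ.hasFDerivAt.comp x (hF.differentiable (by simp) x).hasFDerivAt).fderiv
    rw [h2] at h
    exact h
  · intro v hv
    simp only [tangentSpaceAt, Submodule.mem_iInf]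
    rintro g ⟨hg, hg0⟩
    obtain ⟨pr, hpr⟩ := exists_continuousLinearMap_projection (fderiv ℝ F x).ker
    obtain ⟨i, hi, hi0, hiF, -, -, hid⟩ := exists_levelSet_parametrization hF hFx hs pr hpr
    have h1 : HasFDerivAt (fun u => g (i u)) ((fderiv ℝ g x).comp (fderiv ℝ i 0)) 0 := by
      have := (hg.differentiable (by simp) (i 0)).hasFDerivAt.comp 0
        (hi.differentiable (by simp) 0).hasFDerivAt
      rwa [hi0] at this
    have hit : Filter.Tendsto i (𝓝 0) (𝓝 x) := by
      have := hi.continuous.tendsto 0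
      rwa [hi0] at this
    have h2 : HasFDerivAt (fun u => g (i u)) (0 : _ →L[ℝ] ℝ) 0 := by
      refine (hasFDerivAt_const (0 : ℝ) _).congr_of_eventuallyEq ?_
      have h3 := hit.eventually (eventually_nhdsWithin_iff.1 hg0)
      filter_upwards [hiF, h3, hit.eventually hS] with u h4 h5 h6
      exact h5 (h6.2 h4)
    have h3 := DFunLike.congr_fun (h1.unique h2) ⟨v, hv⟩
    rw [ContinuousLinearMap.comp_apply, hid] at h3
    exact h3

theorem IsLocalEquation.tangentSpaceAt_eq (hf : IsLocalEquation S x f) (hx : x ∈ S) :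
    tangentSpaceAt S x = (fderiv ℝ f x).ker :=
  tangentSpaceAt_eq_ker hf.smooth hf.surjective hx hf.eventually_mem_iff

theorem tangentSpaceAt_mono {S T : Set (EuclideanSpace ℝ (Fin n))} (h : S ⊆ T) :
    tangentSpaceAt S x ≤ tangentSpaceAt T x := by
  intro v hv
  simp only [tangentSpaceAt, Submodule.mem_iInf] at hv ⊢
  exact fun g hg => hv g ⟨hg.1, hg.2.filter_mono (nhdsWithin_mono x h)⟩

theorem tangentSpaceAt_inter_of_isOpen {U : Set (EuclideanSpace ℝ (Fin n))} (hU : IsOpen U)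
    (hx : x ∈ U) : tangentSpaceAt (S ∩ U) x = tangentSpaceAt S x := by
  simp only [tangentSpaceAt, nhdsWithin_inter_of_mem' (mem_nhdsWithin_of_mem_nhds (hU.mem_nhds hx))]

/-- Differentiating the normalizing factor of the unit normal only contributes a multiple of the
gradient, which is orthogonal to the tangent space. So up to a nonzero factor the shape operator is
the Hessian of `f` restricted to tangent vectors. -/
theorem IsLocalEquation.mem_nullDirections_iff (hf : IsLocalEquation S x f) (hx : x ∈ S)
    {w : EuclideanSpace ℝ (Fin n)} :
    w ∈ nullDirections S f x ↔ fderiv ℝ f x w = 0 ∧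
      ∀ c, fderiv ℝ f x c = 0 → fderiv ℝ (fderiv ℝ f) x w c = 0 := by
  have hT := hf.tangentSpaceAt_eq hx
  have hTm : ∀ v, v ∈ tangentSpaceAt S x ↔ fderiv ℝ f x v = 0 := fun v => by
    rw [hT, LinearMap.mem_ker]; rfl
  have hgd : HasFDerivAt (gradient f) (fderiv ℝ (gradient f) x) x :=
    ((contDiff_gradient hf.smooth).differentiable (by simp) x).hasFDerivAt
  have hnd : DifferentiableAt ℝ (fun y => ‖gradient f y‖⁻¹) x :=
    (hgd.differentiableAt.norm ℝ hf.gradient_ne).inv (norm_ne_zero_iff.2 hf.gradient_ne)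
  have hu := hnd.hasFDerivAt.smul hgd
  have hinner : ∀ w c, fderiv ℝ f x c = 0 → inner ℝ (fderiv ℝ (unitNormal f) x w) c =
      ‖gradient f x‖⁻¹ * fderiv ℝ (fderiv ℝ f) x w c := by
    intro w c hc
    have h1 : fderiv ℝ (unitNormal f) x = _ := hu.fderiv
    rw [h1]
    simp [inner_add_left, inner_smul_left, inner_fderiv_gradient hf.smooth,
      hc]
  have hne : ‖gradient f x‖⁻¹ ≠ 0 := inv_ne_zero (norm_ne_zero_iff.2 hf.gradient_ne)
  simp only [nullDirections, Submodule.mem_map, Module.End.mem_eigenspace_iff, zero_smul]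
  constructor
  · rintro ⟨w, hw, rfl⟩
    refine ⟨(hTm _).1 w.2, fun c hc => ?_⟩
    have h1 : (tangentSpaceAt S x).orthogonalProjectionOnto (fderiv ℝ (unitNormal f) x w) = 0 := by
      simpa [shapeOperator] using hw
    have h2 := (Submodule.orthogonalProjectionOnto_eq_zero_iff).1 h1
    have h3 := (Submodule.mem_orthogonal' _ _).1 h2 c ((hTm c).2 hc)
    rw [hinner _ _ hc] at h3
    exact (mul_eq_zero.1 h3).resolve_left hne
  · rintro ⟨h1, h2⟩
    refine ⟨⟨w, (hTm w).2 h1⟩, ?_, rfl⟩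
    have h3 : (tangentSpaceAt S x).orthogonalProjectionOnto (fderiv ℝ (unitNormal f) x w) = 0 := by
      rw [Submodule.orthogonalProjectionOnto_eq_zero_iff, Submodule.mem_orthogonal']
      intro c hc
      rw [hinner _ _ ((hTm c).1 hc), h2 c ((hTm c).1 hc), mul_zero]
    simpa [shapeOperator] using h3

end LocalEquation

/-! ### Tangent planes in homogeneous coordinates. -/

section TangentPlanes

variable {n : ℕ} {S : Set (EuclideanSpace ℝ (Fin n))} {x : EuclideanSpace ℝ (Fin n)}

/-- A hyperplane is a maximal proper subspace, so failing to be transversal to it means lying in it.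
-/
theorem sup_orthogonal_ne_top_iff {T : Submodule ℝ (EuclideanSpace ℝ (Fin n))}
    {α : EuclideanSpace ℝ (Fin n)} (hα : α ≠ 0) :
    T ⊔ (ℝ ∙ α)ᗮ ≠ ⊤ ↔ ∀ t ∈ T, inner ℝ α t = 0 := by
  constructor
  · intro h t ht
    by_contra hne
    refine h (eq_top_iff.2 fun v _ => ?_)
    have h1 : v = (inner ℝ α v / inner ℝ α t) • t + (v - (inner ℝ α v / inner ℝ α t) • t) := by simp
    rw [h1]
    refine Submodule.add_mem_sup (T.smul_mem _ ht) ?_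
    rw [Submodule.mem_orthogonal_singleton_iff_inner_right, inner_sub_right, inner_smul_right]
    field_simp
    simp
  · intro h htop
    have h1 : T ⊔ (ℝ ∙ α)ᗮ ≤ (ℝ ∙ α)ᗮ :=
      sup_le (fun t ht => Submodule.mem_orthogonal_singleton_iff_inner_right.2 (h t ht)) le_rfl
    rw [htop] at h1
    have h2 := Submodule.mem_orthogonal_singleton_iff_inner_right.1 (h1 (Submodule.mem_top (x := α)))
    exact hα (inner_self_eq_zero.1 h2)

theorem mem_homogeneousVectors_tangentPlanesAt {z : EuclideanSpace ℝ (Fin n) × ℝ} :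
    z ∈ homogeneousVectors (tangentPlanesAt S x) ↔ x ∈ S ∧ z.1 ≠ 0 ∧ inner ℝ z.1 x = z.2 ∧
      ∀ t ∈ tangentSpaceAt S x, inner ℝ z.1 t = 0 := by
  constructor
  · rintro ⟨hz, hx, α, p, h, he, hα, hp, hT⟩
    rw [sup_orthogonal_ne_top_iff hα] at hT
    obtain ⟨a, ha⟩ := (Projectivization.mk_eq_mk_iff' ℝ _ _ _ _).1 he
    subst ha
    have ha0 : a ≠ 0 := fun h0 => hz (by simp [h0])
    refine ⟨hx, by simp [ha0, hα], by simp [inner_smul_left, hp], fun t ht => ?_⟩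
    simp [inner_smul_left, hT t ht]
  · rintro ⟨hx, hα, hp, hT⟩
    have hz : z ≠ 0 := fun h => hα (by simp [h])
    exact ⟨hz, hx, z.1, z.2, hz, rfl, hα, hp, (sup_orthogonal_ne_top_iff hα).2 hT⟩

theorem IsLocalEquation.mem_homogeneousVectors_iff {f : EuclideanSpace ℝ (Fin n) → ℝ}
    (hf : IsLocalEquation S x f) (hx : x ∈ S) {z : EuclideanSpace ℝ (Fin n) × ℝ} :
    z ∈ homogeneousVectors (tangentPlanesAt S x) ↔ ∃ c : ℝ, c ≠ 0 ∧
      z = c • (gradient f x, inner ℝ (gradient f x) x) := by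
  rw [mem_homogeneousVectors_tangentPlanesAt]
  have hT : tangentSpaceAt S x = (ℝ ∙ gradient f x)ᗮ := by
    rw [hf.tangentSpaceAt_eq hx]
    ext v
    rw [Submodule.mem_orthogonal_singleton_iff_inner_right, inner_gradient_eq_fderiv]; rfl
  constructor
  · rintro ⟨-, hα, hp, h⟩
    have h1 : z.1 ∈ (ℝ ∙ gradient f x)ᗮᗮ := by
      rw [Submodule.mem_orthogonal']
      rwa [hT] at h
    rw [Submodule.orthogonal_orthogonal, Submodule.mem_span_singleton] at h1
    obtain ⟨c, hc⟩ := h1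
    refine ⟨c, fun h0 => hα (by rw [← hc, h0, zero_smul]), ?_⟩
    ext1
    · exact hc.symm
    · rw [← hp, ← hc]; simp [inner_smul_left]
  · rintro ⟨c, hc, rfl⟩
    refine ⟨hx, by simp [hc, hf.gradient_ne], by simp [inner_smul_left], fun t ht => ?_⟩
    rw [hT, Submodule.mem_orthogonal_singleton_iff_inner_right] at ht
    simp [inner_smul_left, ht]

theorem mem_homogeneousVectors_tangentPlanesAlong {T L : Set (EuclideanSpace ℝ (Fin n))}
    {z : EuclideanSpace ℝ (Fin n) × ℝ} : z ∈ homogeneousVectors (tangentPlanesAlong T L) ↔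
      ∃ x ∈ L ∩ T, z ∈ homogeneousVectors (tangentPlanesAt T x) := by
  simp only [homogeneousVectors, tangentPlanesAlong, Set.mem_iUnion, Set.mem_ofPred_eq]
  constructor
  · rintro ⟨h, x, hx, hz⟩
    exact ⟨x, hx, h, hz⟩
  · rintro ⟨x, hx, h, hz⟩
    exact ⟨h, x, hx, hz⟩

theorem mem_homogeneousVectors_dualSet {z : EuclideanSpace ℝ (Fin n) × ℝ} :
    z ∈ homogeneousVectors (dualSet S) ↔ ∃ x, z ∈ homogeneousVectors (tangentPlanesAt S x) := by
  simp only [homogeneousVectors, dualSet, Set.mem_iUnion, Set.mem_ofPred_eq]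
  exact exists_comm

theorem dualSet_inter_of_isOpen {U : Set (EuclideanSpace ℝ (Fin n))} (hU : IsOpen U) :
    dualSet (S ∩ U) = tangentPlanesAlong S U := by
  ext w
  simp only [dualSet, tangentPlanesAlong, Set.mem_iUnion, exists_prop, tangentPlanesAt,
    Set.mem_ofPred_eq]
  refine exists_congr fun x => ?_
  constructor
  · rintro ⟨⟨hS, hxU⟩, h⟩
    rw [tangentSpaceAt_inter_of_isOpen hU hxU] at h
    exact ⟨⟨hxU, hS⟩, hS, h⟩
  · rintro ⟨⟨hxU, hS⟩, -, h⟩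
    rw [tangentSpaceAt_inter_of_isOpen hU hxU]
    exact ⟨⟨hS, hxU⟩, h⟩

end TangentPlanes

/-! ### The normalized Gauss map. -/

section GaussMap

variable {n : ℕ} {S : Set (EuclideanSpace ℝ (Fin n))} {x : EuclideanSpace ℝ (Fin n)}
  {f : EuclideanSpace ℝ (Fin n) → ℝ}
  {X : Type*} [NormedAddCommGroup X] [NormedSpace ℝ X]

/-- `G` is the map that takes `u` to the plane tangent to `S` at `i u`, with the homogeneous
coordinates normalized by the vector `ν`. The conditions are those that hold at the point `u`
for a smooth map `i` into `S`. -/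
structure IsGaussMapAt (S : Set (EuclideanSpace ℝ (Fin n))) (f : EuclideanSpace ℝ (Fin n) → ℝ)
    (ν : EuclideanSpace ℝ (Fin n)) (i : X → EuclideanSpace ℝ (Fin n))
    (G : X → EuclideanSpace ℝ (Fin n) × ℝ) (u : X) : Prop where
  mem : i u ∈ S
  isLocalEquation : IsLocalEquation S (i u) f
  inner_ne : inner ℝ ν (gradient f (i u)) ≠ 0
  apply_eq : G u = (inner ℝ ν (gradient f (i u)))⁻¹ •
    (gradient f (i u), inner ℝ (gradient f (i u)) (i u))
  fderiv_tangent : ∀ c, fderiv ℝ f (i u) (fderiv ℝ i u c) = 0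
  inner_fderiv_eq : ∀ c w, fderiv ℝ f (i u) w = 0 → inner ℝ (fderiv ℝ G u c).1 w =
    (inner ℝ ν (gradient f (i u)))⁻¹ * fderiv ℝ (fderiv ℝ f) (i u) (fderiv ℝ i u c) w
  incidence : ∀ c, inner ℝ (fderiv ℝ G u c).1 (i u) = (fderiv ℝ G u c).2
  normalized : ∀ c, inner ℝ ν (fderiv ℝ G u c).1 = 0

/-- The Hessian controls the tangential part of `dG`, the normalization by `ν` excludes a normal
part, and incidence determines the last coordinate. -/
theorem IsGaussMapAt.fderiv_eq_zero_iff {ν : EuclideanSpace ℝ (Fin n)}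
    {i : X → EuclideanSpace ℝ (Fin n)} {G : X → EuclideanSpace ℝ (Fin n) × ℝ} {u : X}
    (h : IsGaussMapAt S f ν i G u) (c : X) :
    fderiv ℝ G u c = 0 ↔ fderiv ℝ i u c ∈ nullDirections S f (i u) := by
  rw [h.isLocalEquation.mem_nullDirections_iff h.mem]
  constructor
  · intro h0
    refine ⟨h.fderiv_tangent c, fun w hw => ?_⟩
    have h1 := h.inner_fderiv_eq c w hw
    rw [h0, Prod.fst_zero, inner_zero_left] at h1
    exact (mul_eq_zero.1 h1.symm).resolve_left (inv_ne_zero h.inner_ne)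
  · rintro ⟨-, h1⟩
    have h2 : (fderiv ℝ G u c).1 ∈ (ℝ ∙ gradient f (i u))ᗮᗮ := by
      rw [Submodule.mem_orthogonal']
      intro w hw
      rw [Submodule.mem_orthogonal_singleton_iff_inner_right, inner_gradient_eq_fderiv] at hw
      rw [h.inner_fderiv_eq c w hw, h1 w hw, mul_zero]
    rw [Submodule.orthogonal_orthogonal, Submodule.mem_span_singleton] at h2
    obtain ⟨a, ha⟩ := h2
    have h3 := h.normalized c
    rw [← ha, inner_smul_right] at h3
    have h4 : (fderiv ℝ G u c).1 = 0 := by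
      rw [← ha, (mul_eq_zero.1 h3).resolve_right h.inner_ne, zero_smul]
    have h5 := h.incidence c
    rw [h4, inner_zero_left] at h5
    exact Prod.ext h4 h5.symm

theorem exists_isGaussMapAt [FiniteDimensional ℝ X] (hf : IsLocalEquation S x f)
    {i : X → EuclideanSpace ℝ (Fin n)} (hi : ContDiff ℝ ∞ i) {u₀ : X} (hi0 : i u₀ = x)
    (hiS : ∀ᶠ u in 𝓝 u₀, i u ∈ S) {ν : EuclideanSpace ℝ (Fin n)}
    (hν : inner ℝ ν (gradient f x) ≠ 0) :
    ∃ G : X → EuclideanSpace ℝ (Fin n) × ℝ, ContDiff ℝ ∞ G ∧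
      ∀ᶠ u in 𝓝 u₀, IsGaussMapAt S f ν i G u := by
  have hg := contDiff_gradient hf.smooth
  have hgi : ContDiff ℝ ∞ (fun u => gradient f (i u)) := hg.comp hi
  have hd : ContDiff ℝ ∞ (fun u => inner ℝ ν (gradient f (i u))) := contDiff_const.inner ℝ hgi
  have hdne : ∀ᶠ u in 𝓝 u₀, inner ℝ ν (gradient f (i u)) ≠ 0 :=
    hd.continuous.continuousAt.eventually_ne (by rwa [hi0])
  obtain ⟨G, hG, hGe⟩ := exists_contDiff_eventuallyEq (x := u₀)
    (f := fun u => (inner ℝ ν (gradient f (i u)))⁻¹ •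
      (gradient f (i u), inner ℝ (gradient f (i u)) (i u))) (by
      filter_upwards [hdne] with u hu
      exact (hd.contDiffAt.inv hu).smul (hgi.prodMk (hgi.inner ℝ hi)).contDiffAt)
  refine ⟨G, hG, ?_⟩
  have hit : Filter.Tendsto i (𝓝 u₀) (𝓝 x) := by
    have := hi.continuous.tendsto u₀
    rwa [hi0] at this
  filter_upwards [(hit.eventually hf.eventually).eventually_nhds, hiS.eventually_nhds,
    hdne.eventually_nhds, hGe.eventually_nhds] with u hloc hS hne hGu
  have hid : HasFDerivAt i (fderiv ℝ i u) u := (hi.differentiable (by simp) u).hasFDerivAt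
  have hGd : HasFDerivAt G (fderiv ℝ G u) u := (hG.differentiable (by simp) u).hasFDerivAt
  have htan : ∀ c, fderiv ℝ f (i u) (fderiv ℝ i u c) = 0 := by
    intro c
    have h1 := (hf.smooth.differentiable (by simp) (i u)).hasFDerivAt.comp u hid
    have h2 : HasFDerivAt (f ∘ i) (0 : X →L[ℝ] ℝ) u := by
      refine (hasFDerivAt_const (0 : ℝ) u).congr_of_eventuallyEq ?_
      filter_upwards [hloc, hS] with y h3 h4
      exact h3.apply_eq_zero h4
    exact DFunLike.congr_fun (h1.unique h2) c
  have hG1 : HasFDerivAt (fun y => (G y).1)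
      ((ContinuousLinearMap.fst ℝ (EuclideanSpace ℝ (Fin n)) ℝ).comp (fderiv ℝ G u)) u := hGd.fst
  have hG2 : HasFDerivAt (fun y => (G y).2)
      ((ContinuousLinearMap.snd ℝ (EuclideanSpace ℝ (Fin n)) ℝ).comp (fderiv ℝ G u)) u := hGd.snd
  refine ⟨hS.self_of_nhds, hloc.self_of_nhds, hne.self_of_nhds, hGu.self_of_nhds, htan, ?_, ?_, ?_⟩
  · intro c w hw
    have hinv : DifferentiableAt ℝ (fun y => (inner ℝ ν (gradient f (i y)))⁻¹) u :=
      (hd.differentiable (by simp) u).inv hne.self_of_nhds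
    have hgrad : HasFDerivAt (fun y => gradient f (i y))
        ((fderiv ℝ (gradient f) (i u)).comp (fderiv ℝ i u)) u :=
      (hg.differentiable (by simp) (i u)).hasFDerivAt.comp u hid
    have h1 : HasFDerivAt (fun y => (G y).1) _ u :=
      (hinv.hasFDerivAt.smul hgrad).congr_of_eventuallyEq
        (hGu.mono fun y hy => congrArg Prod.fst hy)
    have h2 := DFunLike.congr_fun (hG1.unique h1) c
    simp only [ContinuousLinearMap.comp_apply, ContinuousLinearMap.coe_fst'] at h2
    rw [h2]
    simp [inner_add_left, inner_smul_left, inner_fderiv_gradient hf.smooth, hw]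
  -- Differentiate the identity `⟨(G u).1, i u⟩ = (G u).2`: the term with the derivative of `i`
  -- drops out because `(G u).1` is normal to `S`.
  · intro c
    have h1 : HasFDerivAt (fun y => (G y).2) _ u :=
      (hG1.inner ℝ hid).congr_of_eventuallyEq
        (hGu.mono fun y hy => by simp [hy, inner_smul_left])
    have h2 := DFunLike.congr_fun (hG2.unique h1) c
    have h3 : inner ℝ (G u).1 (fderiv ℝ i u c) = 0 := by
      rw [hGu.self_of_nhds]
      simp [inner_smul_left, htan]
    simp only [ContinuousLinearMap.comp_apply, ContinuousLinearMap.coe_snd',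
      ContinuousLinearMap.prod_apply, fderivInnerCLM_apply, ContinuousLinearMap.coe_fst', h3,
      zero_add] at h2
    exact h2.symm
  · intro c
    have h1 := (innerSL ℝ ν).hasFDerivAt.comp u hG1
    have h2 : HasFDerivAt (innerSL ℝ ν ∘ fun y => (G y).1) (0 : X →L[ℝ] ℝ) u := by
      refine (hasFDerivAt_const (1 : ℝ) u).congr_of_eventuallyEq ?_
      filter_upwards [hGu, hne] with y h3 h4
      simp only [Function.comp_apply, innerSL_apply_apply]
      rw [h3]
      simp only [Prod.smul_fst, inner_smul_right]
      exact inv_mul_cancel₀ h4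
    exact DFunLike.congr_fun (h1.unique h2) c

end GaussMap

/-! ### Hypersurfaces of constant nullity: images and fibres of the Gauss map. -/

section

variable {n : ℕ} {S : Set (EuclideanSpace ℝ (Fin n))} {x : EuclideanSpace ℝ (Fin n)}
  {f : EuclideanSpace ℝ (Fin n) → ℝ}

theorem finrank_range_eq_of_finrank_ker_eq {X Y : Type*} [NormedAddCommGroup X]
    [NormedSpace ℝ X] [FiniteDimensional ℝ X] [NormedAddCommGroup Y] [NormedSpace ℝ Y]
    {A B : X →L[ℝ] Y} (h : finrank ℝ A.ker = finrank ℝ B.ker) :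
    finrank ℝ A.range = finrank ℝ B.range := by
  have h1 := LinearMap.finrank_range_add_finrank_ker A.toLinearMap
  have h2 := LinearMap.finrank_range_add_finrank_ker B.toLinearMap
  omega

theorem IsGaussMapAt.ker_fderiv {X : Type*} [NormedAddCommGroup X] [NormedSpace ℝ X]
    {ν : EuclideanSpace ℝ (Fin n)}
    {i : X → EuclideanSpace ℝ (Fin n)} {G : X → EuclideanSpace ℝ (Fin n) × ℝ} {u : X}
    (h : IsGaussMapAt S f ν i G u) :
    (fderiv ℝ G u).ker = (nullDirections S f (i u)).comap (fderiv ℝ i u).toLinearMap := by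
  ext c
  exact h.fderiv_eq_zero_iff c

/-- The planes tangent to the hypersurface `T` along a parametrized submanifold of `T` form a
submanifold, when the parametrization meets the null directions in a constant dimension. -/
theorem exists_isProjectiveSubmanifold_tangentPlanesAlong {X : Type*} [NormedAddCommGroup X]
    [NormedSpace ℝ X] [FiniteDimensional ℝ X] {T L : Set (EuclideanSpace ℝ (Fin n))}
    (hf : IsLocalEquation T x f) {i : X → EuclideanSpace ℝ (Fin n)}
    (hi : ContDiff ℝ ∞ i) (hi0 : i 0 = x) (p : EuclideanSpace ℝ (Fin n) →L[ℝ] X)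
    (hiT : ∀ᶠ u in 𝓝 0, i u ∈ L ∩ T) (hip : ∀ᶠ u in 𝓝 0, p (i u - x) = u)
    (hpi : ∀ᶠ y in 𝓝 x, y ∈ L ∩ T → i (p (y - x)) = y) {k c : ℕ}
    (hk : ∀ᶠ u in 𝓝 0,
      finrank ℝ ((nullDirections T f (i u)).comap (fderiv ℝ i u).toLinearMap) = k)
    (hc : c + finrank ℝ X = n + k) :
    ∃ U : Set (EuclideanSpace ℝ (Fin n)), IsOpen U ∧ x ∈ U ∧
      IsProjectiveSubmanifoldOfCodim c (tangentPlanesAlong T (L ∩ U)) := by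
  have hνx : inner ℝ (gradient f x) (gradient f x) ≠ (0 : ℝ) :=
    fun h => hf.gradient_ne (inner_self_eq_zero.1 h)
  obtain ⟨G, hG, hGm⟩ := exists_isGaussMapAt hf hi hi0 (hiT.mono fun u h => h.2) hνx
  have hker : ∀ᶠ u in 𝓝 0, finrank ℝ (fderiv ℝ G u).ker = k := by
    filter_upwards [hGm, hk] with u h1 h2
    rw [h1.ker_fderiv, h2]
  have hr : ∀ᶠ u in 𝓝 0,
      finrank ℝ (fderiv ℝ G u).range = finrank ℝ (fderiv ℝ G 0).range := by
    filter_upwards [hker] with u hu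
    exact finrank_range_eq_of_finrank_ker_eq (hu.trans hker.self_of_nhds.symm)
  obtain ⟨N, hN, hNo, hxN⟩ := mem_nhds_iff.1 hpi
  have hit : Filter.Tendsto i (𝓝 0) (𝓝 x) := by
    have := hi.continuous.tendsto 0
    rwa [hi0] at this
  -- With `ν` the gradient at `x`, the normalization of `G` says precisely that its image lies in `ℓ
  -- = 1`.
  let ℓ : EuclideanSpace ℝ (Fin n) × ℝ →L[ℝ] ℝ :=
    (innerSL ℝ (gradient f x)).comp (ContinuousLinearMap.fst ℝ _ ℝ)
  have hℓ : ∀ᶠ u in 𝓝 0, ℓ (G u) = 1 := by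
    filter_upwards [hGm] with u hu
    simp only [ℓ, ContinuousLinearMap.comp_apply, ContinuousLinearMap.coe_fst',
      innerSL_apply_apply]
    rw [hu.apply_eq, Prod.smul_fst, inner_smul_right]
    exact inv_mul_cancel₀ hu.inner_ne
  have hW := (((hGm.and hiT).and hip).and (hit.eventually (hNo.eventually_mem hxN)))
  obtain ⟨U, hUW, hUo, h0U, hsub⟩ := exists_isSubmanifoldOfCodim_cone hG ℓ hℓ hr hW (c := c) (by
    have h1 := LinearMap.finrank_range_add_finrank_ker (fderiv ℝ G 0).toLinearMap
    have h2 : finrank ℝ (fderiv ℝ G 0).toLinearMap.ker = k := hker.self_of_nhds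
    have h3 : finrank ℝ (EuclideanSpace ℝ (Fin n) × ℝ) = n + 1 := by simp
    rw [h3]
    omega)
  have hpc : Continuous fun y => p (y - x) := by fun_prop
  -- In `N` every point of `L ∩ T` is recovered from its parameter, and the preimage of `U` keeps
  -- that parameter where the cone is known to be a submanifold.
  refine ⟨N ∩ (fun y => p (y - x)) ⁻¹' U, hNo.inter (hUo.preimage hpc), ⟨hxN, by simpa using h0U⟩, ?_⟩
  have hset : homogeneousVectors (tangentPlanesAlong T (L ∩ (N ∩ (fun y => p (y - x)) ⁻¹' U))) =
      {v | ∃ t : ℝ, t ≠ 0 ∧ ∃ u ∈ U, v = t • G u} := by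
    ext z
    rw [mem_homogeneousVectors_tangentPlanesAlong]
    constructor
    · rintro ⟨y, ⟨⟨hyL, hyN, hyU⟩, hyT⟩, hz⟩
      have hy : i (p (y - x)) = y := hN hyN ⟨hyL, hyT⟩
      obtain ⟨⟨⟨hg, -⟩, -⟩, -⟩ := hUW hyU
      have hle := hg.isLocalEquation
      obtain ⟨a, ha, hza⟩ := (hle.mem_homogeneousVectors_iff hg.mem).1 (hy.symm ▸ hz)
      refine ⟨a * inner ℝ (gradient f x) (gradient f (i (p (y - x)))),
        mul_ne_zero ha hg.inner_ne, _, hyU, ?_⟩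
      rw [hza, hg.apply_eq, smul_smul, mul_assoc, mul_inv_cancel₀ hg.inner_ne, mul_one]
    · rintro ⟨t, ht, u, hu, rfl⟩
      obtain ⟨⟨⟨hg, hLT⟩, hpu⟩, hNu⟩ := hUW hu
      refine ⟨i u, ⟨⟨hLT.1, hNu, ?_⟩, hLT.2⟩, ?_⟩
      · simp only [Set.mem_preimage]
        rwa [hpu]
      · rw [hg.isLocalEquation.mem_homogeneousVectors_iff hg.mem]
        refine ⟨t * (inner ℝ (gradient f x) (gradient f (i u)))⁻¹,
          mul_ne_zero ht (inv_ne_zero hg.inner_ne), ?_⟩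
        rw [hg.apply_eq, smul_smul]
  rw [IsProjectiveSubmanifoldOfCodim, hset]
  exact hsub

theorem IsLocalEquation.finrank_ker (hf : IsLocalEquation S x f) :
    finrank ℝ (fderiv ℝ f x).ker + 1 = n := by
  have h := LinearMap.finrank_range_add_finrank_ker (fderiv ℝ f x).toLinearMap
  rw [LinearMap.range_eq_top.2 hf.surjective, finrank_top, finrank_self, finrank_euclideanSpace_fin]
    at h
  have h' : finrank ℝ (fderiv ℝ f x).toLinearMap.ker = finrank ℝ (fderiv ℝ f x).ker := rfl
  omega

/-- A parametrization of a hypersurface over its tangent space. -/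
theorem IsLocalEquation.exists_parametrization (hf : IsLocalEquation S x f) (hx : x ∈ S)
    (p : EuclideanSpace ℝ (Fin n) →L[ℝ] (fderiv ℝ f x).ker)
    (hp : ∀ w : (fderiv ℝ f x).ker, p w = w) :
    ∃ i : (fderiv ℝ f x).ker → EuclideanSpace ℝ (Fin n), ContDiff ℝ ∞ i ∧ i 0 = x ∧
      (∀ᶠ u in 𝓝 0, i u ∈ S) ∧ (∀ᶠ u in 𝓝 0, p (i u - x) = u) ∧
      (∀ᶠ y in 𝓝 x, y ∈ S → i (p (y - x)) = y) ∧ (∀ w, fderiv ℝ i 0 w = w) ∧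
      ∀ᶠ u in 𝓝 0, finrank ℝ ((nullDirections S f (i u)).comap (fderiv ℝ i u).toLinearMap) =
        finrank ℝ (nullDirections S f (i u)) := by
  obtain ⟨i, hi, hi0, hif, hip, hpi, hid⟩ :=
    exists_levelSet_parametrization hf.smooth (hf.apply_eq_zero hx) hf.surjective p hp
  have hit : Filter.Tendsto i (𝓝 0) (𝓝 x) := by
    have := hi.continuous.tendsto 0
    rwa [hi0] at this
  have hiS : ∀ᶠ u in 𝓝 0, i u ∈ S := by
    filter_upwards [hif, hit.eventually hf.eventually_mem_iff] with u h1 h2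
    exact h2.2 h1
  refine ⟨i, hi, hi0, hiS, hip, ?_, hid, ?_⟩
  · filter_upwards [hpi, hf.eventually_mem_iff] with y h1 h2 h3
    exact h1 (h2.1 h3)
  · filter_upwards [hip.eventually_nhds, hif.eventually_nhds, hiS,
      hit.eventually hf.eventually] with u h1 h2 h3 h4
    have hdi := (hi.differentiable (by simp) u).hasFDerivAt
    have hpid : ∀ w, p (fderiv ℝ i u w) = w := fun w => by
      have h5 := p.hasFDerivAt.comp u (hdi.sub_const x)
      have h6 : HasFDerivAt (p ∘ fun y => i y - x) (ContinuousLinearMap.id ℝ _) u :=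
        (hasFDerivAt_id u).congr_of_eventuallyEq h1
      exact DFunLike.congr_fun (h5.unique h6) w
    have hfi : ∀ w, fderiv ℝ f (i u) (fderiv ℝ i u w) = 0 := fun w => by
      have h5 := (hf.smooth.differentiable (by simp) (i u)).hasFDerivAt.comp u hdi
      have h6 : HasFDerivAt (f ∘ i) (0 : _ →L[ℝ] ℝ) u :=
        (hasFDerivAt_const (0 : ℝ) u).congr_of_eventuallyEq h2
      exact DFunLike.congr_fun (h5.unique h6) w
    have hinj : Function.Injective (fderiv ℝ i u).toLinearMap :=
      Function.LeftInverse.injective hpid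
    have hrange : (fderiv ℝ i u).toLinearMap.range = (fderiv ℝ f (i u)).ker := by
      refine Submodule.eq_of_le_of_finrank_eq ?_ ?_
      · rintro _ ⟨w, rfl⟩
        exact hfi w
      · rw [LinearMap.finrank_range_of_inj hinj]
        have h5 := hf.finrank_ker
        have h6 := h4.finrank_ker
        omega
    have hle : nullDirections S f (i u) ≤ (fderiv ℝ i u).toLinearMap.range := by
      rw [hrange]
      exact fun w hw => ((h4.mem_nullDirections_iff h3).1 hw).1
    rw [(Submodule.equivMapOfInjective _ hinj _).finrank_eq, Submodule.map_comap_eq,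
      inf_eq_right.2 hle]

/-- A level set of a submersion that lies in a linear space of directions of its tangent space fills
this linear space. -/
theorem eventually_eq_zero_of_levelSet_subset {X Z : Type*} [NormedAddCommGroup X]
    [NormedSpace ℝ X] [FiniteDimensional ℝ X] [NormedAddCommGroup Z] [NormedSpace ℝ Z]
    [FiniteDimensional ℝ Z] {F : X → Z} (hF : ContDiff ℝ ∞ F) (h0 : F 0 = 0)
    (hs : Function.Surjective (fderiv ℝ F 0)) {N : Submodule ℝ X} (hN : N ≤ (fderiv ℝ F 0).ker)
    (hFN : ∀ᶠ u in 𝓝 0, F u = 0 → u ∈ N) : ∀ᶠ u in 𝓝 0, u ∈ N → F u = 0 := by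
  obtain ⟨q, hq⟩ := exists_continuousLinearMap_projection (fderiv ℝ F 0).ker
  obtain ⟨j, hj, hj0, hjF, hjq, -, -⟩ := exists_levelSet_parametrization hF h0 hs q hq
  have hjt : Filter.Tendsto j (𝓝 0) (𝓝 0) := by
    have := hj.continuous.tendsto 0
    rwa [hj0] at this
  -- Since `j b` lies in `N`, hence in the kernel, it equals its own parameter `b`: the level set is
  -- the kernel itself near zero.
  have hmain : ∀ᶠ (b : (fderiv ℝ F 0).ker) in 𝓝 0, F b = 0 := by
    filter_upwards [hjF, hjq, hjt.eventually hFN] with b h1 h2 h3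
    have h4 := hq ⟨j b, hN (h3 h1)⟩
    rw [sub_zero] at h2
    have h5 : (b : X) = j b := congrArg Subtype.val (h2.symm.trans h4)
    rw [h5, h1]
  obtain ⟨δ, hδ, hball⟩ := Metric.eventually_nhds_iff.1 hmain
  filter_upwards [Metric.ball_mem_nhds 0 hδ] with w hw hwn
  exact @hball ⟨w, hN hwn⟩ hw

set_option maxHeartbeats 1000000 in
/-- A hypersurface of constant nullity contains, near each of its points, the affine space of null
directions, and its tangent space is constant along it. -/
theorem IsLocalEquation.eventually_add_mem {k : ℕ} (hS : ∀ x ∈ S, ∀ f, IsLocalEquation S x f →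
      finrank ℝ (nullDirections S f x) = k) (hf : IsLocalEquation S x f) (hx : x ∈ S) :
    ∀ᶠ w in 𝓝 (0 : EuclideanSpace ℝ (Fin n)), w ∈ nullDirections S f x →
      x + w ∈ S ∧ tangentSpaceAt S (x + w) = tangentSpaceAt S x := by
  obtain ⟨p, hp⟩ := exists_continuousLinearMap_projection (fderiv ℝ f x).ker
  obtain ⟨i, hi, hi0, hiS, hip, hpi, hid, hnull⟩ := hf.exists_parametrization hx p hp
  have hνx : inner ℝ (gradient f x) (gradient f x) ≠ (0 : ℝ) :=
    fun h => hf.gradient_ne (inner_self_eq_zero.1 h)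
  obtain ⟨G, hG, hGm⟩ := exists_isGaussMapAt hf hi hi0 hiS hνx
  have hGd := hG.differentiable (by simp)
  have hker : ∀ᶠ u in 𝓝 0, finrank ℝ (fderiv ℝ G u).ker = k := by
    filter_upwards [hGm, hnull] with u h1 h2
    rw [h1.ker_fderiv, h2, hS _ h1.mem _ h1.isLocalEquation]
  have hr : ∀ᶠ u in 𝓝 0,
      finrank ℝ (fderiv ℝ G u).range = finrank ℝ (fderiv ℝ G 0).range := by
    filter_upwards [hker] with u hu
    exact finrank_range_eq_of_finrank_ker_eq (hu.trans hker.self_of_nhds.symm)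
  obtain ⟨π, hπ⟩ := exists_continuousLinearMap_projection (fderiv ℝ G 0).range
  obtain ⟨σ, hσ, -, hσG⟩ := exists_constantRank_factorization hG hr π hπ
  set F : (fderiv ℝ f x).ker → (fderiv ℝ G 0).range := fun u => π (G u) - π (G 0) with hFdef
  have hF : ContDiff ℝ ∞ F := (π.contDiff.comp hG).sub contDiff_const
  have hF' : ∀ u, HasFDerivAt F (π.comp (fderiv ℝ G u)) u := fun u =>
    (π.hasFDerivAt.comp u (hGd u).hasFDerivAt).sub_const _
  have hsurj : Function.Surjective (fderiv ℝ F 0) := by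
    rintro ⟨y, u, hu⟩
    refine ⟨u, ?_⟩
    rw [(hF' 0).fderiv]
    exact (congrArg π hu).trans (hπ ⟨y, u, hu⟩)
  have hsurj' := eventually_surjective (hF.continuous_fderiv (by simp)).continuousAt hsurj
  have hg0 := hGm.self_of_nhds
  have hkerF : (nullDirections S f x).comap (Submodule.subtype (fderiv ℝ f x).ker) ≤
      (fderiv ℝ F 0).ker := by
    intro w hw
    have h1 : fderiv ℝ G 0 w = 0 := by
      rw [hg0.fderiv_eq_zero_iff, hid, hi0]; exact hw
    rw [LinearMap.mem_ker, (hF' 0).fderiv]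
    change π (fderiv ℝ G 0 w) = 0
    rw [h1, map_zero]
  -- the fibre of the Gauss map through `x`
  have hfibre : ∀ᶠ u in 𝓝 0, F u = 0 →
      i u - x ∈ nullDirections S f x ∧ G u = G 0 := by
    filter_upwards [hGm, hσG.eventually_nhds, hsurj'] with u hgu hσu hsu hFu
    have hρ : π (G u) = π (G 0) := sub_eq_zero.1 hFu
    have hGu : G u = G 0 := by
      rw [hσu.self_of_nhds, hσG.self_of_nhds, hρ, ← hσG.self_of_nhds]
    have hσ0 : ∀ u, (∀ᶠ y in 𝓝 u, G y = σ (π (G y))) → ∀ c,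
        fderiv ℝ G u c = fderiv ℝ σ (π (G u)) (π (fderiv ℝ G u c)) := by
      intro u hu c
      have h1 := (hσ.differentiable (by simp) (π (G u))).hasFDerivAt.comp u
        (π.hasFDerivAt.comp u (hGd u).hasFDerivAt)
      have h2 := h1.congr_of_eventuallyEq hu
      exact DFunLike.congr_fun ((hGd u).hasFDerivAt.unique h2) c
    -- `dG` factors through `dσ`, and along the fibre `σ` is differentiated at one and the same
    -- point, so `dG u` and `dG 0` have the same range.
    have hrange : ∀ c, ∃ c', fderiv ℝ G u c' = fderiv ℝ G 0 c := by
      intro c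
      obtain ⟨c', hc'⟩ := hsu (π (fderiv ℝ G 0 c))
      rw [(hF' u).fderiv, ContinuousLinearMap.comp_apply] at hc'
      refine ⟨c', ?_⟩
      rw [hσ0 u hσu, hc', hρ, ← hσ0 0 hσG c]
    refine ⟨?_, hGu⟩
    have hgrad : ∀ u, IsGaussMapAt S f (gradient f x) i G u → inner ℝ (G u).1 (i u) = (G u).2 := by
      intro u hu
      rw [hu.apply_eq]
      simp [inner_smul_left]
    have htan : fderiv ℝ f x (i u - x) = 0 := by
      have h1 := hgrad u hgu
      have h2 := hgrad 0 hg0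
      rw [hGu, ← h2, ← sub_eq_zero, ← inner_sub_right, hg0.apply_eq, hi0, Prod.smul_fst,
        real_inner_smul_left, inner_gradient_eq_fderiv f x (i u - x)] at h1
      exact (mul_eq_zero.1 h1).resolve_left (inv_ne_zero hνx)
    rw [hf.mem_nullDirections_iff hx]
    refine ⟨htan, fun c hc => ?_⟩
    obtain ⟨c', hc'⟩ := hrange ⟨c, hc⟩
    -- The vector `dG 0 c` satisfies the incidence relation at both `i u` and `x`, so its first
    -- component is orthogonal to `i u - x`. This product is, up to a nonzero factor, the Hessian on
    -- `c` and `i u - x`; thus `i u - x` is a null direction.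
    have h1 := hgu.incidence c'
    have h2 := hg0.incidence ⟨c, hc⟩
    rw [hc', ← h2, ← sub_eq_zero, ← inner_sub_right, hi0] at h1
    have h3 := hg0.inner_fderiv_eq ⟨c, hc⟩ (i u - x) (by rw [hi0]; exact htan)
    rw [h1, hid, hi0] at h3
    rw [fderiv_fderiv_symm hf.smooth]
    exact (mul_eq_zero.1 h3.symm).resolve_left (inv_ne_zero hνx)
  have hfibre' : ∀ᶠ u in 𝓝 0, F u = 0 →
      u ∈ (nullDirections S f x).comap (Submodule.subtype (fderiv ℝ f x).ker) ∧
        (u : EuclideanSpace ℝ (Fin n)) = i u - x := by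
    filter_upwards [hfibre, hip] with u h1 h2 h3
    obtain ⟨h4, -⟩ := h1 h3
    have h5 : i u - x ∈ (fderiv ℝ f x).ker := ((hf.mem_nullDirections_iff hx).1 h4).1
    have h6 : (u : EuclideanSpace ℝ (Fin n)) = i u - x :=
      congrArg Subtype.val (h2.symm.trans (hp ⟨_, h5⟩))
    refine ⟨?_, h6⟩
    rw [Submodule.mem_comap, Submodule.subtype_apply, h6]
    exact h4
  -- The fibre lies in the null space, and the null space lies in the tangent space of the fibre;
  -- therefore they agree locally.
  have hzero := eventually_eq_zero_of_levelSet_subset hF (by simp [hFdef]) hsurj hkerF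
    (hfibre'.mono fun u h1 h2 => (h1 h2).1)
  have hmain : ∀ᶠ (b : (fderiv ℝ f x).ker) in 𝓝 0,
      (b : EuclideanSpace ℝ (Fin n)) ∈ nullDirections S f x →
      x + (b : EuclideanSpace ℝ (Fin n)) ∈ S ∧
      tangentSpaceAt S (x + (b : EuclideanSpace ℝ (Fin n))) = tangentSpaceAt S x := by
    filter_upwards [hzero, hfibre, hfibre', hGm] with b h1 h3 h4 h5 h6
    have h7 := (h3 (h1 h6)).2
    have h12 : x + (b : EuclideanSpace ℝ (Fin n)) = i b := by
      rw [(h4 (h1 h6)).2]; abel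
    rw [h12]
    refine ⟨h5.mem, ?_⟩
    rw [h5.isLocalEquation.tangentSpaceAt_eq h5.mem, hf.tangentSpaceAt_eq hx]
    have h13 := congrArg Prod.fst h7
    rw [h5.apply_eq, hg0.apply_eq, hi0] at h13
    simp only [Prod.smul_fst] at h13
    ext v
    have h14 := congrArg (fun a => inner ℝ a v) h13
    simp only [real_inner_smul_left, inner_gradient_eq_fderiv f _ v] at h14
    rw [LinearMap.mem_ker, LinearMap.mem_ker]
    change fderiv ℝ f (i b) v = 0 ↔ fderiv ℝ f x v = 0
    constructor
    · intro h16
      rw [h16, mul_zero] at h14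
      exact (mul_eq_zero.1 h14.symm).resolve_left (inv_ne_zero hνx)
    · intro h16
      rw [h16, mul_zero] at h14
      exact (mul_eq_zero.1 h14).resolve_left (inv_ne_zero h5.inner_ne)
  obtain ⟨δ, hδ, hball⟩ := Metric.eventually_nhds_iff.1 hmain
  filter_upwards [Metric.ball_mem_nhds 0 hδ] with w hw hwn
  have hw1 : w ∈ (fderiv ℝ f x).ker := ((hf.mem_nullDirections_iff hx).1 hwn).1
  exact @hball ⟨w, hw1⟩ hw hwn

end

/-! ### The boundary of `D` inside a single hypersurface. -/

section Frontier

variable {n : ℕ} {S : Set (EuclideanSpace ℝ (Fin n))} {x : EuclideanSpace ℝ (Fin n)}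
  {f : EuclideanSpace ℝ (Fin n) → ℝ}

/-- Where the boundary of a regular closed set lies in a hypersurface, it is an open part of it. -/
theorem IsLocalEquation.eventually_mem_frontier {D : Set (EuclideanSpace ℝ (Fin n))}
    (hD : IsClosed D) (hreg : closure (interior D) = D) (hf : IsLocalEquation S x f)
    (hx : x ∈ S) (hxD : x ∈ frontier D) (hDS : ∀ᶠ y in 𝓝 x, y ∈ frontier D → y ∈ S) :
    ∀ᶠ y in 𝓝 x, y ∈ S → y ∈ frontier D := by
  obtain ⟨p, hp⟩ := exists_continuousLinearMap_projection (fderiv ℝ f x).ker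
  obtain ⟨e, he, hxe, hsm⟩ := exists_straightening hf.smooth hf.surjective p hp
  have hex : e x = (0, 0) := by rw [he, hf.apply_eq_zero hx]; simp
  have h0 : ((0 : ℝ), (0 : (fderiv ℝ f x).ker)) ∈ e.target := hex ▸ e.map_source hxe
  have hst : Filter.Tendsto e.symm (𝓝 ((0 : ℝ), (0 : (fderiv ℝ f x).ker))) (𝓝 x) := by
    have h1 := (hsm _ h0).continuousAt.tendsto
    rwa [← hex, e.left_inv hxe, hex] at h1
  have hbox := (e.open_target.eventually_mem h0).and (hst.eventually (hDS.and hf.eventually_mem_iff))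
  obtain ⟨δ, hδ, hball⟩ := Metric.eventually_nhds_iff_ball.1 hbox
  have hb' : ∀ s : ℝ, ∀ b : (fderiv ℝ f x).ker, |s| < δ → ‖b‖ < δ →
      (s, b) ∈ Metric.ball ((0 : ℝ), (0 : (fderiv ℝ f x).ker)) δ := by
    intro s b hs hb
    rw [← ball_prod_same]
    exact ⟨by simpa using hs, by simpa using hb⟩
  have hfs : ∀ z ∈ e.target, f (e.symm z) = z.1 := fun z hz => by
    have := he (e.symm z)
    rw [e.right_inv hz] at this
    exact (congrArg Prod.fst this).symm
  let side : Set ℝ → Set (EuclideanSpace ℝ (Fin n)) := fun I =>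
    e.symm '' (I ×ˢ Metric.ball (0 : (fderiv ℝ f x).ker) δ)
  -- Each side of the hypersurface is connected and misses the boundary of `D`, so it lies entirely
  -- in `D` or entirely outside. If the sides differ, the hypersurface is boundary near `x`; the two
  -- equal cases contradict `x` being a boundary point of a regular closed set.
  have hside : ∀ I : Set ℝ, IsPreconnected I → (∀ s ∈ I, |s| < δ ∧ s ≠ 0) →
      side I ⊆ D ∨ side I ⊆ Dᶜ := by
    intro I hI hIs
    have hpre : IsPreconnected (side I) := by
      refine (hI.prod (convex_ball _ _).isPreconnected).image _ ?_
      rintro ⟨s, b⟩ ⟨hs, hb⟩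
      exact (hsm _ (hball _ (hb' s b (hIs s hs).1
        (by simpa using hb))).1).continuousAt.continuousWithinAt
    have hfr : ¬ (side I ∩ frontier D).Nonempty := by
      rintro ⟨_, ⟨⟨s, b⟩, ⟨hs, hb⟩, rfl⟩, hD⟩
      obtain ⟨h1, h2, h3⟩ := hball _ (hb' s b (hIs s hs).1 (by simpa using hb))
      have h4 := h3.1 (h2 hD)
      rw [hfs _ h1] at h4
      exact (hIs s hs).2 h4
    have hsub : side I ⊆ interior D ∪ Dᶜ := by
      intro y hy
      by_cases hyD : y ∈ D
      · refine Or.inl (by_contra fun hyi => hfr ⟨y, hy, subset_closure hyD, hyi⟩)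
      · exact Or.inr hyD
    rcases hpre.subset_or_subset isOpen_interior hD.isOpen_compl
      (disjoint_compl_right.mono_left interior_subset) hsub with h | h
    · exact Or.inl (h.trans interior_subset)
    · exact Or.inr h
  have hclos : ∀ I : Set ℝ, (0 : ℝ) ∈ closure I → ∀ b : (fderiv ℝ f x).ker, ‖b‖ < δ →
      e.symm (0, b) ∈ closure (side I) := by
    intro I hI b hb
    have h1 : ContinuousAt (fun s : ℝ => e.symm (s, b)) 0 :=
      ContinuousAt.comp (f := fun s : ℝ => (s, b))
        (hsm _ (hball _ (hb' 0 b (by simpa using hδ) hb)).1).continuousAt (by fun_prop)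
    refine closure_mono ?_ (mem_closure_image (f := fun s : ℝ => e.symm (s, b)) h1 hI)
    rintro _ ⟨s, hs, rfl⟩
    exact ⟨(s, b), ⟨hs, by simpa using hb⟩, rfl⟩
  have hpos : (0 : ℝ) ∈ closure (Set.Ioo 0 δ) := by
    rw [closure_Ioo hδ.ne]; exact ⟨le_rfl, hδ.le⟩
  have hneg : (0 : ℝ) ∈ closure (Set.Ioo (-δ) 0) := by
    rw [closure_Ioo (by linarith)]; exact ⟨by linarith, le_rfl⟩
  have hW : ∀ᶠ y in 𝓝 x, ∃ s b, |s| < δ ∧ ‖b‖ < δ ∧ y = e.symm (s, b) ∧ f y = s := by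
    have hc : Filter.Tendsto e (𝓝 x) (𝓝 (0, 0)) := hex ▸ e.continuousAt hxe
    filter_upwards [hc.eventually (Metric.ball_mem_nhds _ hδ), e.open_source.mem_nhds hxe]
      with y h1 h2
    have h1 : e y ∈ Metric.ball ((0 : ℝ), (0 : (fderiv ℝ f x).ker)) δ := h1
    rw [← ball_prod_same] at h1
    refine ⟨(e y).1, (e y).2, by simpa using h1.1, by simpa using h1.2,
      (e.left_inv h2).symm, ?_⟩
    rw [he]
  have hcase : ∀ s : ℝ, |s| < δ → s ≠ 0 → s ∈ Set.Ioo 0 δ ∨ s ∈ Set.Ioo (-δ) 0 := by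
    intro s hs h0
    rcases lt_or_gt_of_ne h0 with h | h
    · exact Or.inr ⟨(abs_lt.1 hs).1, h⟩
    · exact Or.inl ⟨h, (abs_lt.1 hs).2⟩
  have hmix : ∀ I J : Set ℝ, (0 : ℝ) ∈ closure I → (0 : ℝ) ∈ closure J → side I ⊆ D →
      side J ⊆ Dᶜ → ∀ᶠ y in 𝓝 x, y ∈ S → y ∈ frontier D := by
    intro I J hI hJ hID hJD
    filter_upwards [hW, hf.eventually_mem_iff] with y hy hyS hy'
    obtain ⟨s, b, -, hb, rfl, hs⟩ := hy
    rw [hyS.1 hy'] at hs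
    rw [frontier_eq_closure_inter_closure]
    subst hs
    exact ⟨closure_mono hID (hclos I hI b hb), closure_mono hJD (hclos J hJ b hb)⟩
  rcases hside (Set.Ioo 0 δ) isPreconnected_Ioo
      (fun s hs => ⟨abs_lt.2 ⟨by linarith [hs.1], hs.2⟩, hs.1.ne'⟩) with hp1 | hp1 <;>
    rcases hside (Set.Ioo (-δ) 0) isPreconnected_Ioo
      (fun s hs => ⟨abs_lt.2 ⟨hs.1, by linarith [hs.2]⟩, hs.2.ne⟩) with hn1 | hn1
  · -- both sides lie in `D`
    have hxint : x ∈ interior D := by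
      rw [mem_interior_iff_mem_nhds]
      filter_upwards [hW] with y hy
      obtain ⟨s, b, hs, hb, rfl, -⟩ := hy
      by_cases h : s = 0
      · subst h
        exact closure_minimal hp1 hD (hclos _ hpos b hb)
      · rcases hcase s hs h with h | h
        · exact hp1 ⟨(s, b), ⟨h, by simpa using hb⟩, rfl⟩
        · exact hn1 ⟨(s, b), ⟨h, by simpa using hb⟩, rfl⟩
    exact absurd hxint hxD.2
  · exact hmix _ _ hpos hneg hp1 hn1
  · exact hmix _ _ hneg hpos hn1 hp1
  · -- both sides lie outside `D`
    exfalso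
    have hxD' : x ∈ closure (interior D) := by
      rw [hreg]; exact hD.frontier_subset hxD
    obtain ⟨y, hy, hyD⟩ := mem_closure_iff_nhds.1 hxD' _ hW
    obtain ⟨s, b, hs, hb, rfl, -⟩ := hy
    by_cases h : s = 0
    · subst h
      obtain ⟨z, hz, hz'⟩ := mem_closure_iff.1 (hclos _ hpos b hb) _ isOpen_interior hyD
      exact hp1 hz' (interior_subset hz)
    · rcases hcase s hs h with h | h
      · exact hp1 ⟨(s, b), ⟨h, by simpa using hb⟩, rfl⟩ (interior_subset hyD)
      · exact hn1 ⟨(s, b), ⟨h, by simpa using hb⟩, rfl⟩ (interior_subset hyD)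

end Frontier

/-! ### Complete rulings. -/

section Ruling

variable {n : ℕ} {S : Set (EuclideanSpace ℝ (Fin n))} {x : EuclideanSpace ℝ (Fin n)}
  {f : EuclideanSpace ℝ (Fin n) → ℝ}

theorem IsLocalEquation.nullDirections_le (hf : IsLocalEquation S x f) (hx : x ∈ S) :
    nullDirections S f x ≤ (fderiv ℝ f x).ker :=
  fun _ hw => ((hf.mem_nullDirections_iff hx).1 hw).1

/-- A closed hypersurface of constant nullity contains the complete affine spaces of null
directions, and its tangent space is constant along each of them. -/
theorem IsLocalEquation.add_mem_of_mem_nullDirections {k : ℕ} (hc : IsClosed S)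
    (hsm : IsSmoothHypersurface S) (hS : ∀ x ∈ S, ∀ f, IsLocalEquation S x f →
      finrank ℝ (nullDirections S f x) = k) (hf : IsLocalEquation S x f) (hx : x ∈ S)
    {w : EuclideanSpace ℝ (Fin n)} (hw : w ∈ nullDirections S f x) :
    x + w ∈ S ∧ tangentSpaceAt S (x + w) = tangentSpaceAt S x := by
  set K := nullDirections S f x with hK
  set T := tangentSpaceAt S x with hT
  have hKT : K ≤ T := by
    rw [hT, hf.tangentSpaceAt_eq hx]; exact hf.nullDirections_le hx
  let good : Set K := {w | x + (w : EuclideanSpace ℝ (Fin n)) ∈ S ∧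
    tangentSpaceAt S (x + (w : EuclideanSpace ℝ (Fin n))) = T}
  have hlocal : ∀ w₁ : K, ∀ g, IsLocalEquation S (x + (w₁ : EuclideanSpace ℝ (Fin n))) g →
      w₁ ∈ good → K ≤ nullDirections S g (x + (w₁ : EuclideanSpace ℝ (Fin n))) →
      w₁ ∈ interior good := by
    intro w₁ g hg hw₁ hle
    have h1 := hg.eventually_add_mem hS hw₁.1
    have h2 : Filter.Tendsto (fun w : K => (w : EuclideanSpace ℝ (Fin n)) - w₁) (𝓝 w₁) (𝓝 0) := by
      have : Continuous (fun w : K => (w : EuclideanSpace ℝ (Fin n)) - w₁) := by fun_prop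
      simpa using this.tendsto w₁
    rw [mem_interior_iff_mem_nhds]
    filter_upwards [h2.eventually h1] with w hw
    have h3 := hw (hle (K.sub_mem w.2 w₁.2))
    have h4 : x + (w₁ : EuclideanSpace ℝ (Fin n)) + ((w : EuclideanSpace ℝ (Fin n)) - w₁) = x + w := by
      abel
    rw [h4] at h3
    exact ⟨h3.1, h3.2.trans hw₁.2⟩
  -- The local result at a limit point would only follow the null directions of that point, so it
  -- must be shown that `K` consists of null directions there too.
  have hclosed : IsClosed (interior good) := by
    refine isClosed_of_closure_subset fun w₁ hw₁ => ?_
    have hcx : Continuous fun w : K => x + (w : EuclideanSpace ℝ (Fin n)) := by fun_prop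
    have hx₁ : x + (w₁ : EuclideanSpace ℝ (Fin n)) ∈ S := by
      have h1 : IsClosed {w : K | x + (w : EuclideanSpace ℝ (Fin n)) ∈ S} := hc.preimage hcx
      exact closure_minimal (fun w hw => (interior_subset hw).1) h1 hw₁
    obtain ⟨g, hg⟩ := hsm _ hx₁
    have hgev : ∀ᶠ (w : K) in 𝓝 w₁, IsLocalEquation S (x + (w : EuclideanSpace ℝ (Fin n))) g :=
      hcx.continuousAt.eventually hg.eventually
    -- Closed conditions on the first two derivatives of `g`. They hold at points of `interior good`
    -- near `w₁`, where the constancy of the tangent space can be differentiated along `K`, and so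
    -- they pass to `w₁`.
    let Z : Set K := {w | ∀ c ∈ T, fderiv ℝ g (x + (w : EuclideanSpace ℝ (Fin n))) c = 0 ∧
      ∀ w' ∈ K, fderiv ℝ (fderiv ℝ g) (x + (w : EuclideanSpace ℝ (Fin n))) w' c = 0}
    have hg1 : Continuous (fderiv ℝ g) := hg.smooth.continuous_fderiv (by simp)
    have hg2 : Continuous (fderiv ℝ (fderiv ℝ g)) :=
      (hg.smooth.fderiv_right (m := ∞) (by simp)).continuous_fderiv (by simp)
    have hZ : IsClosed Z := by
      have h1 : Z = ⋂ c ∈ T, ({w : K | fderiv ℝ g (x + (w : EuclideanSpace ℝ (Fin n))) c = 0} ∩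
          ⋂ w' ∈ K, {w : K | fderiv ℝ (fderiv ℝ g) (x + (w : EuclideanSpace ℝ (Fin n))) w' c = 0}) := by
        ext w; simp [Z]
      rw [h1]
      refine isClosed_biInter fun c _ => (isClosed_eq (by fun_prop) continuous_const).inter
        (isClosed_biInter fun w' _ => isClosed_eq (by fun_prop) continuous_const)
    have hAZ : w₁ ∈ Z := by
      have h1 : w₁ ∈ closure (interior good ∩
          {w : K | IsLocalEquation S (x + (w : EuclideanSpace ℝ (Fin n))) g}) := by
        rw [mem_closure_iff_nhds] at hw₁ ⊢
        intro t ht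
        obtain ⟨y, ⟨hy1, hy2⟩, hy3⟩ := hw₁ _ (Filter.inter_mem ht hgev)
        exact ⟨y, hy1, hy3, hy2⟩
      refine closure_minimal ?_ hZ h1
      rintro w ⟨hwA, hwg⟩ c hcT
      have hker : ∀ y : K, y ∈ good → IsLocalEquation S (x + (y : EuclideanSpace ℝ (Fin n))) g →
          fderiv ℝ g (x + (y : EuclideanSpace ℝ (Fin n))) c = 0 := by
        intro y hy hyg
        have h2 := hyg.tangentSpaceAt_eq hy.1
        rw [hy.2] at h2
        have h3 := hcT
        rw [h2] at h3
        exact h3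
      refine ⟨hker w (interior_subset hwA) hwg, fun w' hw' => ?_⟩
      have hline : Continuous fun s : ℝ => w + s • (⟨w', hw'⟩ : K) := by fun_prop
      have h0 : w + (0 : ℝ) • (⟨w', hw'⟩ : K) = w := by simp
      have hgood : ∀ᶠ s in 𝓝 (0 : ℝ), fderiv ℝ g (x + (w : EuclideanSpace ℝ (Fin n)) + s • w') c
          = 0 := by
        have h1 : ∀ᶠ (y : K) in 𝓝 w, fderiv ℝ g (x + (y : EuclideanSpace ℝ (Fin n))) c = 0 := by
          filter_upwards [isOpen_interior.mem_nhds hwA,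
            hcx.continuousAt.eventually hwg.eventually] with y hy1 hy2
          exact hker y (interior_subset hy1) hy2
        have h2 : Filter.Tendsto (fun s : ℝ => w + s • (⟨w', hw'⟩ : K)) (𝓝 0) (𝓝 w) := by
          have := hline.tendsto 0
          rwa [h0] at this
        filter_upwards [h2.eventually h1] with s hs
        rw [add_assoc]
        exact hs
      have hd1 : HasDerivAt (fun s : ℝ => x + (w : EuclideanSpace ℝ (Fin n)) + s • w') w' 0 := by
        simpa using ((hasDerivAt_id (0 : ℝ)).smul_const w').const_add
          (x + (w : EuclideanSpace ℝ (Fin n)))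
      have hd2 : HasFDerivAt (fun y => fderiv ℝ g y c)
          ((ContinuousLinearMap.apply ℝ ℝ c).comp
            (fderiv ℝ (fderiv ℝ g) (x + (w : EuclideanSpace ℝ (Fin n)))))
          (x + (w : EuclideanSpace ℝ (Fin n)) + (0 : ℝ) • w') := by
        rw [zero_smul, add_zero]
        exact (ContinuousLinearMap.apply ℝ ℝ c).hasFDerivAt.comp _
          ((hg.smooth.fderiv_right (m := ∞) (by simp)).differentiable (by simp) _).hasFDerivAt
      have hd3 := hd2.comp_hasDerivAt (0 : ℝ) hd1
      have hd4 := hd3.unique ((hasDerivAt_const (0 : ℝ) (0 : ℝ)).congr_of_eventuallyEq hgood)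
      exact hd4
    have hTle : T ≤ (fderiv ℝ g (x + (w₁ : EuclideanSpace ℝ (Fin n)))).ker :=
      fun c hcT => (hAZ c hcT).1
    -- Both spaces have dimension `n - 1`, so the tangent space at the limit is still `T`.
    have hTeq : T = (fderiv ℝ g (x + (w₁ : EuclideanSpace ℝ (Fin n)))).ker := by
      refine Submodule.eq_of_le_of_finrank_eq hTle ?_
      have h1 := hf.finrank_ker
      have h2 := hg.finrank_ker
      rw [hT, hf.tangentSpaceAt_eq hx]
      omega
    refine hlocal w₁ g hg ⟨hx₁, by rw [hg.tangentSpaceAt_eq hx₁, ← hTeq]⟩ fun w' hw' => ?_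
    rw [hg.mem_nullDirections_iff hx₁]
    refine ⟨hTle (hKT hw'), fun c hc' => (hAZ c ?_).2 w' hw'⟩
    rw [hTeq]; exact hc'
  have h0 : (0 : K) ∈ interior good := by
    refine hlocal 0 f (by simpa using hf) ⟨by simpa using hx, by simp [hT]⟩ ?_
    simp [hK]
  have huniv : interior good = Set.univ :=
    IsClopen.eq_univ ⟨hclosed, isOpen_interior⟩ ⟨0, h0⟩
  have : (⟨w, hw⟩ : K) ∈ interior good := by rw [huniv]; trivial
  exact (interior_subset this : (⟨w, hw⟩ : K) ∈ good)

end Ruling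

/-! ### Dual sets, cones and directrices. -/

section Dual

variable {n : ℕ} {S : Set (EuclideanSpace ℝ (Fin n))} {x : EuclideanSpace ℝ (Fin n)}
  {f : EuclideanSpace ℝ (Fin n) → ℝ}

/-- The Gauss map on all of `S` has `n - 1` parameters and a `k`-dimensional kernel, so its image
has dimension `n - 1 - k`. -/
theorem IsLocalEquation.exists_isProjectiveSubmanifold_dualSet {k : ℕ}
    (hS : ∀ x ∈ S, ∀ f, IsLocalEquation S x f → finrank ℝ (nullDirections S f x) = k)
    (hf : IsLocalEquation S x f) (hx : x ∈ S) :
    ∃ U : Set (EuclideanSpace ℝ (Fin n)), IsOpen U ∧ x ∈ U ∧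
      IsProjectiveSubmanifoldOfCodim (k + 1) (dualSet (S ∩ U)) := by
  obtain ⟨p, hp⟩ := exists_continuousLinearMap_projection (fderiv ℝ f x).ker
  obtain ⟨i, hi, hi0, hiS, hip, hpi, -, hnull⟩ := hf.exists_parametrization hx p hp
  have hit : Filter.Tendsto i (𝓝 0) (𝓝 x) := by
    have := hi.continuous.tendsto 0
    rwa [hi0] at this
  obtain ⟨U, hU, hxU, hsub⟩ := exists_isProjectiveSubmanifold_tangentPlanesAlong
    (L := Set.univ) (k := k) (c := k + 1) hf hi hi0 p (by simpa using hiS) hip (by simpa using hpi) (by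
      filter_upwards [hnull, hiS, hit.eventually hf.eventually] with u h1 h2 h3
      rw [h1, hS _ h2 _ h3]) (by
      have := hf.finrank_ker
      omega)
  refine ⟨U, hU, hxU, ?_⟩
  rw [dualSet_inter_of_isOpen hU]
  rwa [Set.univ_inter] at hsub

theorem mem_iff_rep_mem_homogeneousVectors {X : Set (RP n)} {w : RP n} :
    w ∈ X ↔ w.rep ∈ homogeneousVectors X := by
  constructor
  · intro h
    exact ⟨w.rep_nonzero, by rwa [w.mk_rep]⟩
  · rintro ⟨h, hw⟩
    rwa [w.mk_rep] at hw

/-- General position speaks of equations for all surfaces through `x`; the given ones are completed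
to such a family and the independence is then restricted. -/
theorem InGeneralPosition.linearIndependent_gradient {s : ℕ}
    {Γ : Fin s → Set (EuclideanSpace ℝ (Fin n))} (hgp : InGeneralPosition Γ)
    (hsm : ∀ j, IsSmoothHypersurface (Γ j)) {ι : Type*} {J : ι → Fin s}
    (hJ : Function.Injective J) {g : ι → EuclideanSpace ℝ (Fin n) → ℝ}
    (hx : ∀ a, x ∈ Γ (J a)) (hg : ∀ a, IsLocalEquation (Γ (J a)) x (g a)) :
    LinearIndependent ℝ fun a => gradient (g a) x := by
  classical
  have hex : ∀ j, ∃ f, (x ∈ Γ j → IsLocalEquation (Γ j) x f) ∧ ∀ a, J a = j → f = g a := by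
    intro j
    by_cases hj : ∃ a, J a = j
    · obtain ⟨a, rfl⟩ := hj
      exact ⟨g a, fun _ => hg a, fun b hb => by rw [hJ hb]⟩
    · by_cases hxj : x ∈ Γ j
      · obtain ⟨f, hf⟩ := hsm j x hxj
        exact ⟨f, fun _ => hf, fun a ha => absurd ⟨a, ha⟩ hj⟩
      · exact ⟨0, fun h => absurd h hxj, fun a ha => absurd ⟨a, ha⟩ hj⟩
  choose f hf hfg using hex
  have h1 := (hgp x f hf).comp (fun a => ⟨J a, hx a⟩) fun a b hab =>
    hJ (congrArg Subtype.val hab)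
  have h2 : (fun a => gradient (g a) x) =
      (fun j : {j : Fin s // x ∈ Γ j} => gradient (f j) x) ∘ fun a => ⟨J a, hx a⟩ := by
    ext1 a
    simp [hfg _ a rfl]
  rwa [h2]

/-- In general position, planes tangent to two of the surfaces at a common point are distinct. -/
theorem InGeneralPosition.linearIndependent_tangentPlanes {s : ℕ}
    {Γ : Fin s → Set (EuclideanSpace ℝ (Fin n))} (hgp : InGeneralPosition Γ)
    (hsm : ∀ j, IsSmoothHypersurface (Γ j)) {i j : Fin s} (hij : i ≠ j)
    {z z' : EuclideanSpace ℝ (Fin n) × ℝ} (hz : z ∈ homogeneousVectors (tangentPlanesAt (Γ i) x))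
    (hz' : z' ∈ homogeneousVectors (tangentPlanesAt (Γ j) x)) :
    LinearIndependent ℝ ![z.1, z'.1] := by
  have hxi := (mem_homogeneousVectors_tangentPlanesAt.1 hz).1
  have hxj := (mem_homogeneousVectors_tangentPlanesAt.1 hz').1
  obtain ⟨f, hf⟩ := hsm i x hxi
  obtain ⟨g, hg⟩ := hsm j x hxj
  obtain ⟨a, ha, rfl⟩ := (hf.mem_homogeneousVectors_iff hxi).1 hz
  obtain ⟨b, hb, rfl⟩ := (hg.mem_homogeneousVectors_iff hxj).1 hz'
  have h := hgp.linearIndependent_gradient hsm (x := x) (J := ![i, j]) (g := ![f, g]) (by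
    intro p q hpq
    fin_cases p <;> fin_cases q <;> simp_all [eq_comm]) (by
    intro p; fin_cases p <;> assumption) (by
    intro p; fin_cases p <;> assumption)
  have h2 : (fun p => gradient ((![f, g] : Fin 2 → _) p) x) = ![gradient f x, gradient g x] := by
    ext1 p; fin_cases p <;> rfl
  rw [h2, LinearIndependent.pair_iff] at h
  rw [LinearIndependent.pair_iff]
  intro r t hrt
  simp only [Prod.smul_fst, smul_smul] at hrt
  obtain ⟨h3, h4⟩ := h _ _ hrt
  exact ⟨(mul_eq_zero.1 h3).resolve_right ha, (mul_eq_zero.1 h4).resolve_right hb⟩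

theorem mem_rulingSpace_iff {y : EuclideanSpace ℝ (Fin n)} :
    y ∈ rulingSpace S f x ↔ y - x ∈ nullDirections S f x := by
  rw [rulingSpace, AffineSubspace.mem_mk', vsub_eq_sub]

section Ruled

variable {k : ℕ} (hc : IsClosed S) (hsm : IsSmoothHypersurface S)
  (hS : ∀ x ∈ S, ∀ f, IsLocalEquation S x f → finrank ℝ (nullDirections S f x) = k)
  (hf : IsLocalEquation S x f) (hx : x ∈ S)

include hc hsm hS hf hx

theorem IsLocalEquation.rulingSpace_subset : (rulingSpace S f x : Set (EuclideanSpace ℝ (Fin n))) ⊆ S := by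
  intro y hy
  have h := (hf.add_mem_of_mem_nullDirections hc hsm hS hx (mem_rulingSpace_iff.1 hy)).1
  rwa [add_sub_cancel] at h

/-- A hypersurface of constant nullity has the same tangent plane along each of its rulings. -/
theorem IsLocalEquation.homogeneousVectors_tangentPlanesAt_subset {y : EuclideanSpace ℝ (Fin n)}
    (hy : y ∈ rulingSpace S f x) :
    homogeneousVectors (tangentPlanesAt S x) ⊆ homogeneousVectors (tangentPlanesAt S y) := by
  intro z hz
  rw [mem_homogeneousVectors_tangentPlanesAt] at hz ⊢
  obtain ⟨-, h1, h2, h3⟩ := hz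
  have hw := mem_rulingSpace_iff.1 hy
  have h := hf.add_mem_of_mem_nullDirections hc hsm hS hx hw
  rw [add_sub_cancel] at h
  refine ⟨h.1, h1, ?_, by rwa [h.2]⟩
  have h4 := h3 (y - x) (by
    rw [hf.tangentSpaceAt_eq hx]; exact hf.nullDirections_le hx hw)
  rw [inner_sub_right, sub_eq_zero] at h4
  rw [h4, h2]

end Ruled

section Cone

variable {s k : ℕ} {Γ : Fin s → Set (EuclideanSpace ℝ (Fin n))} (hgp : InGeneralPosition Γ)
  (hclosed : ∀ j, IsClosed (Γ j)) (hsm : ∀ j, IsSmoothHypersurface (Γ j)) {i j : Fin s}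
  (hS : ∀ x ∈ Γ i, ∀ f, IsLocalEquation (Γ i) x f → finrank ℝ (nullDirections (Γ i) f x) = k)
  (hf : IsLocalEquation (Γ i) x f) (hx : x ∈ Γ i) (hij : j ≠ i) {v : RP n}
  (hv : v ∈ tangentPlanesAt (Γ i) x)

include hgp hclosed hsm hS hf hx hij hv

/-- The plane `v` is tangent to `Γ i` at every point of the ruling; being tangent to `Γ j` at one of
them would make two independent normals proportional. -/
theorem InGeneralPosition.notMem_tangentPlanesAlong :
    v ∉ tangentPlanesAlong (Γ j) (rulingSpace (Γ i) f x) := by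
  intro hvj
  rw [mem_iff_rep_mem_homogeneousVectors, mem_homogeneousVectors_tangentPlanesAlong] at hvj
  obtain ⟨y, ⟨hyL, hyj⟩, hz'⟩ := hvj
  have hz := hf.homogeneousVectors_tangentPlanesAt_subset (hclosed i) (hsm i) hS hx hyL
    (mem_iff_rep_mem_homogeneousVectors.1 hv)
  have h := hgp.linearIndependent_tangentPlanes hsm hij.symm hz hz'
  rw [LinearIndependent.pair_iff] at h
  have := (h 1 (-1) (by simp)).1
  exact one_ne_zero this

/-- At a common point both planes annihilate the tangent space of the intersection, hence so do
their combinations. Independence of the normals keeps `α` nonzero. -/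
theorem InGeneralPosition.projectiveCone_subset :
    projectiveCone v (tangentPlanesAlong (Γ j) (rulingSpace (Γ i) f x)) ⊆ dualSet (Γ i ∩ Γ j) := by
  rintro w ⟨u, hu, hw⟩
  rw [mem_iff_rep_mem_homogeneousVectors, mem_homogeneousVectors_tangentPlanesAlong] at hu
  obtain ⟨y, ⟨hyL, hyj⟩, hz'⟩ := hu
  have hz := hf.homogeneousVectors_tangentPlanesAt_subset (hclosed i) (hsm i) hS hx hyL
    (mem_iff_rep_mem_homogeneousVectors.1 hv)
  have h := hgp.linearIndependent_tangentPlanes hsm hij.symm hz hz'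
  rw [LinearIndependent.pair_iff] at h
  have hw' : w.rep ∈ v.submodule ⊔ u.submodule := hw (by
    rw [Projectivization.submodule_eq]; exact Submodule.mem_span_singleton_self _)
  rw [Projectivization.submodule_eq, Projectivization.submodule_eq, Submodule.mem_sup] at hw'
  obtain ⟨a', ha', b', hb', hab⟩ := hw'
  obtain ⟨a, rfl⟩ := Submodule.mem_span_singleton.1 ha'
  obtain ⟨b, rfl⟩ := Submodule.mem_span_singleton.1 hb'
  obtain ⟨hyi, -, h2, h3⟩ := mem_homogeneousVectors_tangentPlanesAt.1 hz
  obtain ⟨-, -, h2', h3'⟩ := mem_homogeneousVectors_tangentPlanesAt.1 hz'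
  rw [mem_iff_rep_mem_homogeneousVectors, mem_homogeneousVectors_dualSet]
  refine ⟨y, mem_homogeneousVectors_tangentPlanesAt.2 ⟨⟨hyi, hyj⟩, ?_, ?_, ?_⟩⟩
  · intro h0
    rw [← hab] at h0
    obtain ⟨rfl, rfl⟩ := h a b h0
    exact w.rep_nonzero (by rw [← hab]; simp)
  · rw [← hab]
    simp [inner_add_left, inner_smul_left, h2, h2']
  · intro t ht
    rw [← hab]
    simp [inner_add_left, inner_smul_left, h3 t (tangentSpaceAt_mono Set.inter_subset_left ht),
      h3' t (tangentSpaceAt_mono Set.inter_subset_right ht)]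

end Cone

/-- The section of `T` by the affine space is a hypersurface of `V`, and the Gauss map of `T`
restricted to it is an immersion because no direction of the space is null. Its image has dimension
`dim V - 1`. -/
theorem IsLocalEquation.exists_isProjectiveSubmanifold_of_immersion {V : Type*}
    [NormedAddCommGroup V] [NormedSpace ℝ V] [FiniteDimensional ℝ V]
    {T L : Set (EuclideanSpace ℝ (Fin n))} {g : EuclideanSpace ℝ (Fin n) → ℝ}
    (hg : IsLocalEquation T x g) (hx : x ∈ T) (κ : V →L[ℝ] EuclideanSpace ℝ (Fin n))
    (π : EuclideanSpace ℝ (Fin n) →L[ℝ] V) (hπ : ∀ w, π (κ w) = w)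
    (hmemL : ∀ y, y ∈ L ↔ κ (π (y - x)) = y - x) (hL : ∃ w, fderiv ℝ g x (κ w) ≠ 0)
    (hd : ∀ w, κ w ∈ nullDirections T g x → w = 0) {c : ℕ} (hc : c + finrank ℝ V = n + 1) :
    ∃ U : Set (EuclideanSpace ℝ (Fin n)), IsOpen U ∧ x ∈ U ∧
      IsProjectiveSubmanifoldOfCodim c (tangentPlanesAlong T (L ∩ U)) := by
  let F : V → ℝ := fun w => g (x + κ w)
  have hF : ContDiff ℝ ∞ F := hg.smooth.comp (contDiff_const.add κ.contDiff)
  have hF' : fderiv ℝ F 0 = (fderiv ℝ g x).comp κ := by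
    have h1 : HasFDerivAt (fun w => x + κ w) κ 0 := κ.hasFDerivAt.const_add x
    have h2 : HasFDerivAt g (fderiv ℝ g x) (x + κ 0) := by
      rw [map_zero, add_zero]
      exact (hg.smooth.differentiable (by simp) x).hasFDerivAt
    exact (h2.comp (0 : V) h1).fderiv
  have hsurj : Function.Surjective (fderiv ℝ F 0) := by
    obtain ⟨w, hw⟩ := hL
    refine surjective_of_ne_zero fun h0 => hw ?_
    rw [hF'] at h0
    exact DFunLike.congr_fun h0 w
  obtain ⟨q, hq⟩ := exists_continuousLinearMap_projection (fderiv ℝ F 0).ker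
  obtain ⟨j, hj, hj0, hjF, hqj, hjq, hjd⟩ := exists_levelSet_parametrization hF (x := 0)
    (by simp [F, hg.apply_eq_zero hx]) hsurj q hq
  let i : (fderiv ℝ F 0).ker → EuclideanSpace ℝ (Fin n) := fun u => x + κ (j u)
  have hi : ContDiff ℝ ∞ i := contDiff_const.add (κ.contDiff.comp hj)
  have hi0 : i 0 = x := by simp [i, hj0]
  have hit : Filter.Tendsto i (𝓝 0) (𝓝 x) := by
    have := hi.continuous.tendsto 0
    rwa [hi0] at this
  have hid : ∀ w, fderiv ℝ i 0 w = κ w := by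
    intro w
    have h1 : HasFDerivAt i (κ.comp (fderiv ℝ j 0)) 0 :=
      (κ.hasFDerivAt.comp (0 : (fderiv ℝ F 0).ker)
        (hj.differentiable (by simp) 0).hasFDerivAt).const_add x
    rw [h1.fderiv, ContinuousLinearMap.comp_apply, hjd]
  have hiT : ∀ᶠ u in 𝓝 0, i u ∈ L ∩ T := by
    filter_upwards [hjF, hit.eventually hg.eventually_mem_iff] with u h1 h2
    refine ⟨?_, h2.2 h1⟩
    rw [hmemL]
    simp [i, hπ]
  have hνx : inner ℝ (gradient g x) (gradient g x) ≠ (0 : ℝ) :=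
    fun h => hg.gradient_ne (inner_self_eq_zero.1 h)
  obtain ⟨G, hG, hGm⟩ := exists_isGaussMapAt hg hi hi0 (hiT.mono fun u h => h.2) hνx
  -- The kernel is trivial at the centre, so the rank is maximal there and remains so nearby.
  have hk : ∀ᶠ u in 𝓝 0,
      finrank ℝ ((nullDirections T g (i u)).comap (fderiv ℝ i u).toLinearMap) = 0 := by
    have h0 : (fderiv ℝ G 0).toLinearMap.ker = ⊥ := by
      rw [eq_bot_iff]
      intro w hw
      have h1 := (hGm.self_of_nhds.fderiv_eq_zero_iff w).1 hw
      rw [hid, hi0] at h1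
      exact Subtype.ext (hd _ h1)
    have h1 := LinearMap.finrank_range_add_finrank_ker (fderiv ℝ G 0).toLinearMap
    have h1' : finrank ℝ (fderiv ℝ G 0).toLinearMap.ker = 0 := by
      rw [h0, finrank_bot]
    filter_upwards [hGm, eventually_le_finrank_range
      (hG.continuous_fderiv (by simp)).continuousAt] with u hu h2
    rw [← hu.ker_fderiv]
    have h3 := LinearMap.finrank_range_add_finrank_ker (fderiv ℝ G u).toLinearMap
    change finrank ℝ (fderiv ℝ G u).toLinearMap.ker = 0
    omega
  have hdim : finrank ℝ (fderiv ℝ F 0).ker + 1 = finrank ℝ V := by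
    have h := LinearMap.finrank_range_add_finrank_ker (fderiv ℝ F 0).toLinearMap
    rw [LinearMap.range_eq_top.2 hsurj, finrank_top, finrank_self] at h
    have h' : finrank ℝ (fderiv ℝ F 0).toLinearMap.ker = finrank ℝ (fderiv ℝ F 0).ker := rfl
    omega
  refine exists_isProjectiveSubmanifold_tangentPlanesAlong hg hi hi0 (q.comp π) hiT ?_ ?_ hk (by omega)
  · filter_upwards [hqj] with u hu
    have h1 : i u - x = κ (j u) := by simp [i]
    rw [h1, ContinuousLinearMap.comp_apply, hπ]
    rwa [sub_zero] at hu
  · have ht : Filter.Tendsto (fun y => π (y - x)) (𝓝 x) (𝓝 0) := by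
      have : Continuous (fun y => π (y - x)) := by fun_prop
      simpa using this.tendsto x
    filter_upwards [ht.eventually hjq, hg.eventually_mem_iff] with y h1 h2 h3
    have h4 := (hmemL y).1 h3.1
    have h5 : F (π (y - x)) = 0 := by
      simp only [F]
      rw [h4, add_sub_cancel]
      exact h2.1 h3.2
    have h6 := h1 h5
    rw [sub_zero] at h6
    simp only [i, ContinuousLinearMap.comp_apply]
    rw [h6, h4, add_sub_cancel]

theorem IsLocalEquation.exists_isProjectiveSubmanifold_of_disjoint {T : Set (EuclideanSpace ℝ (Fin n))}
    {g : EuclideanSpace ℝ (Fin n) → ℝ} (hg : IsLocalEquation T x g) (hx : x ∈ T)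
    {L : AffineSubspace ℝ (EuclideanSpace ℝ (Fin n))} (hxL : x ∈ L)
    (hL : ¬ L.direction ≤ tangentSpaceAt T x) (hd : Disjoint L.direction (nullDirections T g x)) :
    ∃ U : Set (EuclideanSpace ℝ (Fin n)), IsOpen U ∧ x ∈ U ∧
      IsProjectiveSubmanifoldOfCodim (n - (finrank ℝ L.direction - 1))
        (tangentPlanesAlong T ((L : Set (EuclideanSpace ℝ (Fin n))) ∩ U)) := by
  obtain ⟨π, hπ⟩ := exists_continuousLinearMap_projection L.direction
  obtain ⟨w, hwL, hwT⟩ := SetLike.not_le_iff_exists.1 hL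
  rw [hg.tangentSpaceAt_eq hx] at hwT
  have hn : finrank ℝ L.direction ≤ n := by simpa using Submodule.finrank_le L.direction
  -- A direction outside the tangent space is nonzero, so both natural number subtractions in the
  -- codimension are genuine.
  have hpos : 0 < finrank ℝ L.direction := by
    refine finrank_pos_iff_exists_ne_zero.2 ⟨⟨w, hwL⟩, fun h0 => hwT ?_⟩
    rw [show w = 0 from congrArg Subtype.val h0]
    exact Submodule.zero_mem _
  refine hg.exists_isProjectiveSubmanifold_of_immersion hx L.direction.subtypeL π hπ (fun y => ?_)
    ⟨⟨w, hwL⟩, hwT⟩ (fun w hw => Subtype.ext (Submodule.disjoint_def.1 hd _ w.2 hw)) (by omega)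
  rw [SetLike.mem_coe, ← AffineSubspace.vsub_right_mem_direction_iff_mem hxL, vsub_eq_sub]
  constructor
  · intro h
    exact congrArg Subtype.val (hπ ⟨y - x, h⟩)
  · intro h
    rw [← h]
    exact (π (y - x)).2

/-- Away from the other surfaces `∂D` is an open part of `Γ i`, so its trace `A` on the ruling is
open as well as closed. It would be the whole ruling, which is unbounded as `k ≥ 1`. -/
theorem IsLocalEquation.exists_mem_rulingSpace_inter {s k : ℕ}
    {Γ : Fin s → Set (EuclideanSpace ℝ (Fin n))} {D : Set (EuclideanSpace ℝ (Fin n))}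
    (hD : IsCompact D) (hDreg : closure (interior D) = D) (hDΓ : frontier D ⊆ ⋃ j, Γ j)
    (hclosed : ∀ j, IsClosed (Γ j)) (hsm : ∀ j, IsSmoothHypersurface (Γ j)) {i : Fin s}
    (hS : ∀ x ∈ Γ i, ∀ f, IsLocalEquation (Γ i) x f → finrank ℝ (nullDirections (Γ i) f x) = k)
    (hk : 1 ≤ k) (hf : IsLocalEquation (Γ i) x f) (hx : x ∈ Γ i) (hxD : x ∈ frontier D) :
    ∃ j, j ≠ i ∧ ∃ y ∈ rulingSpace (Γ i) f x, y ∈ Γ j := by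
  by_contra hcon
  push Not at hcon
  set K := nullDirections (Γ i) f x with hK
  have hcx : Continuous fun w : K => x + (w : EuclideanSpace ℝ (Fin n)) := by fun_prop
  let A : Set K := {w | x + (w : EuclideanSpace ℝ (Fin n)) ∈ frontier D}
  have hL : ∀ w : K, x + (w : EuclideanSpace ℝ (Fin n)) ∈ rulingSpace (Γ i) f x := fun w => by
    rw [mem_rulingSpace_iff, add_sub_cancel_left]; exact w.2
  have hLS : ∀ w : K, x + (w : EuclideanSpace ℝ (Fin n)) ∈ Γ i := fun w =>
    hf.rulingSpace_subset (hclosed i) (hsm i) hS hx (hL w)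
  have hAo : IsOpen A := by
    rw [isOpen_iff_mem_nhds]
    intro w hw
    obtain ⟨g, hg⟩ := hsm i _ (hLS w)
    have h1 : ∀ᶠ y in 𝓝 (x + (w : EuclideanSpace ℝ (Fin n))), ∀ j, j ≠ i → y ∉ Γ j := by
      rw [Filter.eventually_all]
      intro j
      by_cases hj : j = i
      · simp [hj]
      · filter_upwards [(hclosed j).isOpen_compl.mem_nhds (hcon j hj _ (hL w))] with y hy _
        exact hy
    have h2 := hg.eventually_mem_frontier hD.isClosed hDreg (hLS w) hw (by
      filter_upwards [h1] with y hy hyD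
      obtain ⟨j, hj⟩ := Set.mem_iUnion.1 (hDΓ hyD)
      by_cases hji : j = i
      · rwa [← hji]
      · exact absurd hj (hy j hji))
    filter_upwards [hcx.continuousAt.eventually h2] with w' hw'
    exact hw' (hLS w')
  have hAc : IsClosed A := isClosed_frontier.preimage hcx
  have huniv : A = Set.univ := IsClopen.eq_univ ⟨hAc, hAo⟩ ⟨0, by simpa [A] using hxD⟩
  have : Nontrivial K := Module.nontrivial_of_finrank_pos (R := ℝ) (by rw [hS x hx f hf]; omega)
  obtain ⟨R, hR⟩ := hD.isBounded.exists_norm_le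
  obtain ⟨w, hw⟩ := NormedSpace.exists_lt_norm ℝ K (R + ‖x‖)
  have hwA : w ∈ A := by rw [huniv]; trivial
  have h1 := hR _ (hD.isClosed.frontier_subset hwA)
  have h2 : ‖(w : EuclideanSpace ℝ (Fin n))‖ ≤ ‖x + w‖ + ‖x‖ := by
    have := norm_sub_le (x + (w : EuclideanSpace ℝ (Fin n))) x
    rwa [add_sub_cancel_left] at this
  have h3 : ‖w‖ = ‖(w : EuclideanSpace ℝ (Fin n))‖ := rfl
  linarith

theorem IsSmoothHypersurface.tangentPlanesAlong_nonempty {T L : Set (EuclideanSpace ℝ (Fin n))}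
    (hT : IsSmoothHypersurface T) {y : EuclideanSpace ℝ (Fin n)} (hy : y ∈ L ∩ T) :
    (tangentPlanesAlong T L).Nonempty := by
  obtain ⟨g, hg⟩ := hT y hy.2
  have h := mem_homogeneousVectors_tangentPlanesAlong.2 ⟨y, hy,
    (hg.mem_homogeneousVectors_iff hy.2).2 ⟨1, one_ne_zero, rfl⟩⟩
  obtain ⟨h0, h1⟩ := h
  exact ⟨_, h1⟩

end Dual

/-! ### Conormal parametrization of a complete intersection. -/

section Conormal

variable {n : ℕ}

theorem fderiv_pi_apply {ι : Type*} [Fintype ι] {V : Type*} [NormedAddCommGroup V]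
    [NormedSpace ℝ V] {F : ι → V → ℝ} {x : V} (h : ∀ a, DifferentiableAt ℝ (F a) x) (v : V) (a : ι) :
    fderiv ℝ (fun y a => F a y) x v a = fderiv ℝ (F a) x v := by
  rw [fderiv_pi h]
  rfl

/-- The kernel is the orthogonal complement of the span of the gradients, so the rank is the number
of gradients. -/
theorem surjective_fderiv_of_linearIndependent_gradient {ι : Type*} [Fintype ι]
    {F : ι → EuclideanSpace ℝ (Fin n) → ℝ} {x : EuclideanSpace ℝ (Fin n)}
    (hF : ∀ a, DifferentiableAt ℝ (F a) x)
    (hli : LinearIndependent ℝ fun a => gradient (F a) x) :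
    Function.Surjective (fderiv ℝ (fun y a => F a y) x) := by
  set L := fderiv ℝ (fun y a => F a y) x with hL
  have hk : L.toLinearMap.ker = (Submodule.span ℝ (Set.range fun a => gradient (F a) x))ᗮ := by
    ext v
    rw [Submodule.mem_orthogonal, LinearMap.mem_ker]
    constructor
    · intro h w hw
      induction hw using Submodule.span_induction with
      | mem w hw =>
        obtain ⟨a, rfl⟩ := hw
        rw [inner_gradient_eq_fderiv, ← fderiv_pi_apply hF]
        exact congrFun h a
      | zero => simp
      | add a b _ _ ha hb => rw [inner_add_left, ha, hb, add_zero]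
      | smul r a _ ha => rw [inner_smul_left, ha, mul_zero]
    · intro h
      ext a
      have h1 := h _ (Submodule.subset_span ⟨a, rfl⟩)
      rw [inner_gradient_eq_fderiv, ← fderiv_pi_apply hF] at h1
      exact h1
  have h1 := LinearMap.finrank_range_add_finrank_ker L.toLinearMap
  have h2 := Submodule.finrank_add_finrank_orthogonal
    (Submodule.span ℝ (Set.range fun a => gradient (F a) x))
  rw [finrank_span_eq_card hli, ← hk] at h2
  have h3 : finrank ℝ L.toLinearMap.range = finrank ℝ (ι → ℝ) := by
    rw [finrank_fintype_fun_eq_card]; omega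
  exact LinearMap.range_eq_top.1 (Submodule.eq_top_of_finrank_eq h3)

theorem mem_span_gradient_of_orthogonal {ι : Type*} [Fintype ι]
    {F : ι → EuclideanSpace ℝ (Fin n) → ℝ} {x α : EuclideanSpace ℝ (Fin n)}
    (h : ∀ v, (∀ a, fderiv ℝ (F a) x v = 0) → inner ℝ α v = 0) :
    ∃ t : ι → ℝ, ∑ a, t a • gradient (F a) x = α := by
  rw [← Submodule.mem_span_range_iff_exists_fun,
    ← Submodule.orthogonal_orthogonal (Submodule.span ℝ (Set.range fun a => gradient (F a) x)),
    Submodule.mem_orthogonal']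
  intro v hv
  refine h v fun a => ?_
  rw [← inner_gradient_eq_fderiv]
  exact (Submodule.mem_orthogonal _ _).1 hv _ (Submodule.subset_span ⟨a, rfl⟩)

/-- Near a point of a complete intersection, the cone over the planes tangent to it is locally
parametrized by a space of dimension `n`, and the differential of the parametrization takes its
values in the hyperplane dual to the point of tangency. -/
theorem exists_conormal_parametrization {ι : Type*} [Fintype ι]
    {B : Set (EuclideanSpace ℝ (Fin n))} {x : EuclideanSpace ℝ (Fin n)} (hx : x ∈ B)
    {F : ι → EuclideanSpace ℝ (Fin n) → ℝ} (hF : ∀ a, ContDiff ℝ ∞ (F a))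
    (hli : LinearIndependent ℝ fun a => gradient (F a) x)
    (hB : ∀ᶠ y in 𝓝 x, (y ∈ B ↔ ∀ a, F a y = 0)) :
    ∃ Φ : EuclideanSpace ℝ (Fin n) → EuclideanSpace ℝ (Fin n) × ℝ, ContDiff ℝ ∞ Φ ∧
      ∀ᶠ y in 𝓝 x, y ∈ B → ∀ z ∈ homogeneousVectors (tangentPlanesAt B y), ∃ u, Φ u = z ∧
        ∀ c, inner ℝ (fderiv ℝ Φ u c).1 y = (fderiv ℝ Φ u c).2 := by
  have hd : ∀ a y, DifferentiableAt ℝ (F a) y := fun a y => (hF a).differentiable (by simp) y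
  have hFF : ContDiff ℝ ∞ (fun y a => F a y) := contDiff_pi.2 hF
  have hsurj := surjective_fderiv_of_linearIndependent_gradient (fun a => hd a x) hli
  have hB' : ∀ᶠ y in 𝓝 x, (y ∈ B ↔ (fun a => F a y) = 0) := by
    filter_upwards [hB] with y hy
    rw [hy, funext_iff]; rfl
  obtain ⟨p, hp⟩ := exists_continuousLinearMap_projection (fderiv ℝ (fun y a => F a y) x).ker
  obtain ⟨i, hi, hi0, hiF, -, hpi, -⟩ := exists_levelSet_parametrization hFF
    (hB'.self_of_nhds.1 hx) hsurj p hp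
  -- A point of `B` together with the coefficients of a normal at it: `n - m` and `m` parameters,
  -- for `m` equations.
  let Φ : (fderiv ℝ (fun y a => F a y) x).ker × (ι → ℝ) → EuclideanSpace ℝ (Fin n) × ℝ :=
    fun q => (∑ a, q.2 a • gradient (F a) (i q.1),
      inner ℝ (∑ a, q.2 a • gradient (F a) (i q.1)) (i q.1))
  have hiq : ContDiff ℝ ∞ (fun q : (fderiv ℝ (fun y a => F a y) x).ker × (ι → ℝ) => i q.1) :=
    hi.comp contDiff_fst
  have hΦ1 : ContDiff ℝ ∞ (fun q : (fderiv ℝ (fun y a => F a y) x).ker × (ι → ℝ) =>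
      ∑ a, q.2 a • gradient (F a) (i q.1)) := by
    refine ContDiff.sum fun a _ => ?_
    have h1 : ContDiff ℝ ∞ (fun q : (fderiv ℝ (fun y a => F a y) x).ker × (ι → ℝ) => q.2 a) :=
      (contDiff_apply ℝ ℝ a).comp contDiff_snd
    exact h1.smul ((contDiff_gradient (hF a)).comp hiq)
  have hΦ : ContDiff ℝ ∞ Φ := hΦ1.prodMk (hΦ1.inner ℝ hiq)
  have hdim : finrank ℝ ((fderiv ℝ (fun y a => F a y) x).ker × (ι → ℝ)) = n := by
    have h := LinearMap.finrank_range_add_finrank_ker (fderiv ℝ (fun y a => F a y) x).toLinearMap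
    rw [LinearMap.range_eq_top.2 hsurj, finrank_top, finrank_euclideanSpace_fin] at h
    rw [finrank_prod]
    have h' : finrank ℝ (fderiv ℝ (fun y a => F a y) x).toLinearMap.ker =
      finrank ℝ (fderiv ℝ (fun y a => F a y) x).ker := rfl
    omega
  let e : EuclideanSpace ℝ (Fin n) ≃L[ℝ] (fderiv ℝ (fun y a => F a y) x).ker × (ι → ℝ) :=
    ContinuousLinearEquiv.ofFinrankEq (by rw [hdim, finrank_euclideanSpace_fin])
  refine ⟨Φ ∘ e, hΦ.comp e.contDiff, ?_⟩
  have hpt : Filter.Tendsto (fun y => p (y - x)) (𝓝 x) (𝓝 0) := by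
    have : Continuous (fun y => p (y - x)) := by fun_prop
    simpa using this.tendsto x
  filter_upwards [hB'.eventually_nhds, hpi, hpt.eventually hiF.eventually_nhds,
    eventually_surjective (hFF.continuous_fderiv (by simp)).continuousAt hsurj]
    with y hyB hyi hyF hys hy z hz
  have hiy : i (p (y - x)) = y := hyi (hyB.self_of_nhds.1 hy)
  obtain ⟨-, -, hz2, hzT⟩ := mem_homogeneousVectors_tangentPlanesAt.1 hz
  obtain ⟨t, ht⟩ := mem_span_gradient_of_orthogonal (F := F) (x := y) (α := z.1) (by
    intro v hv
    refine hzT v ?_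
    rw [tangentSpaceAt_eq_ker hFF hys hy hyB, LinearMap.mem_ker]
    ext a
    exact (fderiv_pi_apply (fun a => hd a y) v a).trans (hv a))
  have hΦz : Φ (p (y - x), t) = z := by
    simp only [Φ]
    rw [hiy, ht, hz2]
  refine ⟨e.symm (p (y - x), t), by rw [Function.comp_apply, e.apply_symm_apply, hΦz], fun c => ?_⟩
  have hcomp : fderiv ℝ (Φ ∘ e) (e.symm (p (y - x), t)) c = fderiv ℝ Φ (p (y - x), t) (e c) := by
    have h1 : HasFDerivAt Φ (fderiv ℝ Φ (p (y - x), t)) (e (e.symm (p (y - x), t))) := by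
      rw [e.apply_symm_apply]
      exact (hΦ.differentiable (by simp) _).hasFDerivAt
    have h2 := h1.comp _ e.hasFDerivAt
    rw [h2.fderiv]; rfl
  rw [hcomp]
  generalize e c = c'
  have hdΦ := (hΦ.differentiable (by simp) (p (y - x), t)).hasFDerivAt
  have hdi := (hiq.differentiable (by simp) (p (y - x), t)).hasFDerivAt
  have h1 : HasFDerivAt (fun q => (Φ q).2) _ (p (y - x), t) := hdΦ.fst.inner ℝ hdi
  have h2 := DFunLike.congr_fun (hdΦ.snd.unique h1) c'
  -- `z.1` is a combination of gradients and `i` moves inside the level set, so this term of the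
  -- derivative of the incidence relation vanishes.
  have h3 : inner ℝ (Φ (p (y - x), t)).1 (fderiv ℝ (fun q :
      (fderiv ℝ (fun y a => F a y) x).ker × (ι → ℝ) => i q.1) (p (y - x), t) c') = 0 := by
    rw [hΦz, ← ht, sum_inner]
    refine Finset.sum_eq_zero fun a _ => ?_
    rw [inner_smul_left, inner_gradient_eq_fderiv]
    have h4 : HasFDerivAt (F a) (fderiv ℝ (F a) y) (i (p (y - x), t).1) := by
      simp only [hiy]
      exact (hd a y).hasFDerivAt
    have h5 := h4.comp (p (y - x), t) hdi
    have h6 : HasFDerivAt (F a ∘ fun q : (fderiv ℝ (fun y a => F a y) x).ker × (ι → ℝ) => i q.1)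
        (0 : _ →L[ℝ] ℝ) (p (y - x), t) := by
      refine (hasFDerivAt_const (0 : ℝ) _).congr_of_eventuallyEq ?_
      have h7 : Filter.Tendsto (fun q : (fderiv ℝ (fun y a => F a y) x).ker × (ι → ℝ) => q.1)
        (𝓝 (p (y - x), t)) (𝓝 (p (y - x))) := continuous_fst.tendsto _
      filter_upwards [h7.eventually hyF] with q hq
      exact congrFun hq a
    have h8 := DFunLike.congr_fun (h5.unique h6) c'
    rw [ContinuousLinearMap.comp_apply] at h8
    rw [h8]; simp
  simp only [ContinuousLinearMap.comp_apply, ContinuousLinearMap.coe_snd',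
    ContinuousLinearMap.prod_apply, fderivInnerCLM_apply, ContinuousLinearMap.coe_fst', h3,
    zero_add, hiy] at h2
  exact h2.symm

end Conormal

/-! ### Tangent hyperplanes of the dual set are dual to points of `B`. -/

section Reflexivity

variable {n : ℕ}

theorem homogeneousVectors_smul_mem {X : Set (RP n)} {z : EuclideanSpace ℝ (Fin n) × ℝ} {r : ℝ}
    (hr : r ≠ 0) (hz : z ∈ homogeneousVectors X) : r • z ∈ homogeneousVectors X := by
  obtain ⟨h0, h⟩ := hz
  refine ⟨smul_ne_zero hr h0, ?_⟩
  rwa [(Projectivization.mk_eq_mk_iff' ℝ _ _ _ h0).2 ⟨r, rfl⟩]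

theorem exists_smul_eq_of_ker_le {V : Type*} [AddCommGroup V] [Module ℝ V] {φ ψ : V →ₗ[ℝ] ℝ} {q : V}
    (hq : ψ q = 1) (h : ψ.ker ≤ φ.ker) (v : V) : φ v = φ q * ψ v := by
  have h1 : v - ψ v • q ∈ φ.ker := h (by rw [LinearMap.mem_ker]; simp [hq])
  rw [LinearMap.mem_ker, map_sub, map_smul, sub_eq_zero] at h1
  rw [h1, smul_eq_mul, mul_comm]

/-- By the intermediate value theorem the lines in a transversal direction through points near `z`
all meet the zero set near `z`. A set of full measure in the ambient space therefore singles out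
points of the zero set, itself a null set. -/
theorem eventually_exists_add_smul_eq_zero {V : Type*} [NormedAddCommGroup V] [NormedSpace ℝ V]
    {g : V → ℝ} (hg : ContDiff ℝ ∞ g) {z e : V} (hz : g z = 0) (he : 0 < fderiv ℝ g z e)
    {O : Set V} (hO : O ∈ 𝓝 z) : ∀ᶠ v in 𝓝 z, ∃ s : ℝ, g (v + s • e) = 0 ∧ v + s • e ∈ O := by
  have hgc := hg.continuous
  have hd : HasDerivAt (fun s : ℝ => g (z + s • e)) (fderiv ℝ g z e) 0 := by
    have h1 : HasDerivAt (fun s : ℝ => z + s • e) e 0 := by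
      simpa using ((hasDerivAt_id (0 : ℝ)).smul_const e).const_add z
    have h2 : HasFDerivAt g (fderiv ℝ g z) (z + (0 : ℝ) • e) := by
      rw [zero_smul, add_zero]
      exact (hg.differentiable (by simp) z).hasFDerivAt
    exact h2.comp_hasDerivAt (0 : ℝ) h1
  have hpos : ∀ᶠ s in 𝓝[>] (0 : ℝ), 0 < g (z + s • e) ∧ g (z + (-s) • e) < 0 := by
    have h1 := (hasDerivAt_iff_tendsto_slope.1 hd).eventually (lt_mem_nhds he)
    rw [eventually_nhdsWithin_iff] at h1
    have hn : Filter.Tendsto (fun s : ℝ => -s) (𝓝 0) (𝓝 0) := by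
      simpa using (continuous_neg.tendsto (0 : ℝ))
    have h2 := hn.eventually h1
    rw [eventually_nhdsWithin_iff]
    filter_upwards [h1, h2] with s hs1 hs2 hs
    have hs : 0 < s := hs
    have h3 := hs1 (ne_of_gt hs)
    have h4 := hs2 (by simp [hs.ne'])
    simp only [slope_def_field, zero_smul, add_zero, hz, sub_zero] at h3 h4
    refine ⟨(div_pos_iff_of_pos_right hs).1 h3, ?_⟩
    by_contra hcon
    push Not at hcon
    exact absurd h4 (not_lt.2 (div_nonpos_of_nonneg_of_nonpos hcon (by linarith)))
  have hcont : ContinuousAt (fun q : V × ℝ => q.1 + q.2 • e) (z, 0) := by fun_prop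
  have hO' : O ∈ 𝓝 ((fun q : V × ℝ => q.1 + q.2 • e) (z, 0)) := by simpa using hO
  have h5 := hcont.preimage_mem_nhds hO'
  rw [nhds_prod_eq] at h5
  obtain ⟨N, hN, M, hM, hNM⟩ := Filter.mem_prod_iff.1 h5
  obtain ⟨δ, hδ, hδM⟩ := Metric.mem_nhds_iff.1 hM
  obtain ⟨s₀, hs₀, hs₀δ⟩ := (hpos.and (Ioo_mem_nhdsGT hδ)).exists
  have hc1 : Continuous fun v => g (v + s₀ • e) := by fun_prop
  have hc2 : Continuous fun v => g (v + (-s₀) • e) := by fun_prop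
  filter_upwards [hN, hc1.continuousAt.eventually (lt_mem_nhds hs₀.1),
    hc2.continuousAt.eventually (gt_mem_nhds hs₀.2)] with v hv h6 h7
  have hc3 : Continuous fun s : ℝ => g (v + s • e) := by fun_prop
  obtain ⟨s, hs, hgs⟩ := intermediate_value_Icc (a := -s₀) (b := s₀) (by linarith [hs₀δ.1])
    hc3.continuousOn ⟨h7.le, h6.le⟩
  refine ⟨s, hgs, hNM (show (v, s) ∈ N ×ˢ M from ⟨hv, hδM ?_⟩)⟩
  rw [Metric.mem_ball, dist_zero_right, Real.norm_eq_abs]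
  exact (abs_le.2 hs).trans_lt hs₀δ.2

/-- The tangent hyperplanes of a hypersurface that consists of planes tangent to `B` are, on a
dense part of it, dual to points of `B`. -/
theorem exists_tangentHyperplane_dual_mem
    {B : Set (EuclideanSpace ℝ (Fin n))}
    (hB : ∀ x ∈ B, ∃ Φ : EuclideanSpace ℝ (Fin n) → EuclideanSpace ℝ (Fin n) × ℝ,
      ContDiff ℝ ∞ Φ ∧ ∀ᶠ y in 𝓝 x, y ∈ B → ∀ z ∈ homogeneousVectors (tangentPlanesAt B y),
        ∃ u, Φ u = z ∧ ∀ c, inner ℝ (fderiv ℝ Φ u c).1 y = (fderiv ℝ Φ u c).2)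
    (A : (EuclideanSpace ℝ (Fin n) × ℝ) ≃L[ℝ] (EuclideanSpace ℝ (Fin n) × ℝ))
    {S : Set (EuclideanSpace ℝ (Fin n))}
    (hS : ∀ y ∈ S, A (y, 1) ∈ homogeneousVectors (dualSet B))
    {f : EuclideanSpace ℝ (Fin n) → ℝ} {y₀ : EuclideanSpace ℝ (Fin n)} (hy₀ : y₀ ∈ S)
    (hf : IsLocalEquation S y₀ f) {O : Set (EuclideanSpace ℝ (Fin n))} (hO : O ∈ 𝓝 y₀) :
    ∃ y ∈ S ∩ O, ∃ x ∈ B, ∃ c : ℝ, c ≠ 0 ∧ ∀ w r,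
      fderiv ℝ f y (w - r • y) = c * (inner ℝ (A (w, r)).1 x - (A (w, r)).2) := by
  classical
  -- the local equation of the cone over `S`
  let g₀ : EuclideanSpace ℝ (Fin n) × ℝ → ℝ := fun z => f (z.2⁻¹ • z.1)
  let z₀ : EuclideanSpace ℝ (Fin n) × ℝ := (y₀, 1)
  have hz2 : ∀ᶠ z in 𝓝 z₀, z.2 ≠ 0 :=
    continuous_snd.continuousAt.eventually_ne (by simp [z₀])
  have hdeh : ∀ z : EuclideanSpace ℝ (Fin n) × ℝ, z.2 ≠ 0 →
      ContDiffAt ℝ ∞ (fun z : EuclideanSpace ℝ (Fin n) × ℝ => z.2⁻¹ • z.1) z := fun z hz =>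
    (contDiffAt_snd.inv hz).smul contDiffAt_fst
  obtain ⟨g, hg, hgg₀⟩ := exists_contDiff_eventuallyEq (f := g₀) (x := z₀) (by
    filter_upwards [hz2] with z hz
    exact hf.smooth.contDiffAt.comp z (hdeh z hz))
  have hder : ∀ z, z.2 ≠ 0 → g =ᶠ[𝓝 z] g₀ → ∀ w r,
      fderiv ℝ g z (w, r) = z.2⁻¹ * fderiv ℝ f (z.2⁻¹ • z.1) (w - r • z.2⁻¹ • z.1) := by
    intro z hz hgz w r
    have h1 : HasFDerivAt (fun z : EuclideanSpace ℝ (Fin n) × ℝ => z.2⁻¹ • z.1) _ z :=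
      ((hasDerivAt_inv hz).comp_hasFDerivAt z (hasFDerivAt_snd (𝕜 := ℝ) (p := z))).smul
        (hasFDerivAt_fst (𝕜 := ℝ) (p := z))
    have h2 := (hf.smooth.differentiable (by simp) (z.2⁻¹ • z.1)).hasFDerivAt.comp z h1
    rw [hgz.fderiv_eq]
    have h3 : fderiv ℝ g₀ z = _ := h2.fderiv
    rw [h3, ContinuousLinearMap.comp_apply, ← smul_eq_mul, ← map_smul]
    congr 1
    simp only [Function.comp_apply, add_apply, FunLike.coe_smul, Pi.smul_apply,
      ContinuousLinearMap.coe_fst', ContinuousLinearMap.smulRight_apply,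
      ContinuousLinearMap.coe_snd', smul_eq_mul]
    rw [smul_sub, smul_smul, smul_smul, sub_eq_add_neg, ← neg_smul]
    congr 2
    field_simp
  have hdt : Filter.Tendsto (fun z : EuclideanSpace ℝ (Fin n) × ℝ => z.2⁻¹ • z.1) (𝓝 z₀) (𝓝 y₀) := by
    have := (hdeh z₀ (by simp [z₀])).continuousAt.tendsto
    simpa [z₀] using this
  have hgood : ∀ᶠ z in 𝓝 z₀, z.2 ≠ 0 ∧ g =ᶠ[𝓝 z] g₀ ∧ z.2⁻¹ • z.1 ∈ O ∧
      IsLocalEquation S (z.2⁻¹ • z.1) f :=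
    hz2.and (hgg₀.eventuallyEq_nhds.and (hdt.eventually
      ((show ∀ᶠ y in 𝓝 y₀, y ∈ O from hO).and hf.eventually)))
  -- The normal of `S` is a direction transversal to the cone over `S`.
  let e : EuclideanSpace ℝ (Fin n) × ℝ := (gradient f y₀, 0)
  have hgz₀ : g z₀ = 0 := by
    rw [hgg₀.self_of_nhds]
    simp [g₀, z₀, hf.apply_eq_zero hy₀]
  have he : 0 < fderiv ℝ g z₀ e := by
    rw [hder z₀ (by simp [z₀]) hgg₀]
    simp only [z₀, inv_one, one_smul, zero_smul, sub_zero, one_mul, ← inner_gradient_eq_fderiv]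
    exact real_inner_self_pos.2 hf.gradient_ne
  have hfill := eventually_exists_add_smul_eq_zero hg hgz₀ he hgood
  -- cover `B` by countably many parametrized pieces
  choose! Φ hΦ hΦB using hB
  obtain ⟨t, htB, htc, htcov⟩ := TopologicalSpace.countable_cover_nhdsWithin
    (s := B) (f := fun x => {y | y ∈ B → ∀ z ∈ homogeneousVectors (tangentPlanesAt B y),
        ∃ u, Φ x u = z ∧ ∀ c, inner ℝ (fderiv ℝ (Φ x) u c).1 y = (fderiv ℝ (Φ x) u c).2})
    fun x hx => mem_nhdsWithin_of_mem_nhds (hΦB x hx)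
  -- Countability of `t` keeps the union of the exceptional sets null.
  have hae : ∀ᵐ v ∂((MeasureTheory.volume : MeasureTheory.Measure (EuclideanSpace ℝ (Fin n))).prod
      (MeasureTheory.volume : MeasureTheory.Measure ℝ)),
      ∀ x ∈ t, ∀ (u : EuclideanSpace ℝ (Fin n)) (s : ℝ), v = A.symm (Φ x u) + s • e →
        g (A.symm (Φ x u)) = 0 →
        (∀ c, fderiv ℝ g (A.symm (Φ x u)) (fderiv ℝ (A.symm ∘ Φ x) u c) = 0) ∧
        finrank ℝ (fderiv ℝ (A.symm ∘ Φ x) u).range = finrank ℝ (EuclideanSpace ℝ (Fin n)) := by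
    rw [MeasureTheory.ae_ball_iff htc]
    intro x hx
    exact ae_immersion_tangent_levelSet _ (by simp) (A.symm.contDiff.comp (hΦ x (htB hx))) e hg
  obtain ⟨v, hv, s, hgv, hvO⟩ :=
    (MeasureTheory.Measure.dense_of_ae hae).inter_nhds_nonempty hfill
  set z := v + s • e with hzdef
  obtain ⟨hz2, hgz, hzO, hzf⟩ := hvO
  have hyS : z.2⁻¹ • z.1 ∈ S := by
    rw [hzf.eventually_mem_iff.self_of_nhds]
    have h1 := hgz.self_of_nhds
    rw [hgv] at h1
    exact h1.symm
  have hAz : A z ∈ homogeneousVectors (dualSet B) := by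
    have h1 : z = z.2 • ((z.2⁻¹ • z.1, 1) : EuclideanSpace ℝ (Fin n) × ℝ) := by
      ext1
      · simp [smul_smul, hz2]
      · simp
    rw [h1, map_smul]
    exact homogeneousVectors_smul_mem hz2 (hS _ hyS)
  obtain ⟨x, hx⟩ := mem_homogeneousVectors_dualSet.1 hAz
  have hxB := (mem_homogeneousVectors_tangentPlanesAt.1 hx).1
  obtain ⟨x₀, hx₀, hxx₀⟩ := Set.mem_iUnion₂.1 (htcov hxB)
  obtain ⟨u, hu, hinc⟩ := hxx₀ hxB _ hx
  have hzu : A.symm (Φ x₀ u) = z := by rw [hu, A.symm_apply_apply]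
  obtain ⟨h1, h2⟩ := hv x₀ hx₀ u (-s) (by rw [hzu, hzdef, neg_smul]; abel) (by rw [hzu]; exact hgv)
  rw [hzu] at h1
  -- the functional dual to `x`
  let ψ₀ : EuclideanSpace ℝ (Fin n) × ℝ →L[ℝ] ℝ :=
    (innerSL ℝ x).comp (ContinuousLinearMap.fst ℝ _ ℝ) - ContinuousLinearMap.snd ℝ _ ℝ
  let ψ : EuclideanSpace ℝ (Fin n) × ℝ →L[ℝ] ℝ := ψ₀.comp (A : _ →L[ℝ] _)
  have hψ : ∀ q, ψ q = inner ℝ (A q).1 x - (A q).2 := fun q => by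
    simp [ψ, ψ₀, real_inner_comm]
  have hψq : ψ (A.symm (0, -1)) = 1 := by rw [hψ]; simp
  have hAΦ : ∀ c, fderiv ℝ (A.symm ∘ Φ x₀) u c = A.symm (fderiv ℝ (Φ x₀) u c) := by
    intro c
    have h3 := A.symm.hasFDerivAt.comp u
      ((hΦ x₀ (htB hx₀)).differentiable (by simp) u).hasFDerivAt
    rw [h3.fderiv]; rfl
  -- The range lies in the hyperplane dual to `x` and, `Φ x₀` being an immersion at `u`, has its
  -- full dimension `n`. As the range is tangent to the cone, the differential of `g` is a multiple
  -- of `ψ`.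
  have hrange : (fderiv ℝ (A.symm ∘ Φ x₀) u).range = ψ.toLinearMap.ker := by
    refine Submodule.eq_of_le_of_finrank_eq ?_ ?_
    · rintro _ ⟨c, rfl⟩
      change ψ (fderiv ℝ (A.symm ∘ Φ x₀) u c) = 0
      rw [hψ, hAΦ, A.apply_symm_apply, hinc c, sub_self]
    · have h3 := LinearMap.finrank_range_add_finrank_ker ψ.toLinearMap
      have h4 : Function.Surjective ψ.toLinearMap := surjective_of_ne_zero fun h0 => by
        rw [h0] at hψq; simp at hψq
      rw [LinearMap.range_eq_top.2 h4, finrank_top, finrank_self, finrank_prod, finrank_self] at h3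
      rw [h2]; omega
  have hker : ψ.toLinearMap.ker ≤ (fderiv ℝ g z).toLinearMap.ker := by
    rw [← hrange]
    rintro _ ⟨c, rfl⟩
    exact h1 c
  have hprop := exists_smul_eq_of_ker_le hψq hker
  have hfinal : ∀ w r, fderiv ℝ f (z.2⁻¹ • z.1) (w - r • z.2⁻¹ • z.1) =
      (z.2 * fderiv ℝ g z (A.symm (0, -1))) * (inner ℝ (A (w, r)).1 x - (A (w, r)).2) := by
    intro w r
    have h3 := hprop (w, r)
    change fderiv ℝ g z (w, r) = fderiv ℝ g z (A.symm (0, -1)) * ψ (w, r) at h3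
    rw [hder z hz2 hgz, hψ] at h3
    rw [mul_assoc, ← h3, ← mul_assoc, mul_inv_cancel₀ hz2, one_mul]
  refine ⟨_, ⟨hyS, hzO⟩, x, hxB, _, fun h0 => hzf.gradient_ne ?_, hfinal⟩
  have h3 := hfinal (gradient f (z.2⁻¹ • z.1)) 0
  rw [h0, zero_mul, zero_smul, sub_zero, ← inner_gradient_eq_fderiv] at h3
  exact inner_self_eq_zero.1 h3

end Reflexivity

/-! ### Vanishing curvatures of hypersurfaces in the dual set. -/

section DualCurvature

variable {n : ℕ}

/-- The components `ℝⁿ → ℝⁿ` and `ℝⁿ → ℝ` of the restriction of `L` to the first factor, the first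
one transposed and the second one represented by a vector. -/
theorem exists_adjoint_components {E : Type*} [NormedAddCommGroup E] [InnerProductSpace ℝ E]
    [CompleteSpace E] (L : (E × ℝ) →L[ℝ] (E × ℝ)) :
    ∃ (P : E →L[ℝ] E) (q : E), (∀ v a, inner ℝ (P v) a = inner ℝ v (L (a, 0)).1) ∧
      ∀ a, inner ℝ q a = (L (a, 0)).2 := by
  obtain ⟨M, hM⟩ : ∃ M : E →L[ℝ] E × ℝ, ∀ a, M a = L (a, 0) :=
    ⟨L.comp (ContinuousLinearMap.inl ℝ E ℝ), fun _ => rfl⟩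
  refine ⟨ContinuousLinearMap.adjoint ((ContinuousLinearMap.fst ℝ E ℝ).comp M),
    (InnerProductSpace.toDual ℝ E).symm ((ContinuousLinearMap.snd ℝ E ℝ).comp M),
    fun v a => ?_, fun a => ?_⟩
  · rw [ContinuousLinearMap.adjoint_inner_left, ← hM]; rfl
  · rw [InnerProductSpace.toDual_symm_apply, ← hM]; rfl

/-- The homogeneous coordinates `(ξ, τ)` of the tangent hyperplanes of the level sets of `f`, drawn
in an affine chart of the projective space. -/
theorem exists_tangentHyperplane_coordinates {f : EuclideanSpace ℝ (Fin n) → ℝ}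
    (hf : ContDiff ℝ ∞ f)
    (A : (EuclideanSpace ℝ (Fin n) × ℝ) ≃L[ℝ] (EuclideanSpace ℝ (Fin n) × ℝ)) :
    ∃ (ξ : EuclideanSpace ℝ (Fin n) → EuclideanSpace ℝ (Fin n))
      (τ : EuclideanSpace ℝ (Fin n) → ℝ), ContDiff ℝ ∞ ξ ∧ ContDiff ℝ ∞ τ ∧
      ∀ y a b, fderiv ℝ f y ((A.symm (a, b)).1 - (A.symm (a, b)).2 • y) =
        inner ℝ (ξ y) a - b * τ y := by
  have hgrad := contDiff_gradient hf
  obtain ⟨L, hL⟩ : ∃ L : (EuclideanSpace ℝ (Fin n) × ℝ) →L[ℝ] (EuclideanSpace ℝ (Fin n) × ℝ),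
    ∀ z, A.symm z = L z := ⟨A.symm.toContinuousLinearMap, fun _ => rfl⟩
  simp only [hL]
  obtain ⟨P, q, hP, hq⟩ := exists_adjoint_components L
  obtain ⟨⟨p₀, r₀⟩, h0⟩ : ∃ z, z = L (0, 1) := ⟨_, rfl⟩
  have hL' : ∀ a b, L (a, b) = L (a, 0) + b • (p₀, r₀) := fun a b => by
    rw [h0, ← map_smul, ← map_add]; simp
  refine ⟨fun y => P (gradient f y) - (inner ℝ (gradient f y) y : ℝ) • q,
    fun y => -(inner ℝ (gradient f y) (p₀ - r₀ • y)), ?_, ?_, fun y a b => ?_⟩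
  · exact (P.contDiff.comp hgrad).sub ((hgrad.inner ℝ contDiff_id).smul contDiff_const)
  · exact (hgrad.inner ℝ (contDiff_const.sub (contDiff_id.const_smul r₀))).neg
  · rw [hL', ← inner_gradient_eq_fderiv, inner_sub_left, hP, real_inner_smul_left, hq]
    generalize L (a, 0) = z
    simp only [Prod.fst_add, Prod.snd_add, Prod.smul_fst, Prod.smul_snd, inner_sub_right,
      inner_add_right, inner_smul_right, add_smul, smul_eq_mul, mul_smul]
    ring

/-- The dual point `X` maps `S` near `y₁` into a set of dimension `n - m`, where `m` is the number
of equations, and the kernel of its differential on the tangent space is null for `S`. -/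
theorem le_finrank_nullDirections_of_tangentHyperplane_dual_mem {ι : Type*} [Fintype ι]
    {B : Set (EuclideanSpace ℝ (Fin n))} (hBc : IsClosed B)
    (A : (EuclideanSpace ℝ (Fin n) × ℝ) ≃L[ℝ] (EuclideanSpace ℝ (Fin n) × ℝ))
    {S : Set (EuclideanSpace ℝ (Fin n))} {f : EuclideanSpace ℝ (Fin n) → ℝ}
    (hdense : ∀ y ∈ S, IsLocalEquation S y f → ∀ O ∈ 𝓝 y, ∃ y' ∈ S ∩ O, ∃ x ∈ B, ∃ c : ℝ, c ≠ 0 ∧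
      ∀ w r, fderiv ℝ f y' (w - r • y') = c * (inner ℝ (A (w, r)).1 x - (A (w, r)).2))
    {y₁ : EuclideanSpace ℝ (Fin n)} (hy₁ : y₁ ∈ S) (hf : IsLocalEquation S y₁ f)
    {x : EuclideanSpace ℝ (Fin n)} {c : ℝ} (hc : c ≠ 0)
    (hrel : ∀ w r, fderiv ℝ f y₁ (w - r • y₁) = c * (inner ℝ (A (w, r)).1 x - (A (w, r)).2))
    {F : ι → EuclideanSpace ℝ (Fin n) → ℝ} (hF : ∀ a, ContDiff ℝ ∞ (F a))
    (hli : LinearIndependent ℝ fun a => gradient (F a) x)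
    (hBF : ∀ᶠ y in 𝓝 x, y ∈ B → ∀ a, F a y = 0) :
    Fintype.card ι - 1 ≤ finrank ℝ (nullDirections S f y₁) := by
  obtain ⟨ξ, τ, hξ, hτ, hkey⟩ := exists_tangentHyperplane_coordinates hf.smooth A
  have hrelξ : ∀ y x' c', (∀ w r, fderiv ℝ f y (w - r • y) =
      c' * (inner ℝ (A (w, r)).1 x' - (A (w, r)).2)) → τ y = c' ∧ ξ y = c' • x' := by
    intro y x' c' h
    have h1 : ∀ a b, inner ℝ (ξ y) a - b * τ y = c' * (inner ℝ a x' - b) := by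
      intro a b
      rw [← hkey, h, Prod.mk.eta, A.apply_symm_apply]
    constructor
    · have := h1 0 1
      simp only [inner_zero_right, inner_zero_left] at this
      linarith
    · refine ext_inner_right ℝ fun a => ?_
      have := h1 a 0
      rw [real_inner_smul_left, real_inner_comm a x']
      linarith
  obtain ⟨hτ₁, hξ₁⟩ := hrelξ _ _ _ hrel
  have hτne : ∀ᶠ y in 𝓝 y₁, τ y ≠ 0 :=
    hτ.continuous.continuousAt.eventually_ne (by rw [hτ₁]; exact hc)
  -- The affine point dual to the tangent hyperplane with coordinates `(ξ, τ)`; it exists only where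
  -- `τ ≠ 0`.
  let X₀ : EuclideanSpace ℝ (Fin n) → EuclideanSpace ℝ (Fin n) := fun y => (τ y)⁻¹ • ξ y
  have hX₀ : ∀ y, τ y ≠ 0 → ContDiffAt ℝ ∞ X₀ y := fun y hy =>
    (hτ.contDiffAt.inv hy).smul hξ.contDiffAt
  have hX₀rel : ∀ y x' c', c' ≠ 0 → (∀ w r, fderiv ℝ f y (w - r • y) =
      c' * (inner ℝ (A (w, r)).1 x' - (A (w, r)).2)) → X₀ y = x' := by
    intro y x' c' hc' h
    obtain ⟨h1, h2⟩ := hrelξ y x' c' h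
    simp only [X₀]
    rw [h1, h2, smul_smul, inv_mul_cancel₀ hc', one_smul]
  have hXB : ∀ᶠ y in 𝓝 y₁, y ∈ S → X₀ y ∈ B := by
    filter_upwards [hτne, hf.eventually] with y hy hyf hyS
    rw [← hBc.closure_eq, mem_closure_iff_nhds]
    intro N hN
    obtain ⟨y', ⟨-, hy'⟩, x', hx', c', hc', hrel'⟩ := hdense y hyS hyf _
      ((hX₀ y hy).continuousAt.preimage_mem_nhds hN)
    have h1 := hX₀rel y' x' c' hc' hrel'
    exact ⟨X₀ y', hy', h1 ▸ hx'⟩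
  obtain ⟨X, hX, hXe⟩ := exists_contDiff_eventuallyEq (f := X₀) (x := y₁) (hτne.mono hX₀)
  have hX₁ : X y₁ = x := by rw [hXe.self_of_nhds]; exact hX₀rel _ _ _ hc hrel
  have hXt : Filter.Tendsto X (𝓝 y₁) (𝓝 x) := by
    have := hX.continuous.tendsto y₁
    rwa [hX₁] at this
  have hXd := (hX.differentiable (by simp) y₁).hasFDerivAt
  -- the dual point moves along `B`
  have htan : ∀ w ∈ tangentSpaceAt S y₁, ∀ a, fderiv ℝ (F a) x (fderiv ℝ X y₁ w) = 0 := by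
    intro w hw a
    simp only [tangentSpaceAt, Submodule.mem_iInf] at hw
    have h1 := hw (F a ∘ X) ⟨(hF a).comp hX, by
      filter_upwards [hXB.filter_mono nhdsWithin_le_nhds, hXe.filter_mono nhdsWithin_le_nhds,
        (hXt.eventually hBF).filter_mono nhdsWithin_le_nhds, self_mem_nhdsWithin]
        with y h1 h2 h3 h4
      exact h3 (h2 ▸ h1 h4) a⟩
    have h2 : HasFDerivAt (F a) (fderiv ℝ (F a) x) (X y₁) := by
      rw [hX₁]; exact ((hF a).differentiable (by simp) x).hasFDerivAt
    have h3 := h2.comp y₁ hXd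
    rw [h3.fderiv] at h1
    exact h1
  set T := tangentSpaceAt S y₁ with hT
  have hTf : ∀ w, w ∈ T ↔ fderiv ℝ f y₁ w = 0 := fun w => by
    rw [hT, hf.tangentSpaceAt_eq hy₁]; rfl
  have hsurj := surjective_fderiv_of_linearIndependent_gradient
    (fun a => (hF a).differentiable (by simp) x) hli
  let M : T →ₗ[ℝ] EuclideanSpace ℝ (Fin n) := (fderiv ℝ X y₁).toLinearMap.domRestrict T
  have hMrange : M.range ≤ (fderiv ℝ (fun y a => F a y) x).toLinearMap.ker := by
    rintro _ ⟨w, rfl⟩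
    rw [LinearMap.mem_ker]
    ext a
    exact (fderiv_pi_apply (fun a => (hF a).differentiable (by simp) x) _ a).trans
      (htan w w.2 a)
  have hMker : M.ker.map T.subtype ≤ nullDirections S f y₁ := by
    rintro _ ⟨w, hw, rfl⟩
    have hXw : fderiv ℝ X y₁ w = 0 := hw
    rw [hf.mem_nullDirections_iff hy₁]
    refine ⟨(hTf _).1 w.2, fun w' hw' => ?_⟩
    obtain ⟨⟨a, b⟩, hab⟩ : ∃ q, q = A (w', 0) := ⟨_, rfl⟩
    have hsymm : A.symm (a, b) = (w', 0) := by rw [hab, A.symm_apply_apply]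
    have h1 : ∀ y, fderiv ℝ f y w' = inner ℝ (ξ y) a - b * τ y := fun y => by
      rw [← hkey, hsymm]; simp
    -- The second factor vanishes at `y₁`, because `w'` is tangent there, and its derivative along
    -- `w` vanishes because `dX w = 0`. So the product rule gives Hessian zero on `w` and `w'`.
    have h2 : ∀ᶠ y in 𝓝 y₁, fderiv ℝ f y w' = τ y * (inner ℝ (X y) a - b) := by
      filter_upwards [hXe, hτne] with y hy1 hy2
      rw [h1, hy1]
      simp only [X₀, real_inner_smul_left]
      field_simp
    have h3 : inner ℝ (X y₁) a - b = 0 := by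
      have := h2.self_of_nhds
      rw [hw'] at this
      exact (mul_eq_zero.1 this.symm).resolve_left hτne.self_of_nhds
    have hd1 : HasFDerivAt (fun y => fderiv ℝ f y w') _ y₁ :=
      (ContinuousLinearMap.apply ℝ ℝ w').hasFDerivAt.comp y₁
        ((hf.smooth.fderiv_right (m := ∞) (by simp)).differentiable (by simp) y₁).hasFDerivAt
    have hd2 : HasFDerivAt (fun y => τ y * (inner ℝ (X y) a - b)) _ y₁ :=
      ((hτ.differentiable (by simp) y₁).hasFDerivAt).mul
        ((hXd.inner ℝ (hasFDerivAt_const a y₁)).sub_const b)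
    have h4 := DFunLike.congr_fun (hd1.unique (hd2.congr_of_eventuallyEq h2))
      (w : EuclideanSpace ℝ (Fin n))
    simpa [h3, hXw] using h4
  have h1 := LinearMap.finrank_range_add_finrank_ker M
  have h2 := Submodule.finrank_mono hMrange
  have h3 := LinearMap.finrank_range_add_finrank_ker (fderiv ℝ (fun y a => F a y) x).toLinearMap
  rw [LinearMap.range_eq_top.2 hsurj, finrank_top, finrank_euclideanSpace_fin,
    finrank_fintype_fun_eq_card] at h3
  have h4 := Submodule.finrank_mono hMker
  rw [Submodule.finrank_map_subtype_eq T M.ker] at h4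
  have h5 : finrank ℝ T + 1 = n := by
    rw [hT, hf.tangentSpaceAt_eq hy₁]; exact hf.finrank_ker
  omega

/-- The bordered Hessian of `f`, whose kernel is isomorphic to the space of null directions. -/
noncomputable def borderedHessian (f : EuclideanSpace ℝ (Fin n) → ℝ) (y : EuclideanSpace ℝ (Fin n)) :
    EuclideanSpace ℝ (Fin n) × ℝ →L[ℝ] EuclideanSpace ℝ (Fin n) × ℝ :=
  ((fderiv ℝ (gradient f) y).comp (ContinuousLinearMap.fst ℝ _ ℝ) +
    (ContinuousLinearMap.snd ℝ _ ℝ).smulRight (gradient f y)).prod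
      ((fderiv ℝ f y).comp (ContinuousLinearMap.fst ℝ _ ℝ))

theorem borderedHessian_apply (f : EuclideanSpace ℝ (Fin n) → ℝ) (y : EuclideanSpace ℝ (Fin n))
    (w : EuclideanSpace ℝ (Fin n)) (r : ℝ) : borderedHessian f y (w, r) =
      (fderiv ℝ (gradient f) y w + r • gradient f y, fderiv ℝ f y w) := rfl

theorem continuous_borderedHessian {f : EuclideanSpace ℝ (Fin n) → ℝ} (hf : ContDiff ℝ ∞ f) :
    Continuous (borderedHessian f) := by
  have h1 : Continuous (fderiv ℝ (gradient f)) :=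
    (contDiff_gradient hf).continuous_fderiv (by simp)
  have h2 := (contDiff_gradient hf).continuous
  have h3 : Continuous (fderiv ℝ f) := hf.continuous_fderiv (by simp)
  unfold borderedHessian
  have h4 : Continuous fun y => (fderiv ℝ (gradient f) y).comp
      (ContinuousLinearMap.fst ℝ (EuclideanSpace ℝ (Fin n)) ℝ) := h1.clm_comp continuous_const
  have h5 : Continuous fun y => (ContinuousLinearMap.snd ℝ (EuclideanSpace ℝ (Fin n)) ℝ).smulRight
      (gradient f y) := (ContinuousLinearMap.smulRightL ℝ _ _ _).continuous.comp h2
  have h6 : Continuous fun y => (fderiv ℝ f y).comp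
      (ContinuousLinearMap.fst ℝ (EuclideanSpace ℝ (Fin n)) ℝ) := h3.clm_comp continuous_const
  exact (ContinuousLinearMap.prodₗᵢ ℝ).continuous.comp ((h4.add h5).prodMk h6)

/-- The extra coordinate is a Lagrange multiplier for the normal part of the Hessian image; it is
determined by `w` because the gradient is nonzero. -/
theorem IsLocalEquation.finrank_ker_borderedHessian {S : Set (EuclideanSpace ℝ (Fin n))}
    {f : EuclideanSpace ℝ (Fin n) → ℝ} {y : EuclideanSpace ℝ (Fin n)}
    (hf : IsLocalEquation S y f) (hy : y ∈ S) :
    finrank ℝ (borderedHessian f y).toLinearMap.ker = finrank ℝ (nullDirections S f y) := by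
  have hmap : (borderedHessian f y).toLinearMap.ker.map (LinearMap.fst ℝ _ ℝ) =
      nullDirections S f y := by
    ext w
    rw [Submodule.mem_map, hf.mem_nullDirections_iff hy]
    constructor
    · rintro ⟨⟨w, r⟩, hw, rfl⟩
      have hw' : borderedHessian f y (w, r) = 0 := hw
      rw [borderedHessian_apply, Prod.mk_eq_zero] at hw'
      refine ⟨hw'.2, fun c hc => ?_⟩
      have h1 := congrArg (fun v => inner ℝ v c) hw'.1
      simp only [inner_add_left, inner_fderiv_gradient hf.smooth, real_inner_smul_left,
        inner_gradient_eq_fderiv f y c, hc, mul_zero, add_zero, inner_zero_left] at h1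
      exact h1
    · rintro ⟨h1, h2⟩
      have h3 : fderiv ℝ (gradient f) y w ∈ (ℝ ∙ gradient f y)ᗮᗮ := by
        rw [Submodule.mem_orthogonal']
        intro c hc
        rw [Submodule.mem_orthogonal_singleton_iff_inner_right, inner_gradient_eq_fderiv] at hc
        rw [inner_fderiv_gradient hf.smooth, h2 c hc]
      rw [Submodule.orthogonal_orthogonal, Submodule.mem_span_singleton] at h3
      obtain ⟨r, hr⟩ := h3
      refine ⟨(w, -r), ?_, rfl⟩
      rw [LinearMap.mem_ker]
      change borderedHessian f y (w, -r) = 0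
      rw [borderedHessian_apply, ← hr, h1]
      simp
  rw [← hmap]
  symm
  rw [← LinearMap.range_domRestrict]
  refine LinearMap.finrank_range_of_inj ?_
  rw [injective_iff_map_eq_zero]
  rintro ⟨⟨w, r⟩, hw⟩ h0
  have h0' : w = 0 := h0
  subst h0'
  have hw' : borderedHessian f y (0, r) = 0 := hw
  rw [borderedHessian_apply, Prod.mk_eq_zero, map_zero, zero_add, smul_eq_zero] at hw'
  have hr := hw'.1.resolve_right hf.gradient_ne
  subst hr
  rfl

/-- The tangent spaces vary with the point, but the bordered Hessian acts on a fixed space, so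
semicontinuity of its rank applies. -/
theorem IsLocalEquation.eventually_finrank_nullDirections_le {S : Set (EuclideanSpace ℝ (Fin n))}
    {f : EuclideanSpace ℝ (Fin n) → ℝ} {y : EuclideanSpace ℝ (Fin n)}
    (hf : IsLocalEquation S y f) (hy : y ∈ S) :
    ∀ᶠ y' in 𝓝 y, y' ∈ S → finrank ℝ (nullDirections S f y') ≤ finrank ℝ (nullDirections S f y) := by
  filter_upwards [hf.eventually, eventually_le_finrank_range
    (continuous_borderedHessian hf.smooth).continuousAt] with y' h1 h2 h3
  rw [← hf.finrank_ker_borderedHessian hy, ← h1.finrank_ker_borderedHessian h3]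
  have h4 := LinearMap.finrank_range_add_finrank_ker (borderedHessian f y).toLinearMap
  have h5 := LinearMap.finrank_range_add_finrank_ker (borderedHessian f y').toLinearMap
  omega

theorem InGeneralPosition.dualCurvaturesVanish {s : ℕ}
    {Γ : Fin s → Set (EuclideanSpace ℝ (Fin n))} (hgp : InGeneralPosition Γ)
    (hclosed : ∀ j, IsClosed (Γ j)) (hsm : ∀ j, IsSmoothHypersurface (Γ j)) (J : Finset (Fin s)) :
    DualCurvaturesVanish (J.card - 1) (dualSet (⋂ j ∈ J, Γ j)) := by
  set B := ⋂ j ∈ J, Γ j with hBdef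
  have hmemB : ∀ y, y ∈ B ↔ ∀ a : J, y ∈ Γ a := fun y => by simp [hBdef]
  have hBc : IsClosed B := isClosed_biInter fun j _ => hclosed j
  have hloc : ∀ x ∈ B, ∃ F : J → EuclideanSpace ℝ (Fin n) → ℝ, (∀ a, ContDiff ℝ ∞ (F a)) ∧
      LinearIndependent ℝ (fun a => gradient (F a) x) ∧
      ∀ᶠ y in 𝓝 x, (y ∈ B ↔ ∀ a, F a y = 0) := by
    intro x hx
    have hx' := (hmemB x).1 hx
    choose F hF using fun a : J => hsm a x (hx' a)
    refine ⟨F, fun a => (hF a).smooth,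
      hgp.linearIndependent_gradient hsm Subtype.val_injective hx' hF, ?_⟩
    filter_upwards [Filter.eventually_all.2 fun a => (hF a).eventually_mem_iff] with y hy
    rw [hmemB]
    exact forall_congr' hy
  intro A S hS hSB y₀ hy₀ f hf
  have hdense : ∀ y ∈ S, IsLocalEquation S y f → ∀ O ∈ 𝓝 y, ∃ y' ∈ S ∩ O, ∃ x ∈ B, ∃ c : ℝ,
      c ≠ 0 ∧ ∀ w r, fderiv ℝ f y' (w - r • y') =
        c * (inner ℝ (A (w, r)).1 x - (A (w, r)).2) := by
    intro y hy hfy O hO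
    refine exists_tangentHyperplane_dual_mem (fun x hx => ?_) A hSB hy hfy hO
    obtain ⟨F, hF, hli, hBF⟩ := hloc x hx
    exact exists_conormal_parametrization hx hF hli hBF
  -- At `y₀` itself the tangent hyperplane need not be dual to an affine point, so the dimension
  -- count is made at a nearby `y₁`, whose nullity does not exceed that of `y₀`.
  obtain ⟨y₁, ⟨hy₁, hle, hf₁⟩, x, hx, c, hc, hrel⟩ := hdense y₀ hy₀ hf _
    ((hf.eventually_finrank_nullDirections_le hy₀).and hf.eventually)
  obtain ⟨F, hF, hli, hBF⟩ := hloc x hx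
  have h := le_finrank_nullDirections_of_tangentHyperplane_dual_mem hBc A hdense hy₁ hf₁ hc hrel hF
    hli (hBF.mono fun y hy => hy.1)
  rw [Fintype.card_coe] at h
  exact h.trans (hle hy₁)

end DualCurvature

/-! ### The theorem. -/

theorem theorem3 (n s : ℕ) (hn : 2 ≤ n)
    (D : Set (EuclideanSpace ℝ (Fin n))) (Γ : Fin s → Set (EuclideanSpace ℝ (Fin n)))
    (hD : IsCompact D) (hDreg : closure (interior D) = D)
    (hDΓ : frontier D ⊆ ⋃ j, Γ j)
    (hclosed : ∀ j, IsClosed (Γ j)) (hsmooth : ∀ j, IsSmoothHypersurface (Γ j))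
    (hgp : InGeneralPosition Γ) :
    -- (a)
    (∀ J : Finset (Fin s), J.Nonempty → (⋂ j ∈ J, Γ j).Nonempty →
      DualCurvaturesVanish (J.card - 1) (dualSet (⋂ j ∈ J, Γ j))) ∧
    -- (b)
    (∀ (i : Fin s) (k : ℕ),
      (∀ x ∈ Γ i, ∀ f, IsLocalEquation (Γ i) x f →
        finrank ℝ (nullDirections (Γ i) f x) = k) →
      -- the dual set has codimension `k + 1`
      (∀ P ∈ Γ i, ∃ U : Set (EuclideanSpace ℝ (Fin n)), IsOpen U ∧ P ∈ U ∧
        IsProjectiveSubmanifoldOfCodim (k + 1) (dualSet (Γ i ∩ U))) ∧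
      -- the cones
      (1 ≤ k → ∀ P ∈ Γ i, ∀ f, IsLocalEquation (Γ i) P f →
        ∀ v ∈ tangentPlanesAt (Γ i) P,
        finrank ℝ (rulingSpace (Γ i) f P).direction = k ∧
        (rulingSpace (Γ i) f P : Set (EuclideanSpace ℝ (Fin n))) ⊆ Γ i ∧
        (∀ j, j ≠ i →
          v ∉ tangentPlanesAlong (Γ j) (rulingSpace (Γ i) f P) ∧
          projectiveCone v (tangentPlanesAlong (Γ j) (rulingSpace (Γ i) f P)) ⊆
            dualSet (Γ i ∩ Γ j) ∧
          (∀ x ∈ (rulingSpace (Γ i) f P : Set (EuclideanSpace ℝ (Fin n))) ∩ Γ j,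
            ∀ g, IsLocalEquation (Γ j) x g →
            ¬ (rulingSpace (Γ i) f P).direction ≤ tangentSpaceAt (Γ j) x →
            Disjoint (rulingSpace (Γ i) f P).direction (nullDirections (Γ j) g x) →
            ∃ U : Set (EuclideanSpace ℝ (Fin n)), IsOpen U ∧ x ∈ U ∧
              IsProjectiveSubmanifoldOfCodim (n - (k - 1))
                (tangentPlanesAlong (Γ j)
                  ((rulingSpace (Γ i) f P : Set (EuclideanSpace ℝ (Fin n))) ∩ U)))) ∧
        (P ∈ frontier D → ∃ j, j ≠ i ∧
          (tangentPlanesAlong (Γ j) (rulingSpace (Γ i) f P)).Nonempty))) := by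
  refine ⟨fun J _ _ => hgp.dualCurvaturesVanish hclosed hsmooth J, fun i k hS => ⟨?_, ?_⟩⟩
  · intro P hP
    obtain ⟨f, hf⟩ := hsmooth i P hP
    exact hf.exists_isProjectiveSubmanifold_dualSet hS hP
  · intro hk P hP f hf v hv
    have hdir : finrank ℝ (rulingSpace (Γ i) f P).direction = k := by
      rw [rulingSpace, AffineSubspace.direction_mk', hS P hP f hf]
    refine ⟨hdir, hf.rulingSpace_subset (hclosed i) (hsmooth i) hS hP, fun j hj => ⟨?_, ?_, ?_⟩, ?_⟩
    · exact hgp.notMem_tangentPlanesAlong hclosed hsmooth hS hf hP hj hv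
    · exact hgp.projectiveCone_subset hclosed hsmooth hS hf hP hj hv
    · intro x hx g hg hL hd
      have h := hg.exists_isProjectiveSubmanifold_of_disjoint hx.2 hx.1 hL hd
      rwa [hdir] at h
    · intro hPD
      obtain ⟨j, hj, y, hyL, hyj⟩ := hf.exists_mem_rulingSpace_inter hD hDreg hDΓ hclosed hsmooth
        hS hk hP hPD
      exact ⟨j, hj, (hsmooth j).tangentPlanesAlong_nonempty ⟨hyL, hyj⟩⟩
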